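/- Let $\sigma=\pm1$ and let $\rho_1,\rho_2$ be real numbers with $-1<\rho_1\rho_2<0$ if $\sigma=1$, and $0<\rho_1\rho_2<1$ if $\sigma=-1$. Put $\rho=1+\sigma\rho_1\rho_2$, $\hat\rho=\sqrt{-\sigma\rho_1\rho_2\rho}$ and $\phi(x,t)=\rho\left(\frac{\rho_2}{\rho_1}x+\frac{\rho_1}{\rho_2}t\right)$. Define $\alpha_r,\beta_r,\theta_r,\vartheta_r,\zeta_r,s_r$ $(r\ge1)$ as the coefficients of the expansions in powers of $\kappa$ $$\frac{\rho_2}{\rho_1}\hat\rho(e^\kappa-1)=\sum_{r\ge1}\alpha_r\kappa^r,\qquad \frac{\rho_1\rho}{\rho_2}\left[\frac1{\hat\rho+\mathrm i\rho}-\frac1{e^\kappa\hat\rho+\mathrm i\rho}\right]=\sum_{r\ge1}\beta_r\kappa^r,\qquad \ln\frac{e^\kappa\hat\rho+\mathrm i\rho}{\hat\rho+\mathrm i\rho}=\sum_{r\ge1}\theta_r\kappa^r,$$ $$\ln\frac{e^\kappa\hat\rho+\mathrm i\sigma\rho_1\rho_2}{\hat\rho+\mathrm i\sigma\rho_1\rho_2}=\sum_{r\ge1}\vartheta_r\kappa^r,\qquad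 \ln e^\kappa=\sum_{r\ge1}\zeta_r\kappa^r,\qquad \ln\left(\frac2\kappa\,\frac{e^\kappa-1}{e^\kappa+1}\right)=\sum_{r\ge1}s_r\kappa^r.$$ Let $a_1,a_2,\dots$ be arbitrary complex numbers, and for integers $n,k,l$ and real $x,t$ put $$x_r^+(n,k,l)=\alpha_rx+\beta_rt+\left(n+\tfrac12\right)\theta_r+k\vartheta_r+l\zeta_r+a_r,\qquad x_r^-(n,k,l)=\alpha_rx+\beta_r^*t-\left(n+\tfrac12\right)\theta_r^*-k\vartheta_r^*-l\zeta_r+a_r^*,$$ where $^*$ is complex conjugation. Write $\boldsymbol x^\pm=(x_1^\pm,x_2^\pm,\dots)$, $\boldsymbol s=(s_1,s_2,\dots)$, and let $S_j$ be the elementary Schur polynomials, $\sum_{j\ge0}S_j(\boldsymbol x)\lambda^j=\exp\left(\sum_{j\ge1}x_j\lambda^j\right)$. For an integer $N\ge0$ let $$\sigma_{n,k,l}=\det_{1\le i,j\le N}\left(m^{(n,k,l)}_{2i-1,2j-1}\right),\qquad m^{(n,k,l)}_{i,j}=\sum_{\gamma=0}^{\min(i,j)}\frac1{4^\gamma}S_{i-\gamma}\left(\boldsymbol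 x^+(n,k,l)+\gamma\boldsymbol s\right)S_{j-\gamma}\left(\boldsymbol x^-(n,k,l)+\gamma\boldsymbol s\right)$$ (an empty determinant is $1$), and let $f=\sigma_{0,0,0}$, $g=\sigma_{-1,1,0}$, $h=\sigma_{-1,0,1}$. Then: 1. $f^*=\sigma_{-1,0,0}$, and $f(x,t)\ne0$ for all real $x,t$; 2. every $\sigma_{n,k,l}$ (in particular $f,g,h$) is a polynomial in $x$ and $t$ with complex coefficients; 3. the functions $$u=\rho_1\frac{g}{f^*}e^{\mathrm i\phi},\qquad v=\rho_2\frac{h}{f}e^{\mathrm i\phi}$$ are continuously differentiable on $\mathbb R^2$ and satisfy there the massive Thirring model $$\mathrm iu_x+v+\sigma u|v|^2=0,\qquad \mathrm iv_t+u+\sigma v|u|^2=0;$$ 4. they are localized in space and time on the plane-wave background: $u-\rho_1e^{\mathrm i\phi}\to0$ and $v-\rho_2e^{\mathrm i\phi}\to0$ as $x^2+t^2\to\infty$. -/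

import Mathlib

open Complex

namespace MassiveThirring

noncomputable section

/-! ### The equations -/

/-- `(u, v)` is a classical solution on the whole plane, in light-cone coordinates, of
`i u_x + v + σ u |v|² = 0`, `i v_t + u + σ v |u|² = 0`. -/
def IsSolution (σ : ℝ) (u v : ℝ → ℝ → ℂ) : Prop :=
  ContDiff ℝ 1 (fun p : ℝ × ℝ => u p.1 p.2) ∧
  ContDiff ℝ 1 (fun p : ℝ × ℝ => v p.1 p.2) ∧
  ∀ x t : ℝ,
    I * deriv (fun y : ℝ => u y t) x + v x t + (σ : ℂ) * u x t * (‖v x t‖ : ℂ) ^ 2 = 0 ∧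
    I * deriv (fun r : ℝ => v x r) t + u x t + (σ : ℂ) * v x t * (‖u x t‖ : ℂ) ^ 2 = 0

/-- `F` is a polynomial function, with complex coefficients, of the two real variables. -/
def IsPolynomialFun (F : ℝ → ℝ → ℂ) : Prop :=
  ∃ P : MvPolynomial (Fin 2) ℂ, ∀ x t : ℝ, F x t = MvPolynomial.eval ![(x : ℂ), (t : ℂ)] P

/-! ### Elementary Schur polynomials -/

/-- `S_j(x)`, where `∑ S_j(x) λ^j = exp (∑_{r ≥ 1} x_r λ^r)`; the value `x 0` is not used. -/
def schur (x : ℕ → ℂ) (j : ℕ) : ℂ :=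
  PowerSeries.coeff j
    ((PowerSeries.exp ℂ).subst (PowerSeries.mk fun r => if r = 0 then 0 else x r))

/-! ### Background constants and expansion coefficients -/

/-- `ρ = 1 + σ ρ₁ ρ₂`. -/
def rho (σ ρ₁ ρ₂ : ℝ) : ℝ := 1 + σ * ρ₁ * ρ₂

/-- `ρ̂ = √(-σ ρ₁ ρ₂ ρ)`. -/
def rhoHat (σ ρ₁ ρ₂ : ℝ) : ℝ := Real.sqrt (-σ * ρ₁ * ρ₂ * rho σ ρ₁ ρ₂)

/-- The power series of `e^κ ρ̂ + c` in `κ`. -/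
def shiftedExp (σ ρ₁ ρ₂ : ℝ) (c : ℂ) : PowerSeries ℂ :=
  PowerSeries.exp ℂ * PowerSeries.C (rhoHat σ ρ₁ ρ₂ : ℂ) + PowerSeries.C c

/-- `(ρ₂ / ρ₁) ρ̂ (e^κ - 1) = ∑ α_r κ^r`. -/
def alpha (σ ρ₁ ρ₂ : ℝ) (r : ℕ) : ℂ :=
  PowerSeries.coeff r
    (PowerSeries.C ((ρ₂ : ℂ) / ρ₁ * rhoHat σ ρ₁ ρ₂) * (PowerSeries.exp ℂ - 1))

/-- `(ρ₁ ρ / ρ₂) (1 / (ρ̂ + i ρ) - 1 / (e^κ ρ̂ + i ρ)) = ∑ β_r κ^r`. -/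
def beta (σ ρ₁ ρ₂ : ℝ) (r : ℕ) : ℂ :=
  PowerSeries.coeff r
    (PowerSeries.C ((ρ₁ : ℂ) * rho σ ρ₁ ρ₂ / ρ₂) *
      (PowerSeries.C (1 / ((rhoHat σ ρ₁ ρ₂ : ℂ) + I * rho σ ρ₁ ρ₂)) -
        (shiftedExp σ ρ₁ ρ₂ (I * rho σ ρ₁ ρ₂))⁻¹))

/-- `ln ((e^κ ρ̂ + i ρ) / (ρ̂ + i ρ)) = ∑ θ_r κ^r`. -/
def theta (σ ρ₁ ρ₂ : ℝ) (r : ℕ) : ℂ :=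
  PowerSeries.coeff r
    (PowerSeries.logOf
      (shiftedExp σ ρ₁ ρ₂ (I * rho σ ρ₁ ρ₂) *
        PowerSeries.C (1 / ((rhoHat σ ρ₁ ρ₂ : ℂ) + I * rho σ ρ₁ ρ₂))))

/-- `ln ((e^κ ρ̂ + i σ ρ₁ ρ₂) / (ρ̂ + i σ ρ₁ ρ₂)) = ∑ ϑ_r κ^r`. -/
def vartheta (σ ρ₁ ρ₂ : ℝ) (r : ℕ) : ℂ :=
  PowerSeries.coeff r
    (PowerSeries.logOf
      (shiftedExp σ ρ₁ ρ₂ (I * σ * ρ₁ * ρ₂) *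
        PowerSeries.C (1 / ((rhoHat σ ρ₁ ρ₂ : ℂ) + I * σ * ρ₁ * ρ₂))))

/-- `ln e^κ = ∑ ζ_r κ^r`. -/
def zetaCoeff (r : ℕ) : ℂ :=
  PowerSeries.coeff r (PowerSeries.logOf (PowerSeries.exp ℂ))

/-- The power series of `(e^κ - 1) / κ`, obtained by shifting the coefficients of `e^κ - 1`. -/
def expSubOneDiv : PowerSeries ℂ :=
  PowerSeries.mk fun n => PowerSeries.coeff (n + 1) (PowerSeries.exp ℂ - 1)

/-- `ln ((2 / κ) (e^κ - 1) / (e^κ + 1)) = ∑ s_r κ^r`. -/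
def sCoeff (r : ℕ) : ℂ :=
  PowerSeries.coeff r
    (PowerSeries.logOf (2 * expSubOneDiv * (PowerSeries.exp ℂ + 1)⁻¹))

/-! ### Tau functions and the solutions -/

/-- `x_r⁺(n,k,l) = α_r x + β_r t + (n + 1/2) θ_r + k ϑ_r + l ζ_r + a_r`. -/
def xPlus (σ ρ₁ ρ₂ : ℝ) (a : ℕ → ℂ) (n k l : ℤ) (x t : ℝ) (r : ℕ) : ℂ :=
  alpha σ ρ₁ ρ₂ r * x + beta σ ρ₁ ρ₂ r * t + ((n : ℂ) + 1 / 2) * theta σ ρ₁ ρ₂ r +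
    k * vartheta σ ρ₁ ρ₂ r + l * zetaCoeff r + a r

/-- `x_r⁻(n,k,l) = α_r x + β_r^* t - (n + 1/2) θ_r^* - k ϑ_r^* - l ζ_r + a_r^*`. -/
def xMinus (σ ρ₁ ρ₂ : ℝ) (a : ℕ → ℂ) (n k l : ℤ) (x t : ℝ) (r : ℕ) : ℂ :=
  alpha σ ρ₁ ρ₂ r * x + starRingEnd ℂ (beta σ ρ₁ ρ₂ r) * t -
    ((n : ℂ) + 1 / 2) * starRingEnd ℂ (theta σ ρ₁ ρ₂ r) -
    k * starRingEnd ℂ (vartheta σ ρ₁ ρ₂ r) - l * zetaCoeff r + starRingEnd ℂ (a r)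

/-- `m_{i,j}^{(n,k,l)} = ∑_{γ=0}^{min(i,j)} 4^{-γ} S_{i-γ}(x⁺ + γ s) S_{j-γ}(x⁻ + γ s)`. -/
def entry (σ ρ₁ ρ₂ : ℝ) (a : ℕ → ℂ) (n k l : ℤ) (x t : ℝ) (i j : ℕ) : ℂ :=
  ∑ γ ∈ Finset.range (min i j + 1),
    1 / 4 ^ γ *
      schur (fun r => xPlus σ ρ₁ ρ₂ a n k l x t r + γ * sCoeff r) (i - γ) *
      schur (fun r => xMinus σ ρ₁ ρ₂ a n k l x t r + γ * sCoeff r) (j - γ)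

/-- `σ_{n,k,l} = det_{1 ≤ i, j ≤ N} (m_{2i-1,2j-1}^{(n,k,l)})`; `i : Fin N` counts from `0`. -/
def tau (σ ρ₁ ρ₂ : ℝ) (a : ℕ → ℂ) (N : ℕ) (n k l : ℤ) (x t : ℝ) : ℂ :=
  Matrix.det (Matrix.of fun i j : Fin N =>
    entry σ ρ₁ ρ₂ a n k l x t (2 * (i : ℕ) + 1) (2 * (j : ℕ) + 1))

/-- `f = σ_{0,0,0}`. -/
def tauF (σ ρ₁ ρ₂ : ℝ) (a : ℕ → ℂ) (N : ℕ) (x t : ℝ) : ℂ := tau σ ρ₁ ρ₂ a N 0 0 0 x t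

/-- `g = σ_{-1,1,0}`. -/
def tauG (σ ρ₁ ρ₂ : ℝ) (a : ℕ → ℂ) (N : ℕ) (x t : ℝ) : ℂ := tau σ ρ₁ ρ₂ a N (-1) 1 0 x t

/-- `h = σ_{-1,0,1}`. -/
def tauH (σ ρ₁ ρ₂ : ℝ) (a : ℕ → ℂ) (N : ℕ) (x t : ℝ) : ℂ := tau σ ρ₁ ρ₂ a N (-1) 0 1 x t

/-- The plane-wave factor `exp (i (1 + σ ρ₁ ρ₂) ((ρ₂/ρ₁) x + (ρ₁/ρ₂) t))`. -/
def planeWave (σ ρ₁ ρ₂ : ℝ) (x t : ℝ) : ℂ :=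
  Complex.exp (I * (1 + σ * ρ₁ * ρ₂) * ((ρ₂ : ℂ) / ρ₁ * x + (ρ₁ : ℂ) / ρ₂ * t))

/-- `u = ρ₁ (g / f^*) e^{iφ}`. -/
def rogueU (σ ρ₁ ρ₂ : ℝ) (a : ℕ → ℂ) (N : ℕ) (x t : ℝ) : ℂ :=
  ρ₁ * (tauG σ ρ₁ ρ₂ a N x t / starRingEnd ℂ (tauF σ ρ₁ ρ₂ a N x t)) * planeWave σ ρ₁ ρ₂ x t

/-- `v = ρ₂ (h / f) e^{iφ}`. -/
def rogueV (σ ρ₁ ρ₂ : ℝ) (a : ℕ → ℂ) (N : ℕ) (x t : ℝ) : ℂ :=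
  ρ₂ * (tauH σ ρ₁ ρ₂ a N x t / tauF σ ρ₁ ρ₂ a N x t) * planeWave σ ρ₁ ρ₂ x t

end

end MassiveThirring

namespace MassiveThirring
noncomputable section

open PowerSeries (coeff constantCoeff mk)

/-! ### Generating series of the elementary Schur polynomials -/

/-! The generating series of the entries `m_{i,j}` has a closed form. The sum over `γ` is a
geometric series in `tanh(κ/2) tanh(λ/2)`, and `1 - tanh(κ/2) tanh(λ/2) = 2(e^κ +
e^λ)/((e^κ+1)(e^λ+1))`, so the series is a Cauchy kernel `A(κ)B(λ)/(e^κ+e^λ)`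
(`sum_schur_mul_schur`). With `p = ρ̂e^κ` and `q = ρ̂e^λ`, a unit step in `n`, `k` or `l` multiplies
it by a constant times `(p+c)/(c-q)`, where `c = iρ`, `iσρ₁ρ₂` or `0`.

The `x`-derivative multiplies the kernel by `(ρ₂/ρ₁)(p+q)` plus a constant, which cancels the Cauchy
denominator: up to a multiple of itself, the matrix has a derivative of rank one. The `t`-derivative
behaves in the same way in the variable `-1/(p+iρ)`. The shifts are rank-one perturbations as well,
so the matrix determinant lemma yields one bilinear identity covering both flows
(`hasDerivAt_det_quotient`, `hasDerivAt_shift_quotient`).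

Keeping only odd indices makes the determinants blind to even factors with constant term `1`. As
`(iρ)(iσρ₁ρ₂) = ρ̂²`, the series `(p+iρ)(p+iσρ₁ρ₂)/p` is even in `κ`, whence `σ_{n+1,k+1,l-1} =
σ_{n,k,l}` (`tau_reduction`). Together with `conj_tau`, this identifies every determinant in four
instances of the bilinear identity with one of `f`, `g`, `h` or a conjugate. Writing `g/f^* =
(g/f)(f/f^*)` and `h/f = (h/f^*)(f^*/f)` turns these instances into the Thirring equations.

For `f ≠ 0`, a null vector `v` of the matrix defines Hermitian moments `K(a,b)`, obtained by
inserting `e^{aκ}e^{bλ}` into the kernel. The Cauchy denominator gives `K(a+1,b) + K(a,b+1)` the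
rank-one form `conj(φ_a) φ_b`, and evenness supplies further linear relations. These force every
`φ_a` to vanish (`moments_eq_zero`), and then `v = 0`.

For localization, `S_n(x^±)` grows like `z^n/n!` with `z = α₁x + β₁t` for `x⁺`, and with its
conjugate for `x⁻`. The dominant part of each determinant comes from `γ = 0, …, N-1`; its
coefficient is the square of a nonzero determinant independent of `n`, `k`, `l` (`tendsto_det_div`),
so all ratios of determinants tend to `1`. -/

/-- The exponent `∑_{r ≥ 1} x_r κ^r`. -/
def exponent (x : ℕ → ℂ) : PowerSeries ℂ := mk fun r => if r = 0 then 0 else x r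

/-- The generating series `∑ S_j(x) κ^j`. -/
def schurSeries (x : ℕ → ℂ) : PowerSeries ℂ := (PowerSeries.exp ℂ).subst (exponent x)

/-- Complex conjugation of the coefficients. -/
def conjSeries : PowerSeries ℂ →+* PowerSeries ℂ := PowerSeries.map (starRingEnd ℂ)

theorem coeff_schurSeries (x : ℕ → ℂ) (j : ℕ) : coeff j (schurSeries x) = schur x j := rfl

theorem coeff_conjSeries (F : PowerSeries ℂ) (j : ℕ) :
    coeff j (conjSeries F) = starRingEnd ℂ (coeff j F) := by
  simp [conjSeries]

theorem coeff_exponent_succ (x : ℕ → ℂ) (j : ℕ) : coeff (j + 1) (exponent x) = x (j + 1) := by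
  simp [exponent]

theorem constantCoeff_exponent (x : ℕ → ℂ) : constantCoeff (exponent x) = 0 := by
  simp [exponent, ← PowerSeries.coeff_zero_eq_constantCoeff_apply]

theorem hasSubst_exponent (x : ℕ → ℂ) : PowerSeries.HasSubst (exponent x) :=
  PowerSeries.HasSubst.of_constantCoeff_zero' (constantCoeff_exponent x)

theorem exponent_coeff {F : PowerSeries ℂ} (hF : constantCoeff F = 0) :
    exponent (fun r => coeff r F) = F := by
  ext n
  rcases n with _ | n
  · simp [exponent, hF]
  · simp [exponent]

theorem exponent_add (x y : ℕ → ℂ) :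
    exponent (fun r => x r + y r) = exponent x + exponent y := by
  ext n
  rcases n with _ | n <;> simp [exponent]

theorem constantCoeff_subst {F G : PowerSeries ℂ} (hG : constantCoeff G = 0) :
    constantCoeff (F.subst G) = constantCoeff F := by
  have hs : PowerSeries.HasSubst G := PowerSeries.HasSubst.of_constantCoeff_zero' hG
  have h1 : constantCoeff ((F - PowerSeries.C (constantCoeff F)).subst G) = 0 :=
    PowerSeries.constantCoeff_subst_eq_zero hG _ (by simp)
  rw [PowerSeries.subst_sub hs, map_sub, sub_eq_zero] at h1
  rw [h1]
  have := PowerSeries.subst_C (a := G) (constantCoeff F)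
  rw [this]
  exact PowerSeries.constantCoeff_C _

theorem constantCoeff_schurSeries (x : ℕ → ℂ) : constantCoeff (schurSeries x) = 1 := by
  rw [schurSeries, constantCoeff_subst (constantCoeff_exponent x), PowerSeries.constantCoeff_exp]

theorem schur_zero (x : ℕ → ℂ) : schur x 0 = 1 := by
  rw [← coeff_schurSeries, PowerSeries.coeff_zero_eq_constantCoeff_apply,
    constantCoeff_schurSeries]

theorem derivative_schurSeries (x : ℕ → ℂ) :
    PowerSeries.derivative ℂ (schurSeries x) =
      PowerSeries.derivative ℂ (exponent x) * schurSeries x := by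
  rw [schurSeries, PowerSeries.derivative_subst (hasSubst_exponent x), PowerSeries.derivative_exp,
    mul_comm]

/-- Uniqueness for the linear differential equation `F' = H F`. -/
theorem eq_of_derivative_eq {F G H : PowerSeries ℂ} (hF : PowerSeries.derivative ℂ F = H * F)
    (hG : PowerSeries.derivative ℂ G = H * G) (h0 : constantCoeff F = constantCoeff G) :
    F = G := by
  ext n
  induction n using Nat.strong_induction_on with
  | _ n ih =>
    rcases n with _ | n
    · simpa using h0
    · have h1 := congrArg (coeff n) hF
      have h2 := congrArg (coeff n) hG
      rw [PowerSeries.coeff_derivative, PowerSeries.coeff_mul] at h1 h2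
      have h3 : ∑ p ∈ Finset.HasAntidiagonal.antidiagonal n, coeff p.1 H * coeff p.2 F =
          ∑ p ∈ Finset.HasAntidiagonal.antidiagonal n, coeff p.1 H * coeff p.2 G := by
        refine Finset.sum_congr rfl fun p hp => ?_
        have hp' := Finset.HasAntidiagonal.mem_antidiagonal.mp hp
        rw [ih p.2 (by omega)]
      have hn : (n : ℂ) + 1 ≠ 0 := Nat.cast_add_one_ne_zero n
      exact mul_right_cancel₀ hn (h1.trans (h3.trans h2.symm))

/-- The exponential is handled throughout as the normalized solution of a linear differential
equation; the addition law, conjugation and the inverse relation with the logarithm all follow from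
this uniqueness. -/
theorem schurSeries_eq {x : ℕ → ℂ} {F : PowerSeries ℂ} (h0 : constantCoeff F = 1)
    (hF : PowerSeries.derivative ℂ F = PowerSeries.derivative ℂ (exponent x) * F) :
    schurSeries x = F :=
  eq_of_derivative_eq (derivative_schurSeries x) hF (by rw [h0, constantCoeff_schurSeries])

theorem schurSeries_add (x y : ℕ → ℂ) :
    schurSeries (fun r => x r + y r) = schurSeries x * schurSeries y := by
  refine schurSeries_eq (by simp [constantCoeff_schurSeries]) ?_
  rw [Derivation.leibniz, derivative_schurSeries, derivative_schurSeries, exponent_add, map_add,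
    smul_eq_mul, smul_eq_mul]
  ring

theorem schurSeries_zero : schurSeries (fun _ => 0) = 1 := by
  refine schurSeries_eq (by simp) ?_
  have : exponent (fun _ => 0) = 0 := by ext n; simp [exponent]
  rw [this, map_zero, zero_mul]
  exact PowerSeries.derivative_one

theorem schurSeries_nat_mul (γ : ℕ) (x : ℕ → ℂ) :
    schurSeries (fun r => γ * x r) = schurSeries x ^ γ := by
  induction γ with
  | zero => simpa using schurSeries_zero
  | succ γ ih =>
    rw [pow_succ, ← ih, ← schurSeries_add]
    congr 1
    ext r
    push_cast
    ring

theorem schurSeries_conj (x : ℕ → ℂ) :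
    schurSeries (fun r => starRingEnd ℂ (x r)) = conjSeries (schurSeries x) := by
  have hd : ∀ F : PowerSeries ℂ, PowerSeries.derivative ℂ (conjSeries F) =
      conjSeries (PowerSeries.derivative ℂ F) := by
    intro F
    ext n
    simp [PowerSeries.coeff_derivative, coeff_conjSeries]
  refine schurSeries_eq ?_ ?_
  · rw [← PowerSeries.coeff_zero_eq_constantCoeff_apply, coeff_conjSeries,
      PowerSeries.coeff_zero_eq_constantCoeff_apply, constantCoeff_schurSeries, map_one]
  · rw [hd, derivative_schurSeries, map_mul, ← hd]
    congr 2
    ext n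
    rcases n with _ | n <;> simp [exponent, coeff_conjSeries]

theorem derivative_logOf {F : PowerSeries ℂ} (hF : constantCoeff F = 1) :
    PowerSeries.derivative ℂ (PowerSeries.logOf F) * F = PowerSeries.derivative ℂ F := by
  have hs : PowerSeries.HasSubst (F - 1) :=
    PowerSeries.HasSubst.of_constantCoeff_zero' (by simp [hF])
  have h1 : PowerSeries.derivative ℂ (PowerSeries.log ℂ) * (1 + PowerSeries.X) = 1 := by
    rw [PowerSeries.deriv_log]
    ext n
    rw [mul_add, mul_one, map_add]
    rcases n with _ | n
    · simp
    · rw [PowerSeries.coeff_succ_mul_X, PowerSeries.coeff_mk, PowerSeries.coeff_mk,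
        PowerSeries.coeff_one, if_neg (Nat.succ_ne_zero n), ← map_add]
      simp [pow_succ]
  have h2 := congrArg (PowerSeries.subst (F - 1)) h1
  have h3 : PowerSeries.subst (F - 1) (1 : PowerSeries ℂ) = 1 := by
    rw [← PowerSeries.coe_substAlgHom hs, map_one]
  rw [PowerSeries.subst_mul hs, PowerSeries.subst_add hs, PowerSeries.subst_X hs, h3,
    add_sub_cancel] at h2
  rw [PowerSeries.logOf_eq, PowerSeries.derivative_subst hs, map_sub, PowerSeries.derivative_one,
    sub_zero, mul_right_comm, h2, one_mul]

/-- This replaces the coefficients `θ`, `ϑ`, `ζ`, `s` by the explicit functions whose logarithms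
define them. -/
theorem schurSeries_logOf {F : PowerSeries ℂ} (hF : constantCoeff F = 1) :
    schurSeries (fun r => coeff r (PowerSeries.logOf F)) = F := by
  refine schurSeries_eq hF ?_
  rw [exponent_coeff (PowerSeries.constantCoeff_logOf hF), derivative_logOf hF]

/-- Coefficient form of `S' = E'S` for the exponent `E`. The recursion involves only lower-order
`S_j`, and so reduces scaling, differentiability, limits and polynomiality to strong induction. -/
theorem schur_succ (x : ℕ → ℂ) (n : ℕ) :
    schur x (n + 1) * (n + 1) =
      ∑ p ∈ Finset.HasAntidiagonal.antidiagonal n, x (p.1 + 1) * (p.1 + 1) * schur x p.2 := by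
  have h := congrArg (coeff n) (derivative_schurSeries x)
  rw [PowerSeries.coeff_derivative, PowerSeries.coeff_mul] at h
  simpa only [PowerSeries.coeff_derivative, coeff_exponent_succ, coeff_schurSeries] using h

/-- Weighted homogeneity, with `x_r` of weight `r`. -/
theorem schur_scale (x : ℕ → ℂ) (c : ℂ) (n : ℕ) :
    schur (fun r => c ^ r * x r) n = c ^ n * schur x n := by
  induction n using Nat.strong_induction_on with
  | _ n ih =>
    rcases n with _ | n
    · simp [schur_zero]
    · have hn : (n : ℂ) + 1 ≠ 0 := Nat.cast_add_one_ne_zero n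
      refine mul_right_cancel₀ hn ?_
      rw [schur_succ, mul_assoc, schur_succ, Finset.mul_sum]
      refine Finset.sum_congr rfl fun p hp => ?_
      have hp' := Finset.HasAntidiagonal.mem_antidiagonal.mp hp
      rw [ih p.2 (by omega), ← hp']
      ring

/-- The coefficients of the exponential depend differentiably on those of the exponent. -/
theorem hasDerivAt_schur {x : ℝ → ℕ → ℂ} {s : ℝ} {F : PowerSeries ℂ} (hF : constantCoeff F = 0)
    (hx : ∀ r, HasDerivAt (fun y => x y (r + 1)) (coeff (r + 1) F) s) (n : ℕ) :
    HasDerivAt (fun y => schur (x y) n) (coeff n (F * schurSeries (x s))) s := by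
  induction n using Nat.strong_induction_on with
  | _ n ih =>
    rcases n with _ | n
    · simp only [schur_zero]
      rw [PowerSeries.coeff_zero_eq_constantCoeff_apply, map_mul, hF, zero_mul]
      exact hasDerivAt_const _ _
    · have hn : (n : ℂ) + 1 ≠ 0 := Nat.cast_add_one_ne_zero n
      have key : HasDerivAt (fun y => ∑ p ∈ Finset.HasAntidiagonal.antidiagonal n,
          x y (p.1 + 1) * (p.1 + 1) * schur (x y) p.2)
          (∑ p ∈ Finset.HasAntidiagonal.antidiagonal n,
            (coeff (p.1 + 1) F * (p.1 + 1) * schur (x s) p.2 +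
              x s (p.1 + 1) * (p.1 + 1) * coeff p.2 (F * schurSeries (x s)))) s := by
        refine HasDerivAt.fun_sum fun p hp => ?_
        have hp' := Finset.HasAntidiagonal.mem_antidiagonal.mp hp
        exact ((hx p.1).mul_const _).mul (ih p.2 (by omega))
      have hfun : (fun y => schur (x y) (n + 1)) = fun y => (∑ p ∈ Finset.HasAntidiagonal.antidiagonal n,
          x y (p.1 + 1) * (p.1 + 1) * schur (x y) p.2) / ((n : ℂ) + 1) := by
        funext y
        rw [← schur_succ, mul_div_cancel_right₀ _ hn]
      rw [hfun]
      -- The Leibniz rule in `κ` for `F * S`, with `S' = E'S`, gives a recursion that matches the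
      -- differentiated `schur_succ` term by term.
      have h := congrArg (coeff n) (Derivation.leibniz (PowerSeries.derivative ℂ) F
        (schurSeries (x s)))
      rw [derivative_schurSeries, PowerSeries.coeff_derivative] at h
      have hval : coeff (n + 1) (F * schurSeries (x s)) = (∑ p ∈ Finset.HasAntidiagonal.antidiagonal n,
            (coeff (p.1 + 1) F * (p.1 + 1) * schur (x s) p.2 +
              x s (p.1 + 1) * (p.1 + 1) * coeff p.2 (F * schurSeries (x s)))) / ((n : ℂ) + 1) := by
        rw [eq_div_iff hn, h, Finset.sum_add_distrib, smul_eq_mul, smul_eq_mul, add_comm, map_add]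
        congr 1
        · rw [mul_comm, PowerSeries.coeff_mul]
          simp only [PowerSeries.coeff_derivative, coeff_schurSeries]
        · rw [mul_left_comm, PowerSeries.coeff_mul]
          simp only [PowerSeries.coeff_derivative, coeff_exponent_succ]
      rw [hval]
      exact key.div_const _

theorem tendsto_schur {ι : Type*} {l : Filter ι} {x : ι → ℕ → ℂ} {y : ℕ → ℂ}
    (h : ∀ r, Filter.Tendsto (fun i => x i (r + 1)) l (nhds (y (r + 1)))) (n : ℕ) :
    Filter.Tendsto (fun i => schur (x i) n) l (nhds (schur y n)) := by
  induction n using Nat.strong_induction_on with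
  | _ n ih =>
    rcases n with _ | n
    · simp only [schur_zero]
      exact tendsto_const_nhds
    · have hn : (n : ℂ) + 1 ≠ 0 := Nat.cast_add_one_ne_zero n
      have hfun : ∀ z : ℕ → ℂ, schur z (n + 1) = (∑ p ∈ Finset.HasAntidiagonal.antidiagonal n,
          z (p.1 + 1) * (p.1 + 1) * schur z p.2) / ((n : ℂ) + 1) := fun z => by
        rw [← schur_succ, mul_div_cancel_right₀ _ hn]
      simp only [hfun]
      refine Filter.Tendsto.div_const (tendsto_finsetSum _ fun p hp => ?_) _
      have hp' := Finset.HasAntidiagonal.mem_antidiagonal.mp hp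
      exact ((h p.1).mul_const _).mul (ih p.2 (by omega))

/-! ### Power series in two variables and the Cauchy kernel -/

/-- A series in the first variable, as a series in two variables. -/
def inl : PowerSeries ℂ →+* PowerSeries (PowerSeries ℂ) := PowerSeries.map PowerSeries.C

/-- A series in the second variable, as a series in two variables. -/
def inr : PowerSeries ℂ →+* PowerSeries (PowerSeries ℂ) := PowerSeries.C

/-- The coefficient of `κ^i λ^j`. -/
def coeff₂ (i j : ℕ) (F : PowerSeries (PowerSeries ℂ)) : ℂ := coeff j (coeff i F)

theorem coeff₂_add (i j : ℕ) (F G : PowerSeries (PowerSeries ℂ)) :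
    coeff₂ i j (F + G) = coeff₂ i j F + coeff₂ i j G := by simp [coeff₂]

theorem coeff₂_sub (i j : ℕ) (F G : PowerSeries (PowerSeries ℂ)) :
    coeff₂ i j (F - G) = coeff₂ i j F - coeff₂ i j G := by simp [coeff₂]

theorem coeff₂_sum {ι : Type*} (i j : ℕ) (s : Finset ι) (F : ι → PowerSeries (PowerSeries ℂ)) :
    coeff₂ i j (∑ k ∈ s, F k) = ∑ k ∈ s, coeff₂ i j (F k) := by simp [coeff₂]

theorem inl_C (c : ℂ) : inl (PowerSeries.C c) = inr (PowerSeries.C c) := by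
  simp [inl, inr]

theorem coeff₂_inl_mul (i j : ℕ) (A : PowerSeries ℂ) (F : PowerSeries (PowerSeries ℂ)) :
    coeff₂ i j (inl A * F) = ∑ p ∈ Finset.HasAntidiagonal.antidiagonal i,
      coeff p.1 A * coeff₂ p.2 j F := by
  simp only [coeff₂, inl, PowerSeries.coeff_mul i, PowerSeries.coeff_map, map_sum,
    PowerSeries.coeff_C_mul]

theorem coeff₂_mul_inr (i j : ℕ) (B : PowerSeries ℂ) (F : PowerSeries (PowerSeries ℂ)) :
    coeff₂ i j (F * inr B) = ∑ p ∈ Finset.HasAntidiagonal.antidiagonal j,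
      coeff₂ i p.1 F * coeff p.2 B := by
  simp only [coeff₂, inr, PowerSeries.coeff_mul_C, PowerSeries.coeff_mul j]

theorem coeff₂_inl_mul_inr (i j : ℕ) (A B : PowerSeries ℂ) :
    coeff₂ i j (inl A * inr B) = coeff i A * coeff j B := by
  simp [coeff₂, inl, inr, PowerSeries.coeff_mul_C]

theorem coeff₂_C_mul (i j : ℕ) (c : ℂ) (F : PowerSeries (PowerSeries ℂ)) :
    coeff₂ i j (inl (PowerSeries.C c) * F) = c * coeff₂ i j F := by
  simp [coeff₂, inl]

theorem isUnit_exp_add_exp :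
    IsUnit (inl (PowerSeries.exp ℂ) + inr (PowerSeries.exp ℂ)) := by
  rw [PowerSeries.isUnit_iff_constantCoeff, PowerSeries.isUnit_iff_constantCoeff]
  have : constantCoeff (constantCoeff (inl (PowerSeries.exp ℂ) + inr (PowerSeries.exp ℂ)))
      = (2 : ℂ) := by
    rw [← PowerSeries.coeff_zero_eq_constantCoeff_apply,
      ← PowerSeries.coeff_zero_eq_constantCoeff_apply]
    simp [inl, inr]
    norm_num
  rw [this]
  exact isUnit_iff_ne_zero.mpr two_ne_zero

/-- The series of `1 / (e^κ + e^λ)`. -/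
def cauchyKernel : PowerSeries (PowerSeries ℂ) :=
  Ring.inverse (inl (PowerSeries.exp ℂ) + inr (PowerSeries.exp ℂ))

theorem cauchyKernel_spec :
    (inl (PowerSeries.exp ℂ) + inr (PowerSeries.exp ℂ)) * cauchyKernel = 1 :=
  Ring.mul_inverse_cancel _ isUnit_exp_add_exp

/-- The series of `(e^κ + 1) / √2`. -/
def gauge : PowerSeries ℂ :=
  (PowerSeries.exp ℂ + 1) * PowerSeries.C ((1 / Real.sqrt 2 : ℝ) : ℂ)

theorem constantCoeff_exp_add_one : constantCoeff (PowerSeries.exp ℂ + 1) = 2 := by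
  simp [PowerSeries.constantCoeff_exp]
  norm_num

theorem constantCoeff_gauge_ne_zero : constantCoeff gauge ≠ 0 := by
  rw [gauge, map_mul, constantCoeff_exp_add_one, PowerSeries.constantCoeff_C]
  refine mul_ne_zero two_ne_zero ?_
  norm_cast
  positivity

theorem gauge_mul_inv : gauge * gauge⁻¹ = 1 :=
  PowerSeries.mul_inv_cancel _ constantCoeff_gauge_ne_zero

/-- The series of `2 (e^κ - 1) / (e^κ + 1)`. -/
def tanhSeries : PowerSeries ℂ := PowerSeries.X * schurSeries sCoeff

theorem X_mul_expSubOneDiv : PowerSeries.X * expSubOneDiv = PowerSeries.exp ℂ - 1 := by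
  ext n
  rcases n with _ | n
  · simp [PowerSeries.constantCoeff_exp]
  · rw [PowerSeries.coeff_succ_X_mul, expSubOneDiv, PowerSeries.coeff_mk]

theorem exp_add_one_mul_inv : (PowerSeries.exp ℂ + 1) * (PowerSeries.exp ℂ + 1)⁻¹ = 1 :=
  PowerSeries.mul_inv_cancel _ (by rw [constantCoeff_exp_add_one]; exact two_ne_zero)

theorem constantCoeff_sArgument :
    constantCoeff (2 * expSubOneDiv * (PowerSeries.exp ℂ + 1)⁻¹) = 1 := by
  have h : constantCoeff expSubOneDiv = 1 := by
    rw [← PowerSeries.coeff_zero_eq_constantCoeff_apply, expSubOneDiv, PowerSeries.coeff_mk]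
    simp [PowerSeries.coeff_exp, PowerSeries.coeff_one]
  rw [map_mul, map_mul, PowerSeries.constantCoeff_inv, constantCoeff_exp_add_one, h,
    map_ofNat]
  norm_num

theorem schurSeries_sCoeff :
    schurSeries sCoeff = 2 * expSubOneDiv * (PowerSeries.exp ℂ + 1)⁻¹ :=
  schurSeries_logOf constantCoeff_sArgument

theorem tanhSeries_mul : tanhSeries * (PowerSeries.exp ℂ + 1) = 2 * (PowerSeries.exp ℂ - 1) := by
  rw [tanhSeries, schurSeries_sCoeff]
  linear_combination (2 * PowerSeries.X * expSubOneDiv) * exp_add_one_mul_inv +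
    2 * X_mul_expSubOneDiv

/-- The rational identity `1 - tanh (κ/2) tanh (λ/2) = 2 (e^κ + e^λ) / ((e^κ + 1) (e^λ + 1))`. -/
theorem one_sub_tanh_mul_tanh :
    1 - inl tanhSeries * inr tanhSeries * inl (PowerSeries.C (1 / 4)) =
      (inl (PowerSeries.exp ℂ) + inr (PowerSeries.exp ℂ)) * (inl gauge⁻¹ * inr gauge⁻¹) := by
  have h1 := congrArg inl gauge_mul_inv
  have h2 := congrArg inr gauge_mul_inv
  have h3 := congrArg inl tanhSeries_mul
  have h4 := congrArg inr tanhSeries_mul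
  have h5 : inl gauge = (inl (PowerSeries.exp ℂ) + 1) *
      inl (PowerSeries.C ((1 / Real.sqrt 2 : ℝ) : ℂ)) := by
    rw [gauge, map_mul, map_add, map_one]
  have h6 : inr gauge = (inr (PowerSeries.exp ℂ) + 1) *
      inl (PowerSeries.C ((1 / Real.sqrt 2 : ℝ) : ℂ)) := by
    rw [gauge, map_mul, map_add, map_one, inl_C]
  -- The factor `2` of the identity is shared equally between the two variables; this is where the
  -- `√2` in `gauge` comes from.
  have h7 : inl (PowerSeries.C ((1 / Real.sqrt 2 : ℝ) : ℂ)) ^ 2 * 2 = 1 := by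
    have : PowerSeries.C (((1 / Real.sqrt 2 : ℝ) : ℂ)) ^ 2 * 2 = (1 : PowerSeries ℂ) := by
      rw [← map_pow, ← Complex.ofReal_pow, div_pow, Real.sq_sqrt zero_le_two,
        show (2 : PowerSeries ℂ) = PowerSeries.C 2 from (map_ofNat PowerSeries.C 2).symm, ← map_mul]
      norm_num
    simpa only [map_mul, map_pow, map_ofNat, map_one] using congrArg inl this
  have h8 : inl (PowerSeries.C (1 / 4)) * 4 = 1 := by
    have : PowerSeries.C (1 / 4 : ℂ) * 4 = (1 : PowerSeries ℂ) := by
      rw [show (4 : PowerSeries ℂ) = PowerSeries.C 4 from (map_ofNat PowerSeries.C 4).symm, ← map_mul]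
      norm_num
    simpa only [map_mul, map_pow, map_ofNat, map_one] using congrArg inl this
  simp only [map_mul, map_add, map_sub, map_one, map_ofNat] at h1 h2 h3 h4
  generalize inl (PowerSeries.C ((1 / Real.sqrt 2 : ℝ) : ℂ)) = r at *
  generalize inl (PowerSeries.C (1 / 4)) = q at *
  generalize inl (PowerSeries.exp ℂ) = y at *
  generalize inr (PowerSeries.exp ℂ) = y' at *
  generalize inl gauge⁻¹ = H at *
  generalize inr gauge⁻¹ = H' at *
  generalize inl tanhSeries = T at *
  generalize inr tanhSeries = T' at *
  rw [h5] at h1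
  rw [h6] at h2
  have e1 : T = 2 * (y - 1) * r * H := by
    linear_combination (-T) * h1 + r * H * h3
  have e2 : T' = 2 * (y' - 1) * r * H' := by
    linear_combination (-T') * h2 + r * H' * h4
  have e3 : (1 : PowerSeries (PowerSeries ℂ)) = (y + 1) * (y' + 1) * r ^ 2 * (H * H') := by
    linear_combination (-(y' + 1) * r * H') * h1 - h2
  rw [e1, e2]
  linear_combination e3 - (y - 1) * (y' - 1) * r ^ 2 * H * H' * h8 + (y + y') * (H * H') * h7

theorem coeff_mul_tanhSeries_pow (F : PowerSeries ℂ) (i γ : ℕ) :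
    coeff i (F * tanhSeries ^ γ) =
      if γ ≤ i then coeff (i - γ) (F * schurSeries sCoeff ^ γ) else 0 := by
  rw [tanhSeries, mul_pow, mul_left_comm, PowerSeries.coeff_X_pow_mul']

/-- A geometric expansion in `W = T(κ)T(λ)/4` with `T = tanhSeries`. The truncation is exact: `T`
has no constant term, so the remainder, divisible by `T(κ)^K`, does not reach `κ^i`. -/
theorem coeff₂_cauchyKernel (A B : PowerSeries ℂ) (i j K : ℕ) (hK : i < K) :
    coeff₂ i j (inl A * inr B * cauchyKernel) =
      ∑ γ ∈ Finset.range K, 1 / 4 ^ γ * coeff i (A * gauge⁻¹ * tanhSeries ^ γ) *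
        coeff j (B * gauge⁻¹ * tanhSeries ^ γ) := by
  set W := inl tanhSeries * inr tanhSeries * inl (PowerSeries.C (1 / 4)) with hW
  have h1 : cauchyKernel * (1 - W) = inl gauge⁻¹ * inr gauge⁻¹ := by
    rw [one_sub_tanh_mul_tanh]
    linear_combination (inl gauge⁻¹ * inr gauge⁻¹) * cauchyKernel_spec
  have h2 : inl A * inr B * cauchyKernel =
      ∑ γ ∈ Finset.range K, inl (PowerSeries.C (1 / 4 ^ γ)) *
        (inl (A * gauge⁻¹ * tanhSeries ^ γ) * inr (B * gauge⁻¹ * tanhSeries ^ γ)) +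
      inl (tanhSeries ^ K) * (inl A * inr B * cauchyKernel * inr tanhSeries ^ K *
        inl (PowerSeries.C (1 / 4)) ^ K) := by
    have h3 : ∑ γ ∈ Finset.range K, inl (PowerSeries.C (1 / 4 ^ γ)) *
        (inl (A * gauge⁻¹ * tanhSeries ^ γ) * inr (B * gauge⁻¹ * tanhSeries ^ γ)) =
        inl A * inr B * (inl gauge⁻¹ * inr gauge⁻¹) * ∑ γ ∈ Finset.range K, W ^ γ := by
      rw [Finset.mul_sum]
      refine Finset.sum_congr rfl fun γ _ => ?_
      rw [hW, show (1 : ℂ) / 4 ^ γ = (1 / 4) ^ γ by rw [div_pow, one_pow]]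
      simp only [map_mul, map_pow]
      ring
    have h4 := geom_sum_mul_neg W K
    rw [h3, ← h1]
    have h5 : W ^ K = inl (tanhSeries ^ K) * inr tanhSeries ^ K *
        inl (PowerSeries.C (1 / 4)) ^ K := by
      rw [hW, mul_pow, mul_pow, map_pow]
    linear_combination (-inl A * inr B * cauchyKernel) * (h4 - h5)
  rw [h2, coeff₂_add, coeff₂_sum]
  have h6 : ∀ F, coeff₂ i j (inl (tanhSeries ^ K) * F) = 0 := by
    intro F
    rw [coeff₂_inl_mul]
    refine Finset.sum_eq_zero fun p hp => ?_
    have hp' := Finset.HasAntidiagonal.mem_antidiagonal.mp hp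
    have h7 := coeff_mul_tanhSeries_pow 1 p.1 K
    rw [one_mul, if_neg (by omega)] at h7
    rw [h7, zero_mul]
  rw [h6, add_zero]
  refine Finset.sum_congr rfl fun γ _ => ?_
  rw [coeff₂_C_mul, coeff₂_inl_mul_inr, ← mul_assoc]

/-- The generating series of the matrix entries. -/
theorem sum_schur_mul_schur (x y : ℕ → ℂ) (i j : ℕ) :
    ∑ γ ∈ Finset.range (min i j + 1), 1 / 4 ^ γ * schur (fun r => x r + γ * sCoeff r) (i - γ) *
        schur (fun r => y r + γ * sCoeff r) (j - γ) =
      coeff₂ i j (inl (schurSeries x * gauge) * inr (schurSeries y * gauge) * cauchyKernel) := by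
  have hG : ∀ F γ, F * gauge * gauge⁻¹ * tanhSeries ^ γ = F * tanhSeries ^ γ := by
    intro F γ
    rw [mul_assoc F, gauge_mul_inv, mul_one]
  have hS : ∀ (z : ℕ → ℂ) (m γ : ℕ), γ ≤ m → coeff m (schurSeries z * tanhSeries ^ γ) =
      schur (fun r => z r + γ * sCoeff r) (m - γ) := by
    intro z m γ h
    rw [coeff_mul_tanhSeries_pow, if_pos h, ← schurSeries_nat_mul, ← schurSeries_add,
      coeff_schurSeries]
  rw [coeff₂_cauchyKernel _ _ i j (i + 1) (Nat.lt_succ_self i)]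
  simp only [hG]
  have hsub : Finset.range (min i j + 1) ⊆ Finset.range (i + 1) :=
    Finset.range_subset_range.mpr (by omega)
  rw [← Finset.sum_subset hsub]
  · refine Finset.sum_congr rfl fun γ hγ => ?_
    have := Finset.mem_range.mp hγ
    rw [hS x i γ (by omega), hS y j γ (by omega)]
  · intro γ h1 h2
    rw [Finset.mem_range] at h1 h2
    -- The added terms have `j < γ ≤ i`, so the factor `T(λ)^γ` kills the coefficient of `λ^j`.
    rw [coeff_mul_tanhSeries_pow (schurSeries y), if_neg (by omega), mul_zero]

/-! ### Odd-indexed minors -/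

/-- The matrix of the coefficients with odd indices. -/
def oddMatrix (N : ℕ) (F : PowerSeries (PowerSeries ℂ)) : Matrix (Fin N) (Fin N) ℂ :=
  Matrix.of fun i j => coeff₂ (2 * (i : ℕ) + 1) (2 * (j : ℕ) + 1) F

/-- The vector of the coefficients with odd indices. -/
def oddVector (N : ℕ) (A : PowerSeries ℂ) : Fin N → ℂ := fun i => coeff (2 * (i : ℕ) + 1) A

/-- Multiplication by a series, on odd coefficients, when the series is even. -/
def oddToeplitz (N : ℕ) (e : PowerSeries ℂ) : Matrix (Fin N) (Fin N) ℂ :=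
  Matrix.of fun i j => if j ≤ i then coeff (2 * ((i : ℕ) - (j : ℕ))) e else 0

/-- A power series without odd coefficients. -/
def IsEvenSeries (e : PowerSeries ℂ) : Prop := ∀ n, coeff (2 * n + 1) e = 0

/-- An odd index splits into an even and an odd one. An even multiplier uses only the even part, so
odd coefficients mix with odd coefficients alone. -/
theorem sum_antidiagonal_even {e : PowerSeries ℂ} (he : IsEvenSeries e) {N : ℕ} (i : Fin N)
    (f : ℕ → ℂ) :
    ∑ p ∈ Finset.HasAntidiagonal.antidiagonal (2 * (i : ℕ) + 1), coeff p.1 e * f p.2 =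
      ∑ k : Fin N, oddToeplitz N e i k * f (2 * (k : ℕ) + 1) := by
  have h1 : ∑ k : Fin N, oddToeplitz N e i k * f (2 * (k : ℕ) + 1) =
      ∑ k ∈ Finset.univ.filter (fun k : Fin N => k ≤ i),
        coeff (2 * ((i : ℕ) - (k : ℕ))) e * f (2 * (k : ℕ) + 1) := by
    rw [Finset.sum_filter]
    refine Finset.sum_congr rfl fun k _ => ?_
    simp only [oddToeplitz, Matrix.of_apply]
    split_ifs <;> simp
  rw [h1]
  symm
  refine Finset.sum_of_injOn (fun k : Fin N => (2 * ((i : ℕ) - (k : ℕ)), 2 * (k : ℕ) + 1))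
    ?_ ?_ ?_ ?_
  · intro a _ b _ h
    simp only [Prod.mk.injEq] at h
    exact Fin.ext (by omega)
  · intro k hk
    simp only [Finset.coe_filter, Finset.mem_univ, true_and, Set.mem_ofPred_eq, Fin.le_def] at hk
    simp only [Finset.mem_coe, Finset.HasAntidiagonal.mem_antidiagonal]
    omega
  · intro p hp hp'
    have hsum := Finset.HasAntidiagonal.mem_antidiagonal.mp hp
    rcases Nat.even_or_odd' p.1 with ⟨m, hm | hm⟩
    · exfalso
      have hi := i.isLt
      have hlt : (i : ℕ) - m < N := by omega
      have hle : (⟨(i : ℕ) - m, hlt⟩ : Fin N) ≤ i := Fin.le_def.mpr (Nat.sub_le _ _)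
      refine hp' ((Set.mem_image _ _ _).mpr ⟨⟨(i : ℕ) - m, hlt⟩, ?_, ?_⟩)
      · exact Finset.mem_coe.mpr (Finset.mem_filter.mpr ⟨Finset.mem_univ _, hle⟩)
      · refine Prod.ext ?_ ?_ <;> simp <;> omega
    · rw [hm, he m, zero_mul]
  · intro k _
    rfl

theorem oddMatrix_inl_mul {e : PowerSeries ℂ} (he : IsEvenSeries e) (N : ℕ)
    (F : PowerSeries (PowerSeries ℂ)) :
    oddMatrix N (inl e * F) = oddToeplitz N e * oddMatrix N F := by
  ext i j
  rw [Matrix.mul_apply, oddMatrix, Matrix.of_apply, coeff₂_inl_mul,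
    sum_antidiagonal_even he i fun n => coeff₂ n (2 * (j : ℕ) + 1) F]
  rfl

theorem oddMatrix_mul_inr {e : PowerSeries ℂ} (he : IsEvenSeries e) (N : ℕ)
    (F : PowerSeries (PowerSeries ℂ)) :
    oddMatrix N (F * inr e) = oddMatrix N F * (oddToeplitz N e).transpose := by
  ext i j
  rw [Matrix.mul_apply, oddMatrix, Matrix.of_apply, coeff₂_mul_inr,
    ← Finset.Nat.sum_antidiagonal_swap]
  simp only [Prod.fst_swap, Prod.snd_swap]
  simp only [mul_comm (coeff₂ _ _ _)]
  rw [sum_antidiagonal_even he j fun n => coeff₂ (2 * (i : ℕ) + 1) n F]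
  refine Finset.sum_congr rfl fun k _ => ?_
  rw [mul_comm]
  rfl

theorem det_oddToeplitz (N : ℕ) {e : PowerSeries ℂ} (he : constantCoeff e = 1) :
    (oddToeplitz N e).det = 1 := by
  have hT : (oddToeplitz N e).IsLowerTriangular := fun i j hij => if_neg (not_le_of_gt hij)
  rw [Matrix.det_of_isLowerTriangular _ hT]
  refine Finset.prod_eq_one fun i _ => ?_
  simp [oddToeplitz, he]

/-- Even factors act on rows and columns through unitriangular Toeplitz matrices. -/
theorem det_oddMatrix_even {e e' : PowerSeries ℂ} (he : IsEvenSeries e) (he' : IsEvenSeries e')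
    (h0 : constantCoeff e = 1) (h0' : constantCoeff e' = 1) (N : ℕ)
    (F : PowerSeries (PowerSeries ℂ)) :
    (oddMatrix N (inl e * F * inr e')).det = (oddMatrix N F).det := by
  rw [oddMatrix_mul_inr he', oddMatrix_inl_mul he, Matrix.det_mul, Matrix.det_mul,
    Matrix.det_transpose, det_oddToeplitz N h0, det_oddToeplitz N h0', one_mul, mul_one]

theorem oddMatrix_sub (N : ℕ) (F G : PowerSeries (PowerSeries ℂ)) :
    oddMatrix N (F - G) = oddMatrix N F - oddMatrix N G := by
  ext i j
  simp [oddMatrix, coeff₂_sub]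

theorem oddMatrix_add (N : ℕ) (F G : PowerSeries (PowerSeries ℂ)) :
    oddMatrix N (F + G) = oddMatrix N F + oddMatrix N G := by
  ext i j
  simp [oddMatrix, coeff₂_add]

theorem oddMatrix_C_mul (N : ℕ) (c : ℂ) (F : PowerSeries (PowerSeries ℂ)) :
    oddMatrix N (inl (PowerSeries.C c) * F) = c • oddMatrix N F := by
  ext i j
  simp [oddMatrix, coeff₂_C_mul]

theorem oddMatrix_inl_mul_inr (N : ℕ) (A B : PowerSeries ℂ) :
    oddMatrix N (inl A * inr B) = Matrix.vecMulVec (oddVector N A) (oddVector N B) := by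
  ext i j
  simp [oddMatrix, oddVector, coeff₂_inl_mul_inr, Matrix.vecMulVec_apply]

/-! ### Coefficientwise derivatives -/

/-- Every coefficient of `A` has the corresponding coefficient of `A'` as its derivative. -/
def HasCoeffDerivAt (A : ℝ → PowerSeries ℂ) (A' : PowerSeries ℂ) (s : ℝ) : Prop :=
  ∀ n, HasDerivAt (fun y => coeff n (A y)) (coeff n A') s

theorem HasCoeffDerivAt.mul_const {A : ℝ → PowerSeries ℂ} {A' : PowerSeries ℂ} {s : ℝ}
    (h : HasCoeffDerivAt A A' s) (B : PowerSeries ℂ) :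
    HasCoeffDerivAt (fun y => A y * B) (A' * B) s := by
  intro n
  simp only [PowerSeries.coeff_mul]
  exact HasDerivAt.fun_sum fun p _ => (h p.1).mul_const _

/-- By the truncated expansion, a kernel coefficient is a finite bilinear expression in coefficients
of the two factors, so the ordinary product rule suffices and no convergence question arises. -/
theorem HasCoeffDerivAt.coeff₂_cauchyKernel {A B : ℝ → PowerSeries ℂ} {A' B' : PowerSeries ℂ}
    {s : ℝ} (hA : HasCoeffDerivAt A A' s) (hB : HasCoeffDerivAt B B' s) (i j : ℕ) :
    HasDerivAt (fun y => coeff₂ i j (inl (A y) * inr (B y) * cauchyKernel))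
      (coeff₂ i j (inl A' * inr (B s) * cauchyKernel + inl (A s) * inr B' * cauchyKernel)) s := by
  rw [coeff₂_add]
  simp only [MassiveThirring.coeff₂_cauchyKernel _ _ i j (i + 1) (Nat.lt_succ_self i)]
  rw [← Finset.sum_add_distrib]
  refine HasDerivAt.fun_sum fun γ _ => ?_
  have h1 := (((hA.mul_const gauge⁻¹).mul_const (tanhSeries ^ γ)) i).const_mul ((1 : ℂ) / 4 ^ γ)
  exact h1.mul (((hB.mul_const gauge⁻¹).mul_const (tanhSeries ^ γ)) j)

/-! ### Logarithmic derivatives of bordered determinants -/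

theorem differentiableAt_det {N : ℕ} {m : ℝ → Matrix (Fin N) (Fin N) ℂ} {s : ℝ}
    (h : ∀ i j, DifferentiableAt ℝ (fun y => m y i j) s) :
    DifferentiableAt ℝ (fun y => (m y).det) s := by
  simp only [Matrix.det_apply]
  refine DifferentiableAt.fun_sum fun σ _ => DifferentiableAt.const_smul ?_ _
  exact DifferentiableAt.fun_finsetProd fun i _ => h _ _

theorem det_sub_vecMulVec {N : ℕ} {m : Matrix (Fin N) (Fin N) ℂ} (hm : m.det ≠ 0)
    (v w : Fin N → ℂ) :
    (m - Matrix.vecMulVec v w).det = m.det * (1 - w ⬝ᵥ (m⁻¹).mulVec v) := by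
  have hu : IsUnit m.det := isUnit_iff_ne_zero.mpr hm
  have h1 : m - Matrix.vecMulVec v w =
      m + Matrix.replicateCol Unit v * Matrix.replicateRow Unit (-w) := by
    ext i j
    simp [Matrix.vecMulVec_apply, Matrix.mul_apply, sub_eq_add_neg]
  rw [h1, Matrix.det_add_replicateCol_mul_replicateRow hu]
  congr 1
  rw [Matrix.det_unique, Matrix.mul_assoc, ← Matrix.replicateCol_mulVec,
    Matrix.add_apply, Matrix.one_apply_eq, Matrix.replicateRow_mul_replicateCol_apply,
    neg_dotProduct, sub_eq_add_neg]

/-- The vector `X = m⁻¹v` is differentiable by Cramer's rule; differentiating `mX = v` then gives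
`X' = m⁻¹(v' - m'X)`. -/
theorem hasDerivAt_dotProduct_inv_mulVec {N : ℕ} {m : ℝ → Matrix (Fin N) (Fin N) ℂ}
    {m' : Matrix (Fin N) (Fin N) ℂ} {v w : ℝ → Fin N → ℂ} {v' w' : Fin N → ℂ} {s : ℝ}
    (hm : ∀ i j, HasDerivAt (fun y => m y i j) (m' i j) s)
    (hv : ∀ i, HasDerivAt (fun y => v y i) (v' i) s)
    (hw : ∀ i, HasDerivAt (fun y => w y i) (w' i) s) (hd : (m s).det ≠ 0) :
    HasDerivAt (fun y => w y ⬝ᵥ (m y)⁻¹.mulVec (v y))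
      (w' ⬝ᵥ (m s)⁻¹.mulVec (v s) +
        w s ⬝ᵥ (m s)⁻¹.mulVec (v' - m'.mulVec ((m s)⁻¹.mulVec (v s)))) s := by
  have hdet : DifferentiableAt ℝ (fun y => (m y).det) s :=
    differentiableAt_det fun i j => (hm i j).differentiableAt
  have hev : ∀ᶠ y in nhds s, (m y).det ≠ 0 := hdet.continuousAt.eventually_ne hd
  set X : ℝ → Fin N → ℂ := fun y => (m y)⁻¹.mulVec (v y) with hX
  have hXd : ∀ i, DifferentiableAt ℝ (fun y => X y i) s := by
    intro i
    simp only [hX, Matrix.mulVec, dotProduct, Matrix.inv_def, Ring.inverse_eq_inv',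
      Matrix.smul_apply, smul_eq_mul]
    refine DifferentiableAt.fun_sum fun j _ => ((hdet.inv hd).mul ?_).mul (hv j).differentiableAt
    simp only [Matrix.adjugate_apply]
    refine differentiableAt_det fun a b => ?_
    by_cases hab : a = j
    · subst hab
      simp only [Matrix.updateRow_self]
      exact differentiableAt_const _
    · simp only [Matrix.updateRow_ne hab]
      exact (hm a b).differentiableAt
  have hmX : ∀ y, (m y).det ≠ 0 → (m y).mulVec (X y) = v y := by
    intro y hy
    rw [hX, Matrix.mulVec_mulVec, Matrix.mul_nonsing_inv _ (isUnit_iff_ne_zero.mpr hy),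
      Matrix.one_mulVec]
  set X' : Fin N → ℂ := fun i => deriv (fun y => X y i) s with hX'
  have hXX' : ∀ i, HasDerivAt (fun y => X y i) (X' i) s := fun i => (hXd i).hasDerivAt
  have hlin : (m s).mulVec X' = v' - m'.mulVec (X s) := by
    ext i
    have h1 : HasDerivAt (fun y => (m y).mulVec (X y) i)
        (∑ j, (m' i j * X s j + m s i j * X' j)) s := by
      simp only [Matrix.mulVec, dotProduct]
      exact HasDerivAt.fun_sum fun j _ => (hm i j).mul (hXX' j)
    have h2 : HasDerivAt (fun y => (m y).mulVec (X y) i) (v' i) s := by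
      refine (hv i).congr_of_eventuallyEq ?_
      filter_upwards [hev] with y hy
      rw [hmX y hy]
    have h3 := h1.unique h2
    rw [Finset.sum_add_distrib] at h3
    rw [Pi.sub_apply, ← h3]
    simp [Matrix.mulVec, dotProduct]
  have hX'eq : X' = (m s)⁻¹.mulVec (v' - m'.mulVec (X s)) := by
    rw [← hlin, Matrix.mulVec_mulVec, Matrix.nonsing_inv_mul _ (isUnit_iff_ne_zero.mpr hd),
      Matrix.one_mulVec]
  have h4 : HasDerivAt (fun y => w y ⬝ᵥ X y) (∑ j, (w' j * X s j + w s j * X' j)) s := by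
    simp only [dotProduct]
    exact HasDerivAt.fun_sum fun j _ => (hw j).mul (hXX' j)
  convert h4 using 1
  rw [Finset.sum_add_distrib, ← hX'eq]
  rfl

/-- The bilinear identity in terms of a matrix with a derivative of rank one. -/
theorem hasDerivAt_det_quotient {N : ℕ} {m : ℝ → Matrix (Fin N) (Fin N) ℂ}
    {v w : ℝ → Fin N → ℂ} {a b : Fin N → ℂ} {s : ℝ} {c e₁ e₂ α β : ℂ}
    (hm : ∀ i j, HasDerivAt (fun y => m y i j)
      (c * (a i * b j) + (e₁ + e₂) * m s i j) s)
    (hv : ∀ i, HasDerivAt (fun y => v y i) (c * (a i - α * v s i) + e₁ * v s i) s)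
    (hw : ∀ i, HasDerivAt (fun y => w y i) (c * (b i + β * w s i) + e₂ * w s i) s)
    (hd : (m s).det ≠ 0) :
    HasDerivAt (fun y => (m y - (α - β) • Matrix.vecMulVec (v y) (w y)).det / (m y).det)
      (c * (α - β) * ((m s - Matrix.vecMulVec a (w s)).det * (m s - Matrix.vecMulVec (v s) b).det /
        (m s).det ^ 2 -
        (m s - (α - β) • Matrix.vecMulVec (v s) (w s)).det / (m s).det)) s := by
  have hdet : DifferentiableAt ℝ (fun y => (m y).det) s :=
    differentiableAt_det fun i j => (hm i j).differentiableAt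
  have hev : ∀ᶠ y in nhds s, (m y).det ≠ 0 := hdet.continuousAt.eventually_ne hd
  have hquot : ∀ y, (m y).det ≠ 0 →
      (m y - (α - β) • Matrix.vecMulVec (v y) (w y)).det / (m y).det =
        1 - (α - β) * (w y ⬝ᵥ (m y)⁻¹.mulVec (v y)) := by
    intro y hy
    rw [← Matrix.smul_vecMulVec, det_sub_vecMulVec hy, mul_div_cancel_left₀ _ hy,
      Matrix.mulVec_smul, dotProduct_smul, smul_eq_mul]
  have hder := hasDerivAt_dotProduct_inv_mulVec (m' := Matrix.of fun i j =>
      c * (a i * b j) + (e₁ + e₂) * m s i j)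
    (v' := fun i => c * (a i - α * v s i) + e₁ * v s i)
    (w' := fun i => c * (b i + β * w s i) + e₂ * w s i) hm hv hw hd
  have hmain := (hder.const_mul (α - β)).const_sub 1
  have heq : (fun y => (m y - (α - β) • Matrix.vecMulVec (v y) (w y)).det / (m y).det) =ᶠ[nhds s]
      fun y => 1 - (α - β) * (w y ⬝ᵥ (m y)⁻¹.mulVec (v y)) := by
    filter_upwards [hev] with y hy using hquot y hy
  refine (hmain.congr_of_eventuallyEq heq).congr_deriv ?_
  -- With `⟨w,v⟩ = w ⬝ m⁻¹v`, the derivative of `⟨w,v⟩` is `c(1 - (1-⟨w,a⟩)(1-⟨b,v⟩) - (α-β)⟨w,v⟩)`;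
  -- the contributions of `e₁` and `e₂` cancel. The two factors are the rank-one determinants of the
  -- statement.
  rw [hquot s hd, det_sub_vecMulVec hd, det_sub_vecMulVec hd]
  have e1 : (fun i => c * (a i - α * v s i) + e₁ * v s i) =
      c • a + (e₁ - c * α) • v s := by
    ext i
    simp
    ring
  have e2 : (fun i => c * (b i + β * w s i) + e₂ * w s i) =
      c • b + (e₂ + c * β) • w s := by
    ext i
    simp
    ring
  have e3 : (Matrix.of fun i j => c * (a i * b j) + (e₁ + e₂) * m s i j) =
      c • Matrix.vecMulVec a b + (e₁ + e₂) • m s := by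
    ext i j
    simp [Matrix.vecMulVec_apply]
  rw [e1, e2, e3]
  have e4 : (m s).mulVec ((m s)⁻¹.mulVec (v s)) = v s := by
    rw [Matrix.mulVec_mulVec, Matrix.mul_nonsing_inv _ (isUnit_iff_ne_zero.mpr hd),
      Matrix.one_mulVec]
  have e5 : (Matrix.vecMulVec a b).mulVec ((m s)⁻¹.mulVec (v s)) =
      (b ⬝ᵥ (m s)⁻¹.mulVec (v s)) • a := by
    rw [Matrix.vecMulVec_mulVec]
    ext i
    simp [mul_comm]
  simp only [Matrix.add_mulVec, Matrix.smul_mulVec, e4, e5, Matrix.mulVec_add, Matrix.mulVec_sub,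
    Matrix.mulVec_smul, add_dotProduct, smul_dotProduct, dotProduct_add, dotProduct_sub,
    dotProduct_smul, smul_eq_mul]
  field_simp
  ring

/-! ### The bilinear identity for generating series -/

theorem HasCoeffDerivAt.oddVector {A : ℝ → PowerSeries ℂ} {A' : PowerSeries ℂ} {s : ℝ}
    (h : HasCoeffDerivAt A A' s) {N : ℕ} (i : Fin N) :
    HasDerivAt (fun y => oddVector N (A y) i) (oddVector N A' i) s := h _

theorem HasCoeffDerivAt.congr_deriv {A : ℝ → PowerSeries ℂ} {A' A'' : PowerSeries ℂ} {s : ℝ}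
    (h : HasCoeffDerivAt A A' s) (h' : A' = A'') : HasCoeffDerivAt A A'' s := h' ▸ h

theorem oddVector_C_mul_add (N : ℕ) (c e : ℂ) (F G H : PowerSeries ℂ)
    (h : F = PowerSeries.C c * G + PowerSeries.C e * H) (i : Fin N) :
    oddVector N F i = c * oddVector N G i + e * oddVector N H i := by
  rw [h]
  simp [oddVector]

/-- The bilinear identity for kernels `F = A(κ) B(λ) / (e^κ + e^λ)`, where `P(κ) + Q(λ)` divides
`e^κ + e^λ` up to factors in one variable, and `F₀`, `F₁`, `F₂` arise from `F` by elementary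
shifts. -/
theorem hasDerivAt_shift_quotient {N : ℕ} {F F₂ : ℝ → PowerSeries (PowerSeries ℂ)}
    {F₀ F₁ : PowerSeries (PowerSeries ℂ)} {A B : ℝ → PowerSeries ℂ} {P Q Pα Qβ : PowerSeries ℂ}
    {s : ℝ} {c e₁ e₂ α β u w : ℂ}
    (hF : ∀ y, (inl P + inr Q) * F y = inl (A y) * inr (B y))
    (hF' : ∀ i j, HasDerivAt (fun y => coeff₂ i j (F y))
      (coeff₂ i j (inl (PowerSeries.C c) * ((inl P + inr Q) * F s) +
        inl (PowerSeries.C (e₁ + e₂)) * F s)) s)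
    (hA : HasCoeffDerivAt A ((PowerSeries.C c * P + PowerSeries.C e₁) * A s) s)
    (hB : HasCoeffDerivAt B ((PowerSeries.C c * Q + PowerSeries.C e₂) * B s) s)
    (hPα : (P + PowerSeries.C α) * Pα = 1) (hQβ : (Q - PowerSeries.C β) * Qβ = 1)
    (h₀ : inl (P + PowerSeries.C α) * F₀ =
      inl (PowerSeries.C u) * (inr (PowerSeries.C α - Q) * F s))
    (h₁ : inr (PowerSeries.C β - Q) * F₁ =
      inl (PowerSeries.C w) * (inl (P + PowerSeries.C β) * F s))
    (h₂ : ∀ y, inl (P + PowerSeries.C α) * inr (PowerSeries.C β - Q) * F₂ y =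
      inl (PowerSeries.C (u * w)) *
        (inl (P + PowerSeries.C β) * inr (PowerSeries.C α - Q) * F y))
    (hd : (oddMatrix N (F s)).det ≠ 0) :
    HasDerivAt (fun y => (oddMatrix N (F₂ y)).det / (oddMatrix N (F y)).det)
      (c * (α - β) * ((oddMatrix N F₁).det * (oddMatrix N F₀).det / (oddMatrix N (F s)).det ^ 2 -
        (oddMatrix N (F₂ s)).det / (oddMatrix N (F s)).det)) s := by
  have hl := congrArg inl hPα
  have hr := congrArg inr hQβ
  simp only [map_mul, map_add, map_sub, map_one, ← inl_C] at hl hr h₀ h₁ h₂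
  -- Since `α - Q = (P+α) - (P+Q)` and `(P+Q)F = AB`, the shift subtracts a product of one-variable
  -- series; `k₁` is the mirror image.
  have k₀ : F₀ = inl (PowerSeries.C u) * (F s - inl (A s * Pα) * inr (B s)) := by
    rw [map_mul]
    linear_combination (-F₀ + inl (PowerSeries.C u) * F s) * hl + inl Pα * h₀ -
      inl (PowerSeries.C u) * inl Pα * hF s
  have k₁ : F₁ = inl (PowerSeries.C w) * (F s - inl (A s) * inr (B s * Qβ)) := by
    rw [map_mul]
    linear_combination (-F₁ + inl (PowerSeries.C w) * F s) * hr - inr Qβ * h₁ -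
      inl (PowerSeries.C w) * inr Qβ * hF s
  -- From `(P+β)(α-Q) = (P+α)(β-Q) + (α-β)(P+Q)`: the double shift is still a rank-one perturbation,
  -- with weight `α-β`.
  have k₂ : ∀ y, F₂ y = inl (PowerSeries.C (u * w)) *
      (F y - inl (PowerSeries.C (α - β)) * (inl (A y * Pα) * inr (B y * Qβ))) := by
    intro y
    have h := h₂ y
    simp only [map_mul, map_sub] at h ⊢
    linear_combination (-inl Pα * inr Qβ) * h +
      (-F₂ y + inl (PowerSeries.C u) * inl (PowerSeries.C w) * F y) *
        (inr Qβ * (inr Q - inl (PowerSeries.C β)) * hl + hr) -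
      inl (PowerSeries.C u) * inl (PowerSeries.C w) *
        (inl (PowerSeries.C α) - inl (PowerSeries.C β)) * inl Pα * inr Qβ * hF y
  have hm : ∀ i j, HasDerivAt (fun y => oddMatrix N (F y) i j)
      (c * (oddVector N (A s) i * oddVector N (B s) j) +
        (e₁ + e₂) * oddMatrix N (F s) i j) s := by
    intro i j
    refine (hF' _ _).congr_deriv ?_
    rw [hF, coeff₂_add, coeff₂_C_mul, coeff₂_C_mul, coeff₂_inl_mul_inr]
    rfl
  have hv : ∀ i, HasDerivAt (fun y => oddVector N (A y * Pα) i)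
      (c * (oddVector N (A s) i - α * oddVector N (A s * Pα) i) +
        e₁ * oddVector N (A s * Pα) i) s := by
    intro i
    refine ((hA.mul_const Pα).oddVector i).congr_deriv ?_
    rw [oddVector_C_mul_add N c (e₁ - c * α) _ (A s) (A s * Pα)]
    · ring
    · rw [map_sub, map_mul]
      linear_combination PowerSeries.C c * A s * hPα
  have hw : ∀ i, HasDerivAt (fun y => oddVector N (B y * Qβ) i)
      (c * (oddVector N (B s) i + β * oddVector N (B s * Qβ) i) +
        e₂ * oddVector N (B s * Qβ) i) s := by
    intro i
    refine ((hB.mul_const Qβ).oddVector i).congr_deriv ?_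
    rw [oddVector_C_mul_add N c (e₂ + c * β) _ (B s) (B s * Qβ)]
    · ring
    · rw [map_add, map_mul]
      linear_combination PowerSeries.C c * B s * hQβ
  have key := (hasDerivAt_det_quotient hm hv hw hd).const_mul ((u * w) ^ N)
  have d₀ : (oddMatrix N F₀).det = u ^ N * (oddMatrix N (F s) -
      Matrix.vecMulVec (oddVector N (A s * Pα)) (oddVector N (B s))).det := by
    rw [k₀, oddMatrix_C_mul, oddMatrix_sub, oddMatrix_inl_mul_inr, Matrix.det_smul,
      Fintype.card_fin]
  have d₁ : (oddMatrix N F₁).det = w ^ N * (oddMatrix N (F s) -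
      Matrix.vecMulVec (oddVector N (A s)) (oddVector N (B s * Qβ))).det := by
    rw [k₁, oddMatrix_C_mul, oddMatrix_sub, oddMatrix_inl_mul_inr, Matrix.det_smul,
      Fintype.card_fin]
  have d₂ : ∀ y, (oddMatrix N (F₂ y)).det = (u * w) ^ N * (oddMatrix N (F y) -
      (α - β) • Matrix.vecMulVec (oddVector N (A y * Pα)) (oddVector N (B y * Qβ))).det := by
    intro y
    rw [k₂, oddMatrix_C_mul, oddMatrix_sub, oddMatrix_C_mul, oddMatrix_inl_mul_inr,
      Matrix.det_smul, Fintype.card_fin]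
  have hfun : (fun y => (oddMatrix N (F₂ y)).det / (oddMatrix N (F y)).det) = fun y =>
      (u * w) ^ N * ((oddMatrix N (F y) - (α - β) • Matrix.vecMulVec (oddVector N (A y * Pα))
        (oddVector N (B y * Qβ))).det / (oddMatrix N (F y)).det) := by
    funext y
    rw [d₂, mul_div_assoc]
  rw [hfun]
  refine key.congr_deriv ?_
  rw [d₀, d₁, d₂, mul_pow]
  ring

/-! ### The background constants -/

/-- The nondegeneracy of the background. -/
structure Background (σ ρ₁ ρ₂ : ℝ) : Prop where
  ne₁ : ρ₁ ≠ 0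
  ne₂ : ρ₂ ≠ 0
  rho_pos : 0 < rho σ ρ₁ ρ₂
  rho_lt_one : rho σ ρ₁ ρ₂ < 1

variable {σ ρ₁ ρ₂ : ℝ}

/-- Both sign cases say exactly that `σρ₁ρ₂` lies in `(-1, 0)`, that is `0 < ρ < 1`; the sign of `σ`
plays no further role. -/
theorem background_of_sign
    (h : (σ = 1 ∧ -1 < ρ₁ * ρ₂ ∧ ρ₁ * ρ₂ < 0) ∨ (σ = -1 ∧ 0 < ρ₁ * ρ₂ ∧ ρ₁ * ρ₂ < 1)) :
    Background σ ρ₁ ρ₂ := by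
  have hne : ρ₁ * ρ₂ ≠ 0 := by
    rcases h with ⟨_, _, h⟩ | ⟨_, h, _⟩
    · exact h.ne
    · exact h.ne'
  refine ⟨left_ne_zero_of_mul hne, right_ne_zero_of_mul hne, ?_, ?_⟩ <;>
  · rcases h with ⟨rfl, h1, h2⟩ | ⟨rfl, h1, h2⟩ <;> · rw [rho]; linarith

theorem sign_mul_eq : I * (σ : ℂ) * ρ₁ * ρ₂ = I * ((rho σ ρ₁ ρ₂ : ℂ) - 1) := by
  rw [rho]
  push_cast
  ring

namespace Background

theorem rhoHat_arg (h : Background σ ρ₁ ρ₂) : 0 < -σ * ρ₁ * ρ₂ * rho σ ρ₁ ρ₂ := by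
  have h1 := h.rho_pos
  have h2 := h.rho_lt_one
  refine mul_pos ?_ h1
  have : rho σ ρ₁ ρ₂ = 1 + σ * ρ₁ * ρ₂ := rfl
  linarith

theorem rhoHat_pos (h : Background σ ρ₁ ρ₂) : 0 < rhoHat σ ρ₁ ρ₂ :=
  Real.sqrt_pos.mpr h.rhoHat_arg

theorem rhoHat_sq (h : Background σ ρ₁ ρ₂) :
    (rhoHat σ ρ₁ ρ₂ : ℂ) ^ 2 = rho σ ρ₁ ρ₂ * (1 - rho σ ρ₁ ρ₂) := by
  have h1 : rhoHat σ ρ₁ ρ₂ ^ 2 = rho σ ρ₁ ρ₂ * (1 - rho σ ρ₁ ρ₂) := by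
    rw [rhoHat, Real.sq_sqrt h.rhoHat_arg.le]
    simp only [rho]
    ring
  exact_mod_cast congrArg (fun r : ℝ => (r : ℂ)) h1

theorem rhoHat_ne (h : Background σ ρ₁ ρ₂) : (rhoHat σ ρ₁ ρ₂ : ℂ) ≠ 0 :=
  ofReal_ne_zero.mpr h.rhoHat_pos.ne'

theorem add_I_mul_ne (h : Background σ ρ₁ ρ₂) (b : ℝ) : (rhoHat σ ρ₁ ρ₂ : ℂ) + I * b ≠ 0 := by
  intro h0
  have := congrArg Complex.re h0
  simp at this
  exact h.rhoHat_pos.ne' this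

theorem sub_I_mul_ne (h : Background σ ρ₁ ρ₂) (b : ℝ) : (rhoHat σ ρ₁ ρ₂ : ℂ) - I * b ≠ 0 := by
  have := h.add_I_mul_ne (-b)
  push_cast at this
  rwa [mul_neg, ← sub_eq_add_neg] at this

end Background

theorem sign_mul_eq_ofReal : I * (σ : ℂ) * ρ₁ * ρ₂ = I * ((rho σ ρ₁ ρ₂ - 1 : ℝ) : ℂ) := by
  rw [sign_mul_eq]
  push_cast
  ring

/-! ### Generating series of the tau functions -/

/-- The series of `ρ̂ e^κ`. -/
def scaledExp (σ ρ₁ ρ₂ : ℝ) : PowerSeries ℂ :=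
  PowerSeries.exp ℂ * PowerSeries.C (rhoHat σ ρ₁ ρ₂ : ℂ)

theorem shiftedExp_eq (c : ℂ) : shiftedExp σ ρ₁ ρ₂ c = scaledExp σ ρ₁ ρ₂ + PowerSeries.C c := rfl

theorem constantCoeff_scaledExp :
    constantCoeff (scaledExp σ ρ₁ ρ₂) = (rhoHat σ ρ₁ ρ₂ : ℂ) := by
  simp [scaledExp, PowerSeries.constantCoeff_exp]

theorem conjSeries_C (c : ℂ) :
    conjSeries (PowerSeries.C c) = PowerSeries.C (starRingEnd ℂ c) := by
  simp [conjSeries]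

theorem conjSeries_exp : conjSeries (PowerSeries.exp ℂ) = PowerSeries.exp ℂ :=
  PowerSeries.map_exp _

theorem conjSeries_scaledExp : conjSeries (scaledExp σ ρ₁ ρ₂) = scaledExp σ ρ₁ ρ₂ := by
  rw [scaledExp, map_mul, conjSeries_exp, conjSeries_C, conj_ofReal]

/-- The normalized factor `(e^κ ρ̂ + c) / (ρ̂ + c)`. -/
def shiftFactor (σ ρ₁ ρ₂ : ℝ) (c : ℂ) : PowerSeries ℂ :=
  shiftedExp σ ρ₁ ρ₂ c * PowerSeries.C (1 / ((rhoHat σ ρ₁ ρ₂ : ℂ) + c))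

theorem constantCoeff_shiftFactor {c : ℂ} (hc : (rhoHat σ ρ₁ ρ₂ : ℂ) + c ≠ 0) :
    constantCoeff (shiftFactor σ ρ₁ ρ₂ c) = 1 := by
  rw [shiftFactor, shiftedExp_eq, map_mul, map_add, constantCoeff_scaledExp,
    PowerSeries.constantCoeff_C, PowerSeries.constantCoeff_C, mul_one_div_cancel hc]

theorem schurSeries_theta (h : Background σ ρ₁ ρ₂) :
    schurSeries (theta σ ρ₁ ρ₂) = shiftFactor σ ρ₁ ρ₂ (I * rho σ ρ₁ ρ₂) :=
  schurSeries_logOf (constantCoeff_shiftFactor (h.add_I_mul_ne _))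

theorem schurSeries_vartheta (h : Background σ ρ₁ ρ₂) :
    schurSeries (vartheta σ ρ₁ ρ₂) = shiftFactor σ ρ₁ ρ₂ (I * σ * ρ₁ * ρ₂) :=
  schurSeries_logOf (constantCoeff_shiftFactor (by
    rw [sign_mul_eq_ofReal]
    exact h.add_I_mul_ne _))

theorem schurSeries_zetaCoeff : schurSeries zetaCoeff = PowerSeries.exp ℂ :=
  schurSeries_logOf PowerSeries.constantCoeff_exp

theorem conjSeries_shiftFactor (c : ℂ) :
    conjSeries (shiftFactor σ ρ₁ ρ₂ c) = shiftFactor σ ρ₁ ρ₂ (starRingEnd ℂ c) := by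
  rw [shiftFactor, shiftFactor, shiftedExp_eq, shiftedExp_eq, map_mul, map_add,
    conjSeries_scaledExp, conjSeries_C, conjSeries_C, map_div₀, map_add, map_one, conj_ofReal]

/-- The series is simply `ln e^κ = κ`. -/
theorem conj_zetaCoeff (r : ℕ) : starRingEnd ℂ (zetaCoeff r) = zetaCoeff r := by
  have hX : PowerSeries.logOf (PowerSeries.exp ℂ) = PowerSeries.X := by
    refine PowerSeries.derivative.ext ?_ ?_
    · have h := derivative_logOf (PowerSeries.constantCoeff_exp (A := ℂ))
      rw [PowerSeries.derivative_exp] at h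
      rw [PowerSeries.derivative_X]
      have hu : PowerSeries.exp ℂ ≠ 0 := (PowerSeries.isUnit_exp ℂ).ne_zero
      exact mul_right_cancel₀ hu (h.trans (one_mul _).symm)
    · rw [PowerSeries.constantCoeff_logOf PowerSeries.constantCoeff_exp,
        PowerSeries.constantCoeff_X]
  rw [zetaCoeff, hX, PowerSeries.coeff_X]
  split_ifs <;> simp

variable (σ ρ₁ ρ₂) in
/-- The factor in the first variable of the kernel of `σ_{n,k,l}`. -/
def plusSeries (a : ℕ → ℂ) (n k l : ℤ) (x t : ℝ) : PowerSeries ℂ :=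
  schurSeries (xPlus σ ρ₁ ρ₂ a n k l x t) * gauge

variable (σ ρ₁ ρ₂) in
/-- The factor in the second variable of the kernel of `σ_{n,k,l}`. -/
def minusSeries (a : ℕ → ℂ) (n k l : ℤ) (x t : ℝ) : PowerSeries ℂ :=
  schurSeries (xMinus σ ρ₁ ρ₂ a n k l x t) * gauge

variable (σ ρ₁ ρ₂) in
/-- The generating series in two variables of the matrix entries of `σ_{n,k,l}`. -/
def tauKernel (a : ℕ → ℂ) (n k l : ℤ) (x t : ℝ) : PowerSeries (PowerSeries ℂ) :=
  inl (plusSeries σ ρ₁ ρ₂ a n k l x t) * inr (minusSeries σ ρ₁ ρ₂ a n k l x t) * cauchyKernel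

theorem entry_eq (a : ℕ → ℂ) (n k l : ℤ) (x t : ℝ) (i j : ℕ) :
    entry σ ρ₁ ρ₂ a n k l x t i j = coeff₂ i j (tauKernel σ ρ₁ ρ₂ a n k l x t) :=
  sum_schur_mul_schur _ _ i j

theorem tau_eq (a : ℕ → ℂ) (N : ℕ) (n k l : ℤ) (x t : ℝ) :
    tau σ ρ₁ ρ₂ a N n k l x t = (oddMatrix N (tauKernel σ ρ₁ ρ₂ a n k l x t)).det := by
  simp only [tau, oddMatrix, entry_eq]

/-! ### Elementary shifts -/

/-- `G` arises from `F` by the factor `w (P(κ) + c) / (c - Q(λ))`. -/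
def IsShift (P Q : PowerSeries ℂ) (c w : ℂ) (F G : PowerSeries (PowerSeries ℂ)) : Prop :=
  inr (PowerSeries.C c - Q) * G = inl (PowerSeries.C w) * (inl (P + PowerSeries.C c) * F)

variable (σ ρ₁ ρ₂) in
/-- The constant `-(ρ̂ - c) / (ρ̂ + c)`. -/
def shiftWeight (c : ℂ) : ℂ := -((rhoHat σ ρ₁ ρ₂ : ℂ) - c) / ((rhoHat σ ρ₁ ρ₂ : ℂ) + c)

/-- The first factor gains `(p+c)/(ρ̂+c)` and the second loses `(q-c)/(ρ̂-c)`; the two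
normalizations and the sign of `q-c` combine into `shiftWeight`. -/
theorem isShift_of_factor {c : ℂ} (hc : (rhoHat σ ρ₁ ρ₂ : ℂ) + c ≠ 0)
    (hc' : (rhoHat σ ρ₁ ρ₂ : ℂ) - c ≠ 0) {A A' B B' : PowerSeries ℂ}
    (hA : A' = A * shiftFactor σ ρ₁ ρ₂ c) (hB : B = B' * shiftFactor σ ρ₁ ρ₂ (-c)) :
    IsShift (scaledExp σ ρ₁ ρ₂) (scaledExp σ ρ₁ ρ₂) c (shiftWeight σ ρ₁ ρ₂ c)
      (inl A * inr B * cauchyKernel) (inl A' * inr B' * cauchyKernel) := by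
  have h1 : PowerSeries.C (shiftWeight σ ρ₁ ρ₂ c) * PowerSeries.C (1 / ((rhoHat σ ρ₁ ρ₂ : ℂ) + -c)) =
      -PowerSeries.C (1 / ((rhoHat σ ρ₁ ρ₂ : ℂ) + c)) := by
    rw [← map_mul, ← map_neg, shiftWeight, ← sub_eq_add_neg]
    congr 1
    field_simp
  have h2 := congrArg inl h1
  rw [IsShift, hA, hB, shiftFactor, shiftFactor, shiftedExp_eq, shiftedExp_eq]
  simp only [map_mul, map_add, map_sub, map_neg, ← inl_C] at h2 ⊢
  linear_combination (-(inl (scaledExp σ ρ₁ ρ₂) + inl (PowerSeries.C c)) * inl A * inr B' *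
    (inr (scaledExp σ ρ₁ ρ₂) - inl (PowerSeries.C c)) * cauchyKernel) * h2

theorem conj_I_mul (b : ℝ) : starRingEnd ℂ (I * b) = -(I * b) := by
  rw [map_mul, conj_I, conj_ofReal, neg_mul]

/-- The parameter `iρ` is imaginary, so the conjugated coefficients in `x⁻` exponentiate to the
factor with parameter `-iρ`, as `isShift_of_factor` requires. -/
theorem isShift_n (h : Background σ ρ₁ ρ₂) (a : ℕ → ℂ) (n n' k l : ℤ) (hn : n' = n + 1) (x t : ℝ) :
    IsShift (scaledExp σ ρ₁ ρ₂) (scaledExp σ ρ₁ ρ₂) (I * rho σ ρ₁ ρ₂)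
      (shiftWeight σ ρ₁ ρ₂ (I * rho σ ρ₁ ρ₂))
      (tauKernel σ ρ₁ ρ₂ a n k l x t) (tauKernel σ ρ₁ ρ₂ a n' k l x t) := by
  subst hn
  refine isShift_of_factor (h.add_I_mul_ne _) (h.sub_I_mul_ne _) ?_ ?_
  · rw [plusSeries, plusSeries, mul_right_comm, ← schurSeries_theta h, ← schurSeries_add]
    congr 2
    ext r
    simp only [xPlus]
    push_cast
    ring
  · rw [← conj_I_mul, ← conjSeries_shiftFactor, minusSeries, minusSeries, mul_right_comm,
      ← schurSeries_theta h, ← schurSeries_conj, ← schurSeries_add]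
    congr 2
    ext r
    simp only [xMinus]
    push_cast
    ring

theorem isShift_k (h : Background σ ρ₁ ρ₂) (a : ℕ → ℂ) (n k k' l : ℤ) (hk : k' = k + 1) (x t : ℝ) :
    IsShift (scaledExp σ ρ₁ ρ₂) (scaledExp σ ρ₁ ρ₂) (I * σ * ρ₁ * ρ₂)
      (shiftWeight σ ρ₁ ρ₂ (I * σ * ρ₁ * ρ₂))
      (tauKernel σ ρ₁ ρ₂ a n k l x t) (tauKernel σ ρ₁ ρ₂ a n k' l x t) := by
  subst hk
  have h1 := h.add_I_mul_ne (rho σ ρ₁ ρ₂ - 1)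
  have h2 := h.sub_I_mul_ne (rho σ ρ₁ ρ₂ - 1)
  rw [← sign_mul_eq_ofReal] at h1 h2
  refine isShift_of_factor h1 h2 ?_ ?_
  · rw [plusSeries, plusSeries, mul_right_comm, ← schurSeries_vartheta h, ← schurSeries_add]
    congr 2
    ext r
    simp only [xPlus]
    push_cast
    ring
  · have hconj : -(I * (σ : ℂ) * ρ₁ * ρ₂) = starRingEnd ℂ (I * (σ : ℂ) * ρ₁ * ρ₂) := by
      rw [sign_mul_eq_ofReal, conj_I_mul]
    rw [hconj, ← conjSeries_shiftFactor, minusSeries, minusSeries, mul_right_comm,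
      ← schurSeries_vartheta h, ← schurSeries_conj, ← schurSeries_add]
    congr 2
    ext r
    simp only [xMinus]
    push_cast
    ring

theorem shiftFactor_zero (h : Background σ ρ₁ ρ₂) :
    shiftFactor σ ρ₁ ρ₂ 0 = PowerSeries.exp ℂ := by
  rw [shiftFactor, shiftedExp_eq, map_zero, add_zero, add_zero, scaledExp, mul_assoc, ← map_mul,
    mul_one_div_cancel h.rhoHat_ne, map_one, mul_one]

theorem isShift_l (h : Background σ ρ₁ ρ₂) (a : ℕ → ℂ) (n k l l' : ℤ) (hl : l' = l + 1) (x t : ℝ) :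
    IsShift (scaledExp σ ρ₁ ρ₂) (scaledExp σ ρ₁ ρ₂) 0 (shiftWeight σ ρ₁ ρ₂ 0)
      (tauKernel σ ρ₁ ρ₂ a n k l x t) (tauKernel σ ρ₁ ρ₂ a n k l' x t) := by
  subst hl
  refine isShift_of_factor (by simpa using h.rhoHat_ne) (by simpa using h.rhoHat_ne) ?_ ?_
  · rw [shiftFactor_zero h, plusSeries, plusSeries, mul_right_comm, ← schurSeries_zetaCoeff,
      ← schurSeries_add]
    congr 2
    ext r
    simp only [xPlus]
    push_cast
    ring
  · rw [neg_zero, shiftFactor_zero h, minusSeries, minusSeries, mul_right_comm,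
      ← schurSeries_zetaCoeff, ← schurSeries_add]
    congr 2
    ext r
    simp only [xMinus]
    push_cast
    ring

theorem shiftWeight_ne {c : ℂ} (hc : (rhoHat σ ρ₁ ρ₂ : ℂ) + c ≠ 0)
    (hc' : (rhoHat σ ρ₁ ρ₂ : ℂ) - c ≠ 0) : shiftWeight σ ρ₁ ρ₂ c ≠ 0 :=
  div_ne_zero (neg_ne_zero.mpr hc') hc

/-! ### The algebraic reduction -/

theorem IsEvenSeries.add {e f : PowerSeries ℂ} (he : IsEvenSeries e) (hf : IsEvenSeries f) :
    IsEvenSeries (e + f) := fun n => by rw [map_add, he, hf, add_zero]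

theorem IsEvenSeries.C_mul {e : PowerSeries ℂ} (he : IsEvenSeries e) (c : ℂ) :
    IsEvenSeries (PowerSeries.C c * e) := fun n => by
  rw [PowerSeries.coeff_C_mul, he, mul_zero]

theorem isEvenSeries_C (c : ℂ) : IsEvenSeries (PowerSeries.C c) := fun n => by
  rw [PowerSeries.coeff_C, if_neg (Nat.succ_ne_zero _)]

theorem IsEvenSeries.conj {e : PowerSeries ℂ} (he : IsEvenSeries e) :
    IsEvenSeries (conjSeries e) := fun n => by
  rw [coeff_conjSeries, he, map_zero]

/-- The series of `e^{-κ}`. -/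
def expNeg : PowerSeries ℂ := PowerSeries.evalNegHom (PowerSeries.exp ℂ)

theorem exp_mul_expNeg : PowerSeries.exp ℂ * expNeg = 1 := PowerSeries.exp_mul_exp_neg_eq_one

theorem coeff_expNeg (n : ℕ) : coeff n expNeg = (-1) ^ n * coeff n (PowerSeries.exp ℂ) := by
  simp [expNeg, PowerSeries.evalNegHom, PowerSeries.coeff_rescale]

/-- `e^{mκ} + e^{-mκ}` is even. -/
theorem isEvenSeries_cosh (m : ℕ) : IsEvenSeries (PowerSeries.exp ℂ ^ m + expNeg ^ m) := by
  intro n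
  have h : expNeg ^ m = PowerSeries.evalNegHom (PowerSeries.exp ℂ ^ m) := by
    rw [expNeg, map_pow]
  rw [map_add, h, PowerSeries.evalNegHom, PowerSeries.coeff_rescale, pow_succ, pow_mul]
  simp

theorem conjSeries_expNeg : conjSeries expNeg = expNeg := by
  ext n
  rw [coeff_conjSeries, coeff_expNeg, map_mul, map_pow, map_neg, map_one, ← coeff_conjSeries,
    conjSeries_exp]

variable (σ ρ₁ ρ₂) in
/-- The normalized series of `(ρ̂ e^κ + i ρ) (ρ̂ e^κ + i σ ρ₁ ρ₂) / e^κ`. -/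
def reductionSeries : PowerSeries ℂ :=
  shiftFactor σ ρ₁ ρ₂ (I * rho σ ρ₁ ρ₂) * shiftFactor σ ρ₁ ρ₂ (I * σ * ρ₁ * ρ₂) * expNeg

/-- Because `(iρ)(iσρ₁ρ₂) = ρ(1-ρ) = ρ̂²`, expanding the product over `e^κ` leaves `ρ̂²(e^κ +
e^{-κ})` plus a constant. This is what singles out the value of `ρ̂`. -/
theorem isEvenSeries_reductionSeries (h : Background σ ρ₁ ρ₂) :
    IsEvenSeries (reductionSeries σ ρ₁ ρ₂) := by
  set r : ℂ := (rhoHat σ ρ₁ ρ₂ : ℂ) with hr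
  have key : reductionSeries σ ρ₁ ρ₂ =
      PowerSeries.C (1 / (r + I * rho σ ρ₁ ρ₂) * (1 / (r + I * σ * ρ₁ * ρ₂))) *
        (PowerSeries.C (r ^ 2) * (PowerSeries.exp ℂ ^ 1 + expNeg ^ 1) +
          PowerSeries.C (r * (I * rho σ ρ₁ ρ₂ + I * σ * ρ₁ * ρ₂))) := by
    have h1 : PowerSeries.C (I * rho σ ρ₁ ρ₂) * PowerSeries.C (I * σ * ρ₁ * ρ₂) =
        PowerSeries.C (r ^ 2) := by
      rw [← map_mul, hr, h.rhoHat_sq, sign_mul_eq]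
      congr 1
      linear_combination (rho σ ρ₁ ρ₂ * ((rho σ ρ₁ ρ₂ : ℂ) - 1)) * I_mul_I
    rw [reductionSeries, shiftFactor, shiftFactor, shiftedExp_eq, shiftedExp_eq, scaledExp, ← hr]
    simp only [map_mul, map_add, map_pow, pow_one] at h1 ⊢
    linear_combination (PowerSeries.C (1 / (r + I * rho σ ρ₁ ρ₂)) *
      PowerSeries.C (1 / (r + I * σ * ρ₁ * ρ₂))) * expNeg * h1 + (PowerSeries.C (1 / (r + I * rho σ ρ₁ ρ₂)) *
      PowerSeries.C (1 / (r + I * σ * ρ₁ * ρ₂))) * (PowerSeries.C r ^ 2 * PowerSeries.exp ℂ +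
        PowerSeries.C r * (PowerSeries.C I * PowerSeries.C (rho σ ρ₁ ρ₂ : ℂ) +
          PowerSeries.C I * PowerSeries.C (σ : ℂ) * PowerSeries.C (ρ₁ : ℂ) *
            PowerSeries.C (ρ₂ : ℂ))) * exp_mul_expNeg
  rw [key]
  exact (((isEvenSeries_cosh 1).C_mul _).add (isEvenSeries_C _)).C_mul _

theorem constantCoeff_expNeg : constantCoeff expNeg = 1 := by
  rw [← PowerSeries.coeff_zero_eq_constantCoeff_apply, coeff_expNeg]
  simp

theorem constantCoeff_reductionSeries (h : Background σ ρ₁ ρ₂) :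
    constantCoeff (reductionSeries σ ρ₁ ρ₂) = 1 := by
  have h1 := h.add_I_mul_ne (rho σ ρ₁ ρ₂ - 1)
  rw [← sign_mul_eq_ofReal] at h1
  rw [reductionSeries, map_mul, map_mul, constantCoeff_expNeg,
    constantCoeff_shiftFactor (h.add_I_mul_ne _), constantCoeff_shiftFactor h1, one_mul, one_mul]

theorem plusSeries_reduction (h : Background σ ρ₁ ρ₂) (a : ℕ → ℂ) (n k l : ℤ) (x t : ℝ) :
    plusSeries σ ρ₁ ρ₂ a (n + 1) (k + 1) (l - 1) x t =
      plusSeries σ ρ₁ ρ₂ a n k l x t * reductionSeries σ ρ₁ ρ₂ := by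
  have key : schurSeries (xPlus σ ρ₁ ρ₂ a (n + 1) (k + 1) (l - 1) x t) * PowerSeries.exp ℂ =
      schurSeries (xPlus σ ρ₁ ρ₂ a n k l x t) * (schurSeries (theta σ ρ₁ ρ₂) *
        schurSeries (vartheta σ ρ₁ ρ₂)) := by
    rw [← schurSeries_zetaCoeff, ← schurSeries_add, ← schurSeries_add, ← schurSeries_add]
    congr 1
    ext r
    simp only [xPlus]
    push_cast
    ring
  rw [schurSeries_theta h, schurSeries_vartheta h] at key
  rw [plusSeries, plusSeries, reductionSeries]
  generalize schurSeries (xPlus σ ρ₁ ρ₂ a (n + 1) (k + 1) (l - 1) x t) = F at *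
  generalize schurSeries (xPlus σ ρ₁ ρ₂ a n k l x t) = G at *
  linear_combination gauge * expNeg * key - gauge * F * exp_mul_expNeg

theorem minusSeries_reduction (h : Background σ ρ₁ ρ₂) (a : ℕ → ℂ) (n k l : ℤ) (x t : ℝ) :
    minusSeries σ ρ₁ ρ₂ a (n + 1) (k + 1) (l - 1) x t * conjSeries (reductionSeries σ ρ₁ ρ₂) =
      minusSeries σ ρ₁ ρ₂ a n k l x t := by
  have key : schurSeries (xMinus σ ρ₁ ρ₂ a n k l x t) * PowerSeries.exp ℂ =
      schurSeries (xMinus σ ρ₁ ρ₂ a (n + 1) (k + 1) (l - 1) x t) *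
        (conjSeries (schurSeries (theta σ ρ₁ ρ₂)) *
          conjSeries (schurSeries (vartheta σ ρ₁ ρ₂))) := by
    rw [← schurSeries_zetaCoeff, ← schurSeries_conj, ← schurSeries_conj, ← schurSeries_add,
      ← schurSeries_add, ← schurSeries_add]
    congr 1
    ext r
    simp only [xMinus]
    push_cast
    ring
  rw [schurSeries_theta h, schurSeries_vartheta h] at key
  rw [minusSeries, minusSeries, reductionSeries, map_mul, map_mul, conjSeries_expNeg]
  generalize schurSeries (xMinus σ ρ₁ ρ₂ a (n + 1) (k + 1) (l - 1) x t) = F at *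
  generalize schurSeries (xMinus σ ρ₁ ρ₂ a n k l x t) = G at *
  linear_combination (-gauge * expNeg) * key + gauge * G * exp_mul_expNeg

theorem isEvenSeries_one : IsEvenSeries 1 := by simpa using isEvenSeries_C 1

theorem constantCoeff_conjSeries (e : PowerSeries ℂ) :
    constantCoeff (conjSeries e) = starRingEnd ℂ (constantCoeff e) := by
  rw [← PowerSeries.coeff_zero_eq_constantCoeff_apply, coeff_conjSeries,
    PowerSeries.coeff_zero_eq_constantCoeff_apply]

/-- The two kernels agree once one is multiplied by an even series in `κ` and the other by its
conjugate in `λ`; odd minors do not see either factor. -/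
theorem tau_reduction (h : Background σ ρ₁ ρ₂) (a : ℕ → ℂ) (N : ℕ) (n k l : ℤ) (x t : ℝ) :
    tau σ ρ₁ ρ₂ a N (n + 1) (k + 1) (l - 1) x t = tau σ ρ₁ ρ₂ a N n k l x t := by
  have he := isEvenSeries_reductionSeries h
  have h0 := constantCoeff_reductionSeries h
  have h0' : constantCoeff (conjSeries (reductionSeries σ ρ₁ ρ₂)) = 1 := by
    rw [constantCoeff_conjSeries, h0, map_one]
  have h1 : constantCoeff (1 : PowerSeries ℂ) = 1 := map_one _
  have e1 := det_oddMatrix_even isEvenSeries_one he.conj h1 h0' N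
    (tauKernel σ ρ₁ ρ₂ a (n + 1) (k + 1) (l - 1) x t)
  have e2 := det_oddMatrix_even he isEvenSeries_one h0 h1 N (tauKernel σ ρ₁ ρ₂ a n k l x t)
  have e3 : inl 1 * tauKernel σ ρ₁ ρ₂ a (n + 1) (k + 1) (l - 1) x t *
      inr (conjSeries (reductionSeries σ ρ₁ ρ₂)) =
      inl (reductionSeries σ ρ₁ ρ₂) * tauKernel σ ρ₁ ρ₂ a n k l x t * inr 1 := by
    have h2 := congrArg inr (minusSeries_reduction h a n k l x t)
    rw [map_mul] at h2
    simp only [tauKernel, plusSeries_reduction h, ← h2, map_mul, map_one]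
    ring
  rw [e3] at e1
  exact (tau_eq a N _ _ _ x t).trans (e1.symm.trans (e2.trans (tau_eq a N n k l x t).symm))

/-! ### Evolution of the kernels -/

theorem hasCoeffDerivAt_schurSeries {z : ℝ → ℕ → ℂ} {s : ℝ} {F : PowerSeries ℂ}
    (hF : constantCoeff F = 0)
    (hz : ∀ r, HasDerivAt (fun y => z y (r + 1)) (coeff (r + 1) F) s) :
    HasCoeffDerivAt (fun y => schurSeries (z y)) (F * schurSeries (z s)) s :=
  fun n => hasDerivAt_schur hF hz n

variable (σ ρ₁ ρ₂) in
/-- The series `∑ α_r κ^r`. -/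
def alphaSeries : PowerSeries ℂ :=
  PowerSeries.C ((ρ₂ : ℂ) / ρ₁ * rhoHat σ ρ₁ ρ₂) * (PowerSeries.exp ℂ - 1)

variable (σ ρ₁ ρ₂) in
/-- The series `∑ β_r κ^r`. -/
def betaSeries : PowerSeries ℂ :=
  PowerSeries.C ((ρ₁ : ℂ) * rho σ ρ₁ ρ₂ / ρ₂) *
      (PowerSeries.C (1 / ((rhoHat σ ρ₁ ρ₂ : ℂ) + I * rho σ ρ₁ ρ₂)) -
        (shiftedExp σ ρ₁ ρ₂ (I * rho σ ρ₁ ρ₂))⁻¹)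

theorem coeff_alphaSeries (r : ℕ) : coeff r (alphaSeries σ ρ₁ ρ₂) = alpha σ ρ₁ ρ₂ r := rfl

theorem coeff_betaSeries (r : ℕ) : coeff r (betaSeries σ ρ₁ ρ₂) = beta σ ρ₁ ρ₂ r := rfl

theorem constantCoeff_alphaSeries : constantCoeff (alphaSeries σ ρ₁ ρ₂) = 0 := by
  rw [alphaSeries, map_mul, map_sub, PowerSeries.constantCoeff_exp, map_one, sub_self, mul_zero]

theorem constantCoeff_shiftedExp (c : ℂ) :
    constantCoeff (shiftedExp σ ρ₁ ρ₂ c) = (rhoHat σ ρ₁ ρ₂ : ℂ) + c := by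
  rw [shiftedExp_eq, map_add, constantCoeff_scaledExp, PowerSeries.constantCoeff_C]

theorem constantCoeff_betaSeries : constantCoeff (betaSeries σ ρ₁ ρ₂) = 0 := by
  rw [betaSeries, map_mul, map_sub, PowerSeries.constantCoeff_inv, constantCoeff_shiftedExp,
    PowerSeries.constantCoeff_C, PowerSeries.constantCoeff_C, one_div, sub_self, mul_zero]

theorem conj_alpha (r : ℕ) : starRingEnd ℂ (alpha σ ρ₁ ρ₂ r) = alpha σ ρ₁ ρ₂ r := by
  rw [← coeff_alphaSeries, ← coeff_conjSeries, alphaSeries, map_mul, map_sub, conjSeries_exp,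
    map_one, conjSeries_C]
  simp only [map_mul, map_div₀, conj_ofReal]

theorem hasDerivAt_linear (c d : ℂ) (s : ℝ) : HasDerivAt (fun y : ℝ => c * (y : ℂ) + d) c s := by
  simpa using ((hasDerivAt_id s).ofReal_comp.const_mul c).add_const d

theorem plusSeries_hasDeriv_x (a : ℕ → ℂ) (n k l : ℤ) (x t : ℝ) :
    HasCoeffDerivAt (fun y => plusSeries σ ρ₁ ρ₂ a n k l y t)
      (alphaSeries σ ρ₁ ρ₂ * plusSeries σ ρ₁ ρ₂ a n k l x t) x := by
  refine ((hasCoeffDerivAt_schurSeries constantCoeff_alphaSeries fun r => ?_).mul_const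
    gauge).congr_deriv (mul_assoc _ _ _)
  rw [coeff_alphaSeries]
  refine (hasDerivAt_linear (alpha σ ρ₁ ρ₂ (r + 1))
    (xPlus σ ρ₁ ρ₂ a n k l 0 t (r + 1)) x).congr_of_eventuallyEq (Filter.Eventually.of_forall ?_)
  intro y
  simp only [xPlus, ofReal_zero]
  ring

theorem minusSeries_hasDeriv_x (a : ℕ → ℂ) (n k l : ℤ) (x t : ℝ) :
    HasCoeffDerivAt (fun y => minusSeries σ ρ₁ ρ₂ a n k l y t)
      (alphaSeries σ ρ₁ ρ₂ * minusSeries σ ρ₁ ρ₂ a n k l x t) x := by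
  refine ((hasCoeffDerivAt_schurSeries constantCoeff_alphaSeries fun r => ?_).mul_const
    gauge).congr_deriv (mul_assoc _ _ _)
  rw [coeff_alphaSeries]
  refine (hasDerivAt_linear (alpha σ ρ₁ ρ₂ (r + 1))
    (xMinus σ ρ₁ ρ₂ a n k l 0 t (r + 1)) x).congr_of_eventuallyEq (Filter.Eventually.of_forall ?_)
  intro y
  simp only [xMinus, ofReal_zero]
  ring

theorem plusSeries_hasDeriv_t (a : ℕ → ℂ) (n k l : ℤ) (x t : ℝ) :
    HasCoeffDerivAt (fun y => plusSeries σ ρ₁ ρ₂ a n k l x y)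
      (betaSeries σ ρ₁ ρ₂ * plusSeries σ ρ₁ ρ₂ a n k l x t) t := by
  refine ((hasCoeffDerivAt_schurSeries constantCoeff_betaSeries fun r => ?_).mul_const
    gauge).congr_deriv (mul_assoc _ _ _)
  rw [coeff_betaSeries]
  refine (hasDerivAt_linear (beta σ ρ₁ ρ₂ (r + 1))
    (xPlus σ ρ₁ ρ₂ a n k l x 0 (r + 1)) t).congr_of_eventuallyEq (Filter.Eventually.of_forall ?_)
  intro y
  simp only [xPlus, ofReal_zero]
  ring

theorem minusSeries_hasDeriv_t (a : ℕ → ℂ) (n k l : ℤ) (x t : ℝ) :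
    HasCoeffDerivAt (fun y => minusSeries σ ρ₁ ρ₂ a n k l x y)
      (conjSeries (betaSeries σ ρ₁ ρ₂) * minusSeries σ ρ₁ ρ₂ a n k l x t) t := by
  have h0 : constantCoeff (conjSeries (betaSeries σ ρ₁ ρ₂)) = 0 := by
    rw [constantCoeff_conjSeries, constantCoeff_betaSeries, map_zero]
  refine ((hasCoeffDerivAt_schurSeries h0 fun r => ?_).mul_const
    gauge).congr_deriv (mul_assoc _ _ _)
  rw [coeff_conjSeries, coeff_betaSeries]
  refine (hasDerivAt_linear (starRingEnd ℂ (beta σ ρ₁ ρ₂ (r + 1)))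
    (xMinus σ ρ₁ ρ₂ a n k l x 0 (r + 1)) t).congr_of_eventuallyEq (Filter.Eventually.of_forall ?_)
  intro y
  simp only [xMinus, ofReal_zero]
  ring

/-- The bilinear identity, with the shifts composed. -/
theorem hasDerivAt_of_isShift {N : ℕ} {F₀ F F₁ F₂ : ℝ → PowerSeries (PowerSeries ℂ)}
    {A B A₀ B₀ : ℝ → PowerSeries ℂ} {P Q : PowerSeries ℂ}
    {s : ℝ} {c e₁ e₂ α β u w : ℂ}
    (hF : ∀ y, (inl P + inr Q) * F y = inl (A y) * inr (B y))
    (hF₀ : ∀ y, F y = inl (A₀ y) * inr (B₀ y) * cauchyKernel)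
    (hA : HasCoeffDerivAt A ((PowerSeries.C c * P + PowerSeries.C e₁) * A s) s)
    (hB : HasCoeffDerivAt B ((PowerSeries.C c * Q + PowerSeries.C e₂) * B s) s)
    (hA₀ : HasCoeffDerivAt A₀ ((PowerSeries.C c * P + PowerSeries.C e₁) * A₀ s) s)
    (hB₀ : HasCoeffDerivAt B₀ ((PowerSeries.C c * Q + PowerSeries.C e₂) * B₀ s) s)
    (hα : constantCoeff P + α ≠ 0) (hβ : constantCoeff Q - β ≠ 0) (hu : u ≠ 0)
    (h₀ : ∀ y, IsShift P Q α u (F₀ y) (F y))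
    (h₁ : IsShift P Q β w (F s) (F₁ s))
    (h₂ : ∀ y, IsShift P Q β w (F₀ y) (F₂ y))
    (hd : (oddMatrix N (F s)).det ≠ 0) :
    HasDerivAt (fun y => (oddMatrix N (F₂ y)).det / (oddMatrix N (F y)).det)
      (c * (α - β) * ((oddMatrix N (F₁ s)).det * (oddMatrix N (F₀ s)).det /
        (oddMatrix N (F s)).det ^ 2 -
        (oddMatrix N (F₂ s)).det / (oddMatrix N (F s)).det)) s := by
  have hcu : inl (PowerSeries.C u⁻¹) * inl (PowerSeries.C u) = 1 := by
    rw [← map_mul, ← map_mul, inv_mul_cancel₀ hu, map_one, map_one]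
  have h₀' : ∀ y, inl (P + PowerSeries.C α) * F₀ y =
      inl (PowerSeries.C u⁻¹) * (inr (PowerSeries.C α - Q) * F y) := by
    intro y
    have := h₀ y
    rw [IsShift] at this
    linear_combination (-inl (P + PowerSeries.C α) * F₀ y) * hcu - inl (PowerSeries.C u⁻¹) * this
  refine hasDerivAt_shift_quotient (P := P) (Q := Q) (u := u⁻¹) (w := w)
    (Pα := (P + PowerSeries.C α)⁻¹) (Qβ := (Q - PowerSeries.C β)⁻¹) hF ?_ hA hB
    (PowerSeries.mul_inv_cancel _ ?_) (PowerSeries.mul_inv_cancel _ ?_) (h₀' s) h₁ ?_ hd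
  · intro i j
    simp only [hF₀]
    refine (hA₀.coeff₂_cauchyKernel hB₀ i j).congr_deriv ?_
    congr 1
    simp only [map_mul, map_add, ← inl_C]
    ring
  · rwa [map_add, PowerSeries.constantCoeff_C]
  · rwa [map_sub, PowerSeries.constantCoeff_C]
  · intro y
    have h3 := h₂ y
    rw [IsShift] at h3
    rw [map_mul, map_mul]
    linear_combination inl (P + PowerSeries.C α) * h3 +
      inl (PowerSeries.C w) * inl (P + PowerSeries.C β) * h₀' y

/-- The generator `p+q` of the `x`-flow cancels the Cauchy denominator. -/
theorem scaledExp_mul_cauchyKernel :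
    (inl (scaledExp σ ρ₁ ρ₂) + inr (scaledExp σ ρ₁ ρ₂)) * cauchyKernel =
      inl (PowerSeries.C (rhoHat σ ρ₁ ρ₂ : ℂ)) := by
  rw [scaledExp, map_mul, map_mul, ← inl_C]
  linear_combination inl (PowerSeries.C (rhoHat σ ρ₁ ρ₂ : ℂ)) * cauchyKernel_spec

theorem alphaSeries_eq : alphaSeries σ ρ₁ ρ₂ = PowerSeries.C ((ρ₂ : ℂ) / ρ₁) * scaledExp σ ρ₁ ρ₂ +
    PowerSeries.C (-((ρ₂ : ℂ) / ρ₁ * rhoHat σ ρ₁ ρ₂)) := by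
  simp only [alphaSeries, scaledExp, map_mul, map_neg]
  ring

/-- The bilinear identity in the variable `x`. -/
theorem hasDerivAt_x_of_isShift {N : ℕ} {a : ℕ → ℂ} {n k l : ℤ}
    {F₀ F₁ F₂ : ℝ → PowerSeries (PowerSeries ℂ)} {x t : ℝ} {α β u w : ℂ}
    (hα : (rhoHat σ ρ₁ ρ₂ : ℂ) + α ≠ 0) (hβ : (rhoHat σ ρ₁ ρ₂ : ℂ) - β ≠ 0) (hu : u ≠ 0)
    (h₀ : ∀ y, IsShift (scaledExp σ ρ₁ ρ₂) (scaledExp σ ρ₁ ρ₂) α u (F₀ y)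
      (tauKernel σ ρ₁ ρ₂ a n k l y t))
    (h₁ : IsShift (scaledExp σ ρ₁ ρ₂) (scaledExp σ ρ₁ ρ₂) β w
      (tauKernel σ ρ₁ ρ₂ a n k l x t) (F₁ x))
    (h₂ : ∀ y, IsShift (scaledExp σ ρ₁ ρ₂) (scaledExp σ ρ₁ ρ₂) β w (F₀ y) (F₂ y))
    (hd : tau σ ρ₁ ρ₂ a N n k l x t ≠ 0) :
    HasDerivAt (fun y => (oddMatrix N (F₂ y)).det / tau σ ρ₁ ρ₂ a N n k l y t)
      ((ρ₂ : ℂ) / ρ₁ * (α - β) * ((oddMatrix N (F₁ x)).det * (oddMatrix N (F₀ x)).det /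
        tau σ ρ₁ ρ₂ a N n k l x t ^ 2 -
        (oddMatrix N (F₂ x)).det / tau σ ρ₁ ρ₂ a N n k l x t)) x := by
  simp only [tau_eq] at hd ⊢
  refine hasDerivAt_of_isShift (P := scaledExp σ ρ₁ ρ₂) (Q := scaledExp σ ρ₁ ρ₂)
    (A₀ := fun y => plusSeries σ ρ₁ ρ₂ a n k l y t) (B₀ := fun y => minusSeries σ ρ₁ ρ₂ a n k l y t)
    (A := fun y => plusSeries σ ρ₁ ρ₂ a n k l y t * PowerSeries.C (rhoHat σ ρ₁ ρ₂ : ℂ))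
    (B := fun y => minusSeries σ ρ₁ ρ₂ a n k l y t)
    (e₁ := -((ρ₂ : ℂ) / ρ₁ * rhoHat σ ρ₁ ρ₂)) (e₂ := -((ρ₂ : ℂ) / ρ₁ * rhoHat σ ρ₁ ρ₂))
    (α := α) (β := β) (u := u) (w := w)
    ?_ (fun y => rfl) ?_ ?_ ?_ ?_ ?_ ?_ hu h₀ h₁ h₂ hd
  · intro y
    rw [map_mul, tauKernel]
    linear_combination inl (plusSeries σ ρ₁ ρ₂ a n k l y t) *
      inr (minusSeries σ ρ₁ ρ₂ a n k l y t) * scaledExp_mul_cauchyKernel (σ := σ) (ρ₁ := ρ₁) (ρ₂ := ρ₂)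
  · rw [← alphaSeries_eq]
    exact ((plusSeries_hasDeriv_x a n k l x t).mul_const _).congr_deriv (mul_assoc _ _ _)
  · rw [← alphaSeries_eq]
    exact minusSeries_hasDeriv_x a n k l x t
  · rw [← alphaSeries_eq]
    exact plusSeries_hasDeriv_x a n k l x t
  · rw [← alphaSeries_eq]
    exact minusSeries_hasDeriv_x a n k l x t
  · rwa [constantCoeff_scaledExp]
  · rwa [constantCoeff_scaledExp]

/-! ### Evolution in `t` and the inverted spectral variable -/

variable (σ ρ₁ ρ₂) in
/-- The series of `-1 / (ρ̂ e^κ + i ρ)`. -/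
def invertedExp : PowerSeries ℂ := -(shiftedExp σ ρ₁ ρ₂ (I * rho σ ρ₁ ρ₂))⁻¹

/-- The `t`-flow is affine in `P = -1/(p+iρ)` as the `x`-flow is affine in `p`, so the same bilinear
identity applies after this change of variable. -/
theorem betaSeries_eq : betaSeries σ ρ₁ ρ₂ =
    PowerSeries.C ((ρ₁ : ℂ) * rho σ ρ₁ ρ₂ / ρ₂) * invertedExp σ ρ₁ ρ₂ +
    PowerSeries.C ((ρ₁ : ℂ) * rho σ ρ₁ ρ₂ / ρ₂ *
      (1 / ((rhoHat σ ρ₁ ρ₂ : ℂ) + I * rho σ ρ₁ ρ₂))) := by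
  simp only [betaSeries, invertedExp, map_mul]
  ring

theorem conjSeries_betaSeries_eq : conjSeries (betaSeries σ ρ₁ ρ₂) =
    PowerSeries.C ((ρ₁ : ℂ) * rho σ ρ₁ ρ₂ / ρ₂) * conjSeries (invertedExp σ ρ₁ ρ₂) +
    PowerSeries.C (starRingEnd ℂ ((ρ₁ : ℂ) * rho σ ρ₁ ρ₂ / ρ₂ *
      (1 / ((rhoHat σ ρ₁ ρ₂ : ℂ) + I * rho σ ρ₁ ρ₂)))) := by
  rw [betaSeries_eq, map_add, map_mul, conjSeries_C, conjSeries_C, map_div₀, map_mul, conj_ofReal,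
    conj_ofReal, conj_ofReal]

theorem invertedExp_mul (h : Background σ ρ₁ ρ₂) :
    (scaledExp σ ρ₁ ρ₂ + PowerSeries.C (I * rho σ ρ₁ ρ₂)) * invertedExp σ ρ₁ ρ₂ = -1 := by
  rw [← shiftedExp_eq, invertedExp, mul_neg, PowerSeries.mul_inv_cancel]
  rw [constantCoeff_shiftedExp]
  exact h.add_I_mul_ne _

theorem conj_invertedExp_mul (h : Background σ ρ₁ ρ₂) :
    (scaledExp σ ρ₁ ρ₂ - PowerSeries.C (I * rho σ ρ₁ ρ₂)) * conjSeries (invertedExp σ ρ₁ ρ₂) =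
      -1 := by
  have := congrArg conjSeries (invertedExp_mul h)
  rwa [map_mul, map_add, conjSeries_scaledExp, conjSeries_C, conj_I_mul, map_neg, map_neg, map_one,
    ← sub_eq_add_neg] at this

/-- The bilinear identity in the variable `t`. -/
theorem hasDerivAt_t_of_isShift (h : Background σ ρ₁ ρ₂) {N : ℕ} {a : ℕ → ℂ} {n k l : ℤ}
    {F₀ F₁ F₂ : ℝ → PowerSeries (PowerSeries ℂ)} {x t : ℝ} {α β u w : ℂ}
    (hα : constantCoeff (invertedExp σ ρ₁ ρ₂) + α ≠ 0)
    (hβ : constantCoeff (conjSeries (invertedExp σ ρ₁ ρ₂)) - β ≠ 0) (hu : u ≠ 0)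
    (h₀ : ∀ y, IsShift (invertedExp σ ρ₁ ρ₂) (conjSeries (invertedExp σ ρ₁ ρ₂)) α u (F₀ y)
      (tauKernel σ ρ₁ ρ₂ a n k l x y))
    (h₁ : IsShift (invertedExp σ ρ₁ ρ₂) (conjSeries (invertedExp σ ρ₁ ρ₂)) β w
      (tauKernel σ ρ₁ ρ₂ a n k l x t) (F₁ t))
    (h₂ : ∀ y, IsShift (invertedExp σ ρ₁ ρ₂) (conjSeries (invertedExp σ ρ₁ ρ₂)) β w
      (F₀ y) (F₂ y))
    (hd : tau σ ρ₁ ρ₂ a N n k l x t ≠ 0) :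
    HasDerivAt (fun y => (oddMatrix N (F₂ y)).det / tau σ ρ₁ ρ₂ a N n k l x y)
      ((ρ₁ : ℂ) * rho σ ρ₁ ρ₂ / ρ₂ * (α - β) *
        ((oddMatrix N (F₁ t)).det * (oddMatrix N (F₀ t)).det /
        tau σ ρ₁ ρ₂ a N n k l x t ^ 2 -
        (oddMatrix N (F₂ t)).det / tau σ ρ₁ ρ₂ a N n k l x t)) t := by
  simp only [tau_eq] at hd ⊢
  refine hasDerivAt_of_isShift (P := invertedExp σ ρ₁ ρ₂) (Q := conjSeries (invertedExp σ ρ₁ ρ₂))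
    (A₀ := fun y => plusSeries σ ρ₁ ρ₂ a n k l x y) (B₀ := fun y => minusSeries σ ρ₁ ρ₂ a n k l x y)
    (A := fun y => plusSeries σ ρ₁ ρ₂ a n k l x y *
      (PowerSeries.C (rhoHat σ ρ₁ ρ₂ : ℂ) * invertedExp σ ρ₁ ρ₂))
    (B := fun y => minusSeries σ ρ₁ ρ₂ a n k l x y * -conjSeries (invertedExp σ ρ₁ ρ₂))
    (e₁ := (ρ₁ : ℂ) * rho σ ρ₁ ρ₂ / ρ₂ *
      (1 / ((rhoHat σ ρ₁ ρ₂ : ℂ) + I * rho σ ρ₁ ρ₂)))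
    (e₂ := starRingEnd ℂ ((ρ₁ : ℂ) * rho σ ρ₁ ρ₂ / ρ₂ *
      (1 / ((rhoHat σ ρ₁ ρ₂ : ℂ) + I * rho σ ρ₁ ρ₂))))
    (α := α) (β := β) (u := u) (w := w)
    ?_ (fun y => rfl) ?_ ?_ ?_ ?_ hα hβ hu h₀ h₁ h₂ hd
  -- Here `P+Q = -(p+q)PQ`; hence the extra factors `ρ̂P` and `-Q` in `A` and `B`.
  · intro y
    have h1 := congrArg inl (invertedExp_mul h)
    have h2 := congrArg inr (conj_invertedExp_mul h)
    have h3 := scaledExp_mul_cauchyKernel (σ := σ) (ρ₁ := ρ₁) (ρ₂ := ρ₂)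
    simp only [map_mul, map_add, map_sub, map_neg, map_one, ← inl_C, tauKernel] at h1 h2 h3 ⊢
    generalize inl (plusSeries σ ρ₁ ρ₂ a n k l x y) = A
    generalize inr (minusSeries σ ρ₁ ρ₂ a n k l x y) = B
    generalize inl (invertedExp σ ρ₁ ρ₂) = P at *
    generalize inr (conjSeries (invertedExp σ ρ₁ ρ₂)) = Q at *
    generalize inl (scaledExp σ ρ₁ ρ₂) = p at *
    generalize inr (scaledExp σ ρ₁ ρ₂) = q at *
    linear_combination (-A * B * P * Q) * h3 + A * B * Q * cauchyKernel * h1 +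
      A * B * P * cauchyKernel * h2
  · rw [← betaSeries_eq]
    exact ((plusSeries_hasDeriv_t a n k l x t).mul_const _).congr_deriv (mul_assoc _ _ _)
  · rw [← conjSeries_betaSeries_eq]
    exact ((minusSeries_hasDeriv_t a n k l x t).mul_const _).congr_deriv (mul_assoc _ _ _)
  · rw [← betaSeries_eq]
    exact plusSeries_hasDeriv_t a n k l x t
  · rw [← conjSeries_betaSeries_eq]
    exact minusSeries_hasDeriv_t a n k l x t

/-- Shifts with respect to the inverted variable. -/
theorem isShift_inverted (h : Background σ ρ₁ ρ₂) {F F' G : PowerSeries (PowerSeries ℂ)}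
    {c w w₁ : ℂ} (hc : I * rho σ ρ₁ ρ₂ - c ≠ 0) (hw₁ : w₁ ≠ 0)
    (h₁ : IsShift (scaledExp σ ρ₁ ρ₂) (scaledExp σ ρ₁ ρ₂) (I * rho σ ρ₁ ρ₂) w₁ F' F)
    (h₂ : IsShift (scaledExp σ ρ₁ ρ₂) (scaledExp σ ρ₁ ρ₂) c w F' G) :
    IsShift (invertedExp σ ρ₁ ρ₂) (conjSeries (invertedExp σ ρ₁ ρ₂)) (1 / (I * rho σ ρ₁ ρ₂ - c))
      (w / w₁) F G := by
  have k1 := congrArg inl (invertedExp_mul h)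
  have k2 := congrArg inr (conj_invertedExp_mul h)
  have k3 : inl (PowerSeries.C (w / w₁)) * inl (PowerSeries.C w₁) = inl (PowerSeries.C w) := by
    rw [← map_mul, ← map_mul, div_mul_cancel₀ _ hw₁]
  have k4 : inl (PowerSeries.C (1 / (I * rho σ ρ₁ ρ₂ - c))) *
      (inl (PowerSeries.C (I * rho σ ρ₁ ρ₂)) - inl (PowerSeries.C c)) = 1 := by
    rw [← map_sub, ← map_sub, ← map_mul, ← map_mul, one_div_mul_cancel hc, map_one, map_one]
  rw [IsShift] at h₁ h₂ ⊢
  rw [map_sub, map_add, ← inl_C] at h₁ h₂ ⊢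
  rw [map_mul, map_add, map_neg, map_one] at k1
  rw [map_mul, map_sub, map_neg, map_one, ← inl_C] at k2
  generalize inl (PowerSeries.C (I * rho σ ρ₁ ρ₂)) = a at *
  generalize inl (PowerSeries.C (1 / (I * rho σ ρ₁ ρ₂ - c))) = d at *
  generalize inl (PowerSeries.C (w / w₁)) = e at *
  generalize inl (PowerSeries.C w₁) = v₁ at *
  generalize inl (PowerSeries.C w) = v at *
  generalize inl (PowerSeries.C c) = b at *
  generalize inl (invertedExp σ ρ₁ ρ₂) = P at *
  generalize inr (conjSeries (invertedExp σ ρ₁ ρ₂)) = Q at *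
  generalize inl (scaledExp σ ρ₁ ρ₂) = p at *
  generalize inr (scaledExp σ ρ₁ ρ₂) = q at *
  -- With `d = 1/(iρ-c)`, the factors `d-Q` and `P+d` are `c-q` and `p+c` up to the denominators of
  -- `Q` and `P`. Those denominators amount to undoing an `iρ`-shift, which is `m3`.
  have m1 : (d - Q) = d * (b - q) * Q := by linear_combination Q * k4 + d * k2
  have m2 : P + d = -(d * (p + b) * P) := by linear_combination (-P) * k4 + d * k1
  have m3 : e * (P * F) = -(v * Q * F') := by
    linear_combination (e * P * Q) * h₁ + e * P * F * k2 + e * v₁ * Q * F' * k1 - Q * F' * k3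
  rw [m1, m2]
  linear_combination d * Q * h₂ + d * (p + b) * m3

/-- Undoing the `iρ`-shift alone is the limit `c → ∞` of the parameter `1/(iρ-c)`. -/
theorem isShift_inverted_zero (h : Background σ ρ₁ ρ₂) {F F' : PowerSeries (PowerSeries ℂ)}
    {w : ℂ} (hw : w ≠ 0)
    (h₁ : IsShift (scaledExp σ ρ₁ ρ₂) (scaledExp σ ρ₁ ρ₂) (I * rho σ ρ₁ ρ₂) w F' F) :
    IsShift (invertedExp σ ρ₁ ρ₂) (conjSeries (invertedExp σ ρ₁ ρ₂)) 0 w⁻¹ F F' := by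
  have k1 := congrArg inl (invertedExp_mul h)
  have k2 := congrArg inr (conj_invertedExp_mul h)
  have k3 : inl (PowerSeries.C w⁻¹) * inl (PowerSeries.C w) = 1 := by
    rw [← map_mul, ← map_mul, inv_mul_cancel₀ hw, map_one, map_one]
  rw [IsShift] at h₁ ⊢
  simp only [map_sub, map_add, ← inl_C, map_zero, zero_sub, add_zero, map_neg] at h₁ ⊢
  rw [map_mul, map_add, map_neg, map_one] at k1
  rw [map_mul, map_sub, map_neg, map_one, ← inl_C] at k2
  generalize inl (PowerSeries.C (I * rho σ ρ₁ ρ₂)) = a at *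
  generalize inl (PowerSeries.C w⁻¹) = e at *
  generalize inl (PowerSeries.C w) = v at *
  generalize inl (invertedExp σ ρ₁ ρ₂) = P at *
  generalize inr (conjSeries (invertedExp σ ρ₁ ρ₂)) = Q at *
  generalize inl (scaledExp σ ρ₁ ρ₂) = p at *
  generalize inr (scaledExp σ ρ₁ ρ₂) = q at *
  linear_combination (-e * P * Q) * h₁ - e * P * F * k2 - e * v * Q * F' * k1 + Q * F' * k3

/-! ### The bilinear equations of the massive Thirring model -/

theorem constantCoeff_invertedExp :
    constantCoeff (invertedExp σ ρ₁ ρ₂) = -((rhoHat σ ρ₁ ρ₂ : ℂ) + I * rho σ ρ₁ ρ₂)⁻¹ := by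
  rw [invertedExp, map_neg, PowerSeries.constantCoeff_inv, constantCoeff_shiftedExp]

theorem constantCoeff_conj_invertedExp :
    constantCoeff (conjSeries (invertedExp σ ρ₁ ρ₂)) =
      -((rhoHat σ ρ₁ ρ₂ : ℂ) - I * rho σ ρ₁ ρ₂)⁻¹ := by
  rw [constantCoeff_conjSeries, constantCoeff_invertedExp, map_neg, map_inv₀, map_add, conj_I_mul,
    conj_ofReal, ← sub_eq_add_neg]

namespace Background

theorem I_mul_rho_ne (h : Background σ ρ₁ ρ₂) : I * (rho σ ρ₁ ρ₂ : ℂ) ≠ 0 :=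
  mul_ne_zero I_ne_zero (ofReal_ne_zero.mpr h.rho_pos.ne')

theorem add_sign_ne (h : Background σ ρ₁ ρ₂) :
    (rhoHat σ ρ₁ ρ₂ : ℂ) + I * σ * ρ₁ * ρ₂ ≠ 0 := by
  rw [sign_mul_eq_ofReal]
  exact h.add_I_mul_ne _

theorem sub_sign_ne (h : Background σ ρ₁ ρ₂) :
    (rhoHat σ ρ₁ ρ₂ : ℂ) - I * σ * ρ₁ * ρ₂ ≠ 0 := by
  rw [sign_mul_eq_ofReal]
  exact h.sub_I_mul_ne _

theorem conj_inverted_sub_ne (h : Background σ ρ₁ ρ₂) {c : ℂ}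
    (hc : I * (rho σ ρ₁ ρ₂ : ℂ) - c ≠ 0) (hc' : (rhoHat σ ρ₁ ρ₂ : ℂ) - c ≠ 0) :
    constantCoeff (conjSeries (invertedExp σ ρ₁ ρ₂)) - 1 / (I * rho σ ρ₁ ρ₂ - c) ≠ 0 := by
  have h1 := h.sub_I_mul_ne (rho σ ρ₁ ρ₂)
  have h2 : -((rhoHat σ ρ₁ ρ₂ : ℂ) - I * rho σ ρ₁ ρ₂)⁻¹ - 1 / (I * rho σ ρ₁ ρ₂ - c) =
      -(((rhoHat σ ρ₁ ρ₂ : ℂ) - c) /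
        (((rhoHat σ ρ₁ ρ₂ : ℂ) - I * rho σ ρ₁ ρ₂) * (I * rho σ ρ₁ ρ₂ - c))) := by
    field_simp
    ring
  rw [constantCoeff_conj_invertedExp, h2]
  exact neg_ne_zero.mpr (div_ne_zero hc' (mul_ne_zero h1 hc))

theorem inverted_add_ne (h : Background σ ρ₁ ρ₂) :
    constantCoeff (invertedExp σ ρ₁ ρ₂) + 1 / (I * rho σ ρ₁ ρ₂ - 0) ≠ 0 := by
  have h1 := h.add_I_mul_ne (rho σ ρ₁ ρ₂)
  have h3 : (rho σ ρ₁ ρ₂ : ℂ) ≠ 0 := ofReal_ne_zero.mpr h.rho_pos.ne'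
  have h2 : -((rhoHat σ ρ₁ ρ₂ : ℂ) + I * rho σ ρ₁ ρ₂)⁻¹ + 1 / (I * rho σ ρ₁ ρ₂ - 0) =
      (rhoHat σ ρ₁ ρ₂ : ℂ) /
        (((rhoHat σ ρ₁ ρ₂ : ℂ) + I * rho σ ρ₁ ρ₂) * (I * rho σ ρ₁ ρ₂)) := by
    rw [sub_zero]
    have := h.I_mul_rho_ne
    field_simp
    ring
  rw [constantCoeff_invertedExp, h2]
  exact div_ne_zero h.rhoHat_ne (mul_ne_zero h1 h.I_mul_rho_ne)

theorem I_mul_rho_sub_sign : I * (rho σ ρ₁ ρ₂ : ℂ) - I * σ * ρ₁ * ρ₂ = I := by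
  rw [sign_mul_eq]
  ring

theorem weight_n_ne (h : Background σ ρ₁ ρ₂) : shiftWeight σ ρ₁ ρ₂ (I * rho σ ρ₁ ρ₂) ≠ 0 :=
  shiftWeight_ne (h.add_I_mul_ne _) (h.sub_I_mul_ne _)

theorem weight_k_ne (h : Background σ ρ₁ ρ₂) : shiftWeight σ ρ₁ ρ₂ (I * σ * ρ₁ * ρ₂) ≠ 0 :=
  shiftWeight_ne h.add_sign_ne h.sub_sign_ne

theorem weight_l_ne (h : Background σ ρ₁ ρ₂) : shiftWeight σ ρ₁ ρ₂ 0 ≠ 0 :=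
  shiftWeight_ne (by simpa using h.rhoHat_ne) (by simpa using h.rhoHat_ne)

end Background

section TauDerivatives

variable (a : ℕ → ℂ) (N : ℕ)

/-- The bilinear identity with `α = iρ`, `β = iσρ₁ρ₂`, so `α-β = i`. The singly shifted `σ_{0,1,0}`
is `h` by the reduction. -/
theorem hasDerivAt_g_div_f (h : Background σ ρ₁ ρ₂) {x t : ℝ}
    (hd : tau σ ρ₁ ρ₂ a N 0 0 0 x t ≠ 0) :
    HasDerivAt (fun y => tau σ ρ₁ ρ₂ a N (-1) 1 0 y t / tau σ ρ₁ ρ₂ a N 0 0 0 y t)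
      ((ρ₂ : ℂ) / ρ₁ * I * (tau σ ρ₁ ρ₂ a N (-1) 0 1 x t * tau σ ρ₁ ρ₂ a N (-1) 0 0 x t /
        tau σ ρ₁ ρ₂ a N 0 0 0 x t ^ 2 -
        tau σ ρ₁ ρ₂ a N (-1) 1 0 x t / tau σ ρ₁ ρ₂ a N 0 0 0 x t)) x := by
  have key := hasDerivAt_x_of_isShift (N := N) (a := a) (n := 0) (k := 0) (l := 0)
    (F₀ := fun y => tauKernel σ ρ₁ ρ₂ a (-1) 0 0 y t)
    (F₁ := fun y => tauKernel σ ρ₁ ρ₂ a 0 1 0 y t)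
    (F₂ := fun y => tauKernel σ ρ₁ ρ₂ a (-1) 1 0 y t)
    (h.add_I_mul_ne _) h.sub_sign_ne h.weight_n_ne
    (fun y => isShift_n h a (-1) 0 0 0 rfl y t)
    (isShift_k h a 0 0 1 0 rfl x t)
    (fun y => isShift_k h a (-1) 0 1 0 rfl y t) hd
  simp only [← tau_eq, Background.I_mul_rho_sub_sign] at key
  have hr := tau_reduction h a N (-1) 0 1 x t
  norm_num at hr
  rwa [hr] at key

/-- Parameters `α = iσρ₁ρ₂`, `β = 0`, with base point `σ_{0,1,-1}`, which the reduction identifies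
with `f^*`. -/
theorem hasDerivAt_f_div_conj (h : Background σ ρ₁ ρ₂) {x t : ℝ}
    (hd : tau σ ρ₁ ρ₂ a N (-1) 0 0 x t ≠ 0) :
    HasDerivAt (fun y => tau σ ρ₁ ρ₂ a N 0 0 0 y t / tau σ ρ₁ ρ₂ a N (-1) 0 0 y t)
      ((ρ₂ : ℂ) / ρ₁ * (I * σ * ρ₁ * ρ₂) *
        (tau σ ρ₁ ρ₂ a N (-1) 0 1 x t * tau σ ρ₁ ρ₂ a N 0 0 (-1) x t /
        tau σ ρ₁ ρ₂ a N (-1) 0 0 x t ^ 2 -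
        tau σ ρ₁ ρ₂ a N 0 0 0 x t / tau σ ρ₁ ρ₂ a N (-1) 0 0 x t)) x := by
  have hr : ∀ y, tau σ ρ₁ ρ₂ a N 0 1 (-1) y t = tau σ ρ₁ ρ₂ a N (-1) 0 0 y t := by
    intro y
    have := tau_reduction h a N (-1) 0 0 y t
    norm_num at this
    exact this
  have hr' := tau_reduction h a N (-1) 0 1 x t
  norm_num at hr'
  have key := hasDerivAt_x_of_isShift (N := N) (a := a) (n := 0) (k := 1) (l := -1)
    (F₀ := fun y => tauKernel σ ρ₁ ρ₂ a 0 0 (-1) y t)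
    (F₁ := fun y => tauKernel σ ρ₁ ρ₂ a 0 1 0 y t)
    (F₂ := fun y => tauKernel σ ρ₁ ρ₂ a 0 0 0 y t)
    h.add_sign_ne (by simpa using h.rhoHat_ne) h.weight_k_ne
    (fun y => isShift_k h a 0 0 1 (-1) rfl y t)
    (isShift_l h a 0 1 (-1) 0 rfl x t)
    (fun y => isShift_l h a 0 0 (-1) 0 rfl y t) (by rwa [hr])
  simpa only [← tau_eq, hr, hr', sub_zero] using key

/-- Inverted parameters `0` and `1/(iρ)`: going from `f` to `f^*` undoes an `n`-shift, and `h`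
arises by the `l`-shift. The remaining `σ_{-2,0,1}` is `g` by the reduction. -/
theorem hasDerivAt_h_div_conj (h : Background σ ρ₁ ρ₂) {x t : ℝ}
    (hd : tau σ ρ₁ ρ₂ a N (-1) 0 0 x t ≠ 0) :
    HasDerivAt (fun y => tau σ ρ₁ ρ₂ a N (-1) 0 1 x y / tau σ ρ₁ ρ₂ a N (-1) 0 0 x y)
      ((ρ₁ : ℂ) * rho σ ρ₁ ρ₂ / ρ₂ * (0 - 1 / (I * rho σ ρ₁ ρ₂ - 0)) *
        (tau σ ρ₁ ρ₂ a N (-1) 1 0 x t * tau σ ρ₁ ρ₂ a N 0 0 0 x t /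
        tau σ ρ₁ ρ₂ a N (-1) 0 0 x t ^ 2 -
        tau σ ρ₁ ρ₂ a N (-1) 0 1 x t / tau σ ρ₁ ρ₂ a N (-1) 0 0 x t)) t := by
  have hr' := tau_reduction h a N (-2) 0 1 x t
  norm_num at hr'
  have h0 : I * (rho σ ρ₁ ρ₂ : ℂ) - 0 ≠ 0 := by simpa using h.I_mul_rho_ne
  have hα : constantCoeff (invertedExp σ ρ₁ ρ₂) + 0 ≠ 0 := by
    rw [constantCoeff_invertedExp, add_zero]
    exact neg_ne_zero.mpr (inv_ne_zero (h.add_I_mul_ne _))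
  have key := hasDerivAt_t_of_isShift h (N := N) (a := a) (n := -1) (k := 0) (l := 0)
    (F₀ := fun y => tauKernel σ ρ₁ ρ₂ a 0 0 0 x y)
    (F₁ := fun y => tauKernel σ ρ₁ ρ₂ a (-2) 0 1 x y)
    (F₂ := fun y => tauKernel σ ρ₁ ρ₂ a (-1) 0 1 x y)
    hα (h.conj_inverted_sub_ne h0 (by simpa using h.rhoHat_ne))
    (inv_ne_zero h.weight_n_ne)
    (fun y => isShift_inverted_zero h h.weight_n_ne (isShift_n h a (-1) 0 0 0 rfl x y))
    (isShift_inverted h h0 h.weight_n_ne (isShift_n h a (-2) (-1) 0 0 rfl x t)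
      (isShift_l h a (-2) 0 0 1 rfl x t))
    (fun y => isShift_inverted h h0 h.weight_n_ne (isShift_n h a (-1) 0 0 0 rfl x y)
      (isShift_l h a (-1) 0 0 1 rfl x y)) hd
  simpa only [← tau_eq, ← hr'] using key

/-- Inverted parameters `1/(iρ)` and `1/i`, from the `l`- and `k`-shifts. The base point
`σ_{-1,-1,1}` is `f` by the reduction. -/
theorem hasDerivAt_conj_div_f (h : Background σ ρ₁ ρ₂) {x t : ℝ}
    (hd : tau σ ρ₁ ρ₂ a N 0 0 0 x t ≠ 0) :
    HasDerivAt (fun y => tau σ ρ₁ ρ₂ a N (-1) 0 0 x y / tau σ ρ₁ ρ₂ a N 0 0 0 x y)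
      ((ρ₁ : ℂ) * rho σ ρ₁ ρ₂ / ρ₂ * (1 / (I * rho σ ρ₁ ρ₂ - 0) - 1 / I) *
        (tau σ ρ₁ ρ₂ a N (-1) 1 0 x t * tau σ ρ₁ ρ₂ a N 0 (-1) 0 x t /
        tau σ ρ₁ ρ₂ a N 0 0 0 x t ^ 2 -
        tau σ ρ₁ ρ₂ a N (-1) 0 0 x t / tau σ ρ₁ ρ₂ a N 0 0 0 x t)) t := by
  have hr' := tau_reduction h a N (-2) 0 1 x t
  norm_num at hr'
  have hr : ∀ y, tau σ ρ₁ ρ₂ a N (-1) (-1) 1 x y = tau σ ρ₁ ρ₂ a N 0 0 0 x y := by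
    intro y
    have := tau_reduction h a N (-1) (-1) 1 x y
    norm_num at this
    exact this.symm
  have h0 : I * (rho σ ρ₁ ρ₂ : ℂ) - 0 ≠ 0 := by simpa using h.I_mul_rho_ne
  have h1 : I * (rho σ ρ₁ ρ₂ : ℂ) - I * σ * ρ₁ * ρ₂ ≠ 0 := by
    rw [Background.I_mul_rho_sub_sign]
    exact I_ne_zero
  have key := hasDerivAt_t_of_isShift h (N := N) (a := a) (n := -1) (k := -1) (l := 1)
    (F₀ := fun y => tauKernel σ ρ₁ ρ₂ a 0 (-1) 0 x y)
    (F₁ := fun y => tauKernel σ ρ₁ ρ₂ a (-2) 0 1 x y)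
    (F₂ := fun y => tauKernel σ ρ₁ ρ₂ a (-1) 0 0 x y)
    h.inverted_add_ne (h.conj_inverted_sub_ne h1 h.sub_sign_ne)
    (div_ne_zero h.weight_l_ne h.weight_n_ne)
    (fun y => isShift_inverted h h0 h.weight_n_ne (isShift_n h a (-1) 0 (-1) 0 rfl x y)
      (isShift_l h a (-1) (-1) 0 1 rfl x y))
    (isShift_inverted h h1 h.weight_n_ne (isShift_n h a (-2) (-1) (-1) 1 rfl x t)
      (isShift_k h a (-2) (-1) 0 1 rfl x t))
    (fun y => isShift_inverted h h1 h.weight_n_ne (isShift_n h a (-1) 0 (-1) 0 rfl x y)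
      (isShift_k h a (-1) (-1) 0 0 rfl x y)) (by rwa [hr])
  simpa only [← tau_eq, hr, ← hr', Background.I_mul_rho_sub_sign] using key

end TauDerivatives

/-! ### Complex conjugation -/

theorem conjSeries_sArgument :
    conjSeries (2 * expSubOneDiv * (PowerSeries.exp ℂ + 1)⁻¹) =
      2 * expSubOneDiv * (PowerSeries.exp ℂ + 1)⁻¹ := by
  have h1 : conjSeries expSubOneDiv = expSubOneDiv := by
    ext n
    simp [coeff_conjSeries, expSubOneDiv]
  have h2 := congrArg conjSeries exp_add_one_mul_inv
  rw [map_mul, map_add, conjSeries_exp, map_one] at h2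
  rw [map_mul, map_mul, h1, map_ofNat]
  linear_combination 2 * expSubOneDiv * ((PowerSeries.exp ℂ + 1)⁻¹ * h2 -
    conjSeries (PowerSeries.exp ℂ + 1)⁻¹ * exp_add_one_mul_inv)

theorem conj_sCoeff (r : ℕ) : starRingEnd ℂ (sCoeff r) = sCoeff r := by
  rw [sCoeff, ← coeff_conjSeries]
  congr 1
  have hs : PowerSeries.HasSubst (2 * expSubOneDiv * (PowerSeries.exp ℂ + 1)⁻¹ - 1) :=
    PowerSeries.HasSubst.of_constantCoeff_zero'
      (by rw [map_sub, constantCoeff_sArgument, map_one, sub_self])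
  have h := PowerSeries.map_subst hs (h := starRingEnd ℂ) (PowerSeries.log ℂ)
  have h2 : PowerSeries.map (starRingEnd ℂ) (2 * expSubOneDiv * (PowerSeries.exp ℂ + 1)⁻¹ - 1) =
      2 * expSubOneDiv * (PowerSeries.exp ℂ + 1)⁻¹ - 1 := by
    have h3 := conjSeries_sArgument
    rw [conjSeries] at h3
    rw [map_sub, h3, map_one]
  rw [PowerSeries.map_log] at h
  refine h.trans ?_
  exact congrArg (fun F => PowerSeries.subst F (PowerSeries.log ℂ)) h2

theorem conj_schur (z : ℕ → ℂ) (j : ℕ) :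
    starRingEnd ℂ (schur z j) = schur (fun r => starRingEnd ℂ (z r)) j := by
  rw [← coeff_schurSeries, ← coeff_schurSeries, schurSeries_conj, coeff_conjSeries]

/-- Conjugation exchanges `x⁺` and `x⁻` and reverses the discrete shifts. As these enter through `n
+ 1/2`, the reflection is `n ↦ -1-n`. -/
theorem conj_entry (a : ℕ → ℂ) (n k l : ℤ) (x t : ℝ) (i j : ℕ) :
    starRingEnd ℂ (entry σ ρ₁ ρ₂ a n k l x t i j) =
      entry σ ρ₁ ρ₂ a (-1 - n) (-k) (-l) x t j i := by
  rw [entry, entry, map_sum, min_comm]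
  refine Finset.sum_congr rfl fun γ _ => ?_
  have hp : (fun r => starRingEnd ℂ (xPlus σ ρ₁ ρ₂ a n k l x t r + γ * sCoeff r)) =
      fun r => xMinus σ ρ₁ ρ₂ a (-1 - n) (-k) (-l) x t r + γ * sCoeff r := by
    ext r
    simp only [xPlus, xMinus, map_add, map_mul, conj_alpha, conj_ofReal, conj_sCoeff,
      conj_zetaCoeff, map_natCast, map_intCast, map_div₀, map_one, map_ofNat]
    push_cast
    ring
  have hm : (fun r => starRingEnd ℂ (xMinus σ ρ₁ ρ₂ a n k l x t r + γ * sCoeff r)) =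
      fun r => xPlus σ ρ₁ ρ₂ a (-1 - n) (-k) (-l) x t r + γ * sCoeff r := by
    ext r
    simp only [xPlus, xMinus, map_add, map_sub, map_mul, conj_alpha, conj_ofReal, conj_sCoeff,
      conj_zetaCoeff, map_natCast, map_intCast, map_div₀, map_one, map_ofNat, conj_conj]
    push_cast
    ring
  rw [map_mul, map_mul, conj_schur, conj_schur, hp, hm, map_div₀, map_pow, map_one, map_ofNat]
  ring

theorem conj_tau (a : ℕ → ℂ) (N : ℕ) (n k l : ℤ) (x t : ℝ) :
    starRingEnd ℂ (tau σ ρ₁ ρ₂ a N n k l x t) = tau σ ρ₁ ρ₂ a N (-1 - n) (-k) (-l) x t := by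
  have hM : (starRingEnd ℂ).mapMatrix (Matrix.of fun i j : Fin N =>
      entry σ ρ₁ ρ₂ a n k l x t (2 * (i : ℕ) + 1) (2 * (j : ℕ) + 1)) =
      (Matrix.of fun i j : Fin N =>
        entry σ ρ₁ ρ₂ a (-1 - n) (-k) (-l) x t (2 * (i : ℕ) + 1) (2 * (j : ℕ) + 1)).transpose :=
    Matrix.ext fun i j => conj_entry a n k l x t _ _
  exact (RingHom.map_det _ _).trans ((congrArg Matrix.det hM).trans (Matrix.det_transpose _))

/-! ### Polynomial dependence on the variables -/

namespace IsPolynomialFun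

theorem const (c : ℂ) : IsPolynomialFun fun _ _ => c := ⟨MvPolynomial.C c, by simp⟩

theorem fst : IsPolynomialFun fun x _ => (x : ℂ) := ⟨MvPolynomial.X 0, by simp⟩

theorem snd : IsPolynomialFun fun _ t => (t : ℂ) := ⟨MvPolynomial.X 1, by simp⟩

theorem add {F G : ℝ → ℝ → ℂ} (hF : IsPolynomialFun F) (hG : IsPolynomialFun G) :
    IsPolynomialFun fun x t => F x t + G x t := by
  obtain ⟨P, hP⟩ := hF
  obtain ⟨Q, hQ⟩ := hG
  exact ⟨P + Q, by simp [hP, hQ]⟩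

theorem mul {F G : ℝ → ℝ → ℂ} (hF : IsPolynomialFun F) (hG : IsPolynomialFun G) :
    IsPolynomialFun fun x t => F x t * G x t := by
  obtain ⟨P, hP⟩ := hF
  obtain ⟨Q, hQ⟩ := hG
  exact ⟨P * Q, by simp [hP, hQ]⟩

theorem sum {ι : Type*} (s : Finset ι) {F : ι → ℝ → ℝ → ℂ} (hF : ∀ i ∈ s, IsPolynomialFun (F i)) :
    IsPolynomialFun fun x t => ∑ i ∈ s, F i x t := by
  classical
  induction s using Finset.induction_on with
  | empty => simpa using const 0
  | insert i s hi ih =>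
    simp only [Finset.sum_insert hi]
    exact (hF i (Finset.mem_insert_self i s)).add
      (ih fun j hj => hF j (Finset.mem_insert_of_mem hj))

theorem prod {ι : Type*} (s : Finset ι) {F : ι → ℝ → ℝ → ℂ} (hF : ∀ i ∈ s, IsPolynomialFun (F i)) :
    IsPolynomialFun fun x t => ∏ i ∈ s, F i x t := by
  classical
  induction s using Finset.induction_on with
  | empty => simpa using const 1
  | insert i s hi ih =>
    simp only [Finset.prod_insert hi]
    exact (hF i (Finset.mem_insert_self i s)).mul
      (ih fun j hj => hF j (Finset.mem_insert_of_mem hj))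

theorem schur {z : ℝ → ℝ → ℕ → ℂ} (hz : ∀ r, IsPolynomialFun fun x t => z x t (r + 1)) (n : ℕ) :
    IsPolynomialFun fun x t => MassiveThirring.schur (z x t) n := by
  induction n using Nat.strong_induction_on with
  | _ n ih =>
    rcases n with _ | n
    · simpa only [schur_zero] using const 1
    · have hn : (n : ℂ) + 1 ≠ 0 := Nat.cast_add_one_ne_zero n
      have hfun : ∀ z : ℕ → ℂ, MassiveThirring.schur z (n + 1) =
          (∑ p ∈ Finset.HasAntidiagonal.antidiagonal n,
            z (p.1 + 1) * (p.1 + 1) * MassiveThirring.schur z p.2) * ((n : ℂ) + 1)⁻¹ := fun z => by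
        rw [← schur_succ, mul_inv_cancel_right₀ hn]
      simp only [hfun]
      refine (sum _ fun p hp => ?_).mul (const _)
      have hp' := Finset.HasAntidiagonal.mem_antidiagonal.mp hp
      exact ((hz p.1).mul (const _)).mul (ih p.2 (by omega))

theorem linear (c d e : ℂ) : IsPolynomialFun fun x t => c * x + d * t + e :=
  (((const c).mul fst).add ((const d).mul snd)).add (const e)

theorem congr {F G : ℝ → ℝ → ℂ} (hF : IsPolynomialFun F) (h : ∀ x t, G x t = F x t) :
    IsPolynomialFun G := by
  obtain ⟨P, hP⟩ := hF
  exact ⟨P, fun x t => (h x t).trans (hP x t)⟩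

theorem det {N : ℕ} {M : ℝ → ℝ → Matrix (Fin N) (Fin N) ℂ}
    (hM : ∀ i j, IsPolynomialFun fun x t => M x t i j) :
    IsPolynomialFun fun x t => (M x t).det := by
  simp only [Matrix.det_apply']
  exact sum _ fun τ _ => (const _).mul (prod _ fun i _ => hM _ _)

theorem contDiff {F : ℝ → ℝ → ℂ} (hF : IsPolynomialFun F) :
    ContDiff ℝ 1 fun p : ℝ × ℝ => F p.1 p.2 := by
  obtain ⟨P, hP⟩ := hF
  simp only [hP]
  clear hP
  induction P using MvPolynomial.induction_on with
  | C c => simpa using contDiff_const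
  | add P Q hP hQ => simpa using hP.add hQ
  | mul_X P i hP =>
    simp only [map_mul, MvPolynomial.eval_X]
    refine hP.mul ?_
    fin_cases i
    · exact ofRealCLM.contDiff.comp contDiff_fst
    · exact ofRealCLM.contDiff.comp contDiff_snd

end IsPolynomialFun

theorem isPolynomialFun_tau (a : ℕ → ℂ) (N : ℕ) (n k l : ℤ) :
    IsPolynomialFun (tau σ ρ₁ ρ₂ a N n k l) := by
  refine IsPolynomialFun.det fun i j => ?_
  simp only [Matrix.of_apply, entry]
  refine IsPolynomialFun.sum _ fun γ _ =>
    ((IsPolynomialFun.const _).mul (IsPolynomialFun.schur (fun r => ?_) _)).mul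
      (IsPolynomialFun.schur (fun r => ?_) _)
  · refine (IsPolynomialFun.linear (alpha σ ρ₁ ρ₂ (r + 1)) (beta σ ρ₁ ρ₂ (r + 1))
      (xPlus σ ρ₁ ρ₂ a n k l 0 0 (r + 1) + γ * sCoeff (r + 1))).congr fun x t => ?_
    simp only [xPlus, ofReal_zero]
    ring
  · refine (IsPolynomialFun.linear (alpha σ ρ₁ ρ₂ (r + 1))
      (starRingEnd ℂ (beta σ ρ₁ ρ₂ (r + 1)))
      (xMinus σ ρ₁ ρ₂ a n k l 0 0 (r + 1) + γ * sCoeff (r + 1))).congr fun x t => ?_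
    simp only [xMinus, ofReal_zero]
    ring

/-! ### The massive Thirring model -/

theorem conj_tauF (a : ℕ → ℂ) (N : ℕ) (x t : ℝ) :
    starRingEnd ℂ (tauF σ ρ₁ ρ₂ a N x t) = tau σ ρ₁ ρ₂ a N (-1) 0 0 x t := by
  simpa [tauF] using conj_tau (σ := σ) (ρ₁ := ρ₁) (ρ₂ := ρ₂) a N 0 0 0 x t

theorem conj_tauG (a : ℕ → ℂ) (N : ℕ) (x t : ℝ) :
    starRingEnd ℂ (tauG σ ρ₁ ρ₂ a N x t) = tau σ ρ₁ ρ₂ a N 0 (-1) 0 x t := by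
  simpa [tauG] using conj_tau (σ := σ) (ρ₁ := ρ₁) (ρ₂ := ρ₂) a N (-1) 1 0 x t

theorem conj_tauH (a : ℕ → ℂ) (N : ℕ) (x t : ℝ) :
    starRingEnd ℂ (tauH σ ρ₁ ρ₂ a N x t) = tau σ ρ₁ ρ₂ a N 0 0 (-1) x t := by
  simpa [tauH] using conj_tau (σ := σ) (ρ₁ := ρ₁) (ρ₂ := ρ₂) a N (-1) 0 1 x t

theorem norm_planeWave (x t : ℝ) : ‖planeWave σ ρ₁ ρ₂ x t‖ = 1 := by
  have : I * (1 + σ * ρ₁ * ρ₂) * ((ρ₂ : ℂ) / ρ₁ * x + (ρ₁ : ℂ) / ρ₂ * t) =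
      ((1 + σ * ρ₁ * ρ₂) * (ρ₂ / ρ₁ * x + ρ₁ / ρ₂ * t) : ℝ) * I := by
    push_cast
    ring
  rw [planeWave, this, norm_exp_ofReal_mul_I]

theorem norm_sq_mul_planeWave (c : ℝ) (z : ℂ) (x t : ℝ) :
    ((‖(c : ℂ) * z * planeWave σ ρ₁ ρ₂ x t‖ : ℝ) : ℂ) ^ 2 = (c : ℂ) ^ 2 * (z * starRingEnd ℂ z) := by
  rw [norm_mul, norm_mul, norm_planeWave, mul_one, mul_conj', ofReal_mul, mul_pow]
  congr 1
  rw [norm_real]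
  norm_cast
  exact sq_abs c

theorem hasDerivAt_planeWave_x (x t : ℝ) :
    HasDerivAt (fun y => planeWave σ ρ₁ ρ₂ y t)
      (planeWave σ ρ₁ ρ₂ x t * (I * (1 + σ * ρ₁ * ρ₂) * ((ρ₂ : ℂ) / ρ₁))) x := by
  refine HasDerivAt.cexp ?_
  refine (hasDerivAt_linear (I * (1 + σ * ρ₁ * ρ₂) * ((ρ₂ : ℂ) / ρ₁))
    (I * (1 + σ * ρ₁ * ρ₂) * ((ρ₁ : ℂ) / ρ₂ * t)) x).congr_of_eventuallyEq
    (Filter.Eventually.of_forall fun y => ?_)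
  simp only
  ring

theorem hasDerivAt_planeWave_t (x t : ℝ) :
    HasDerivAt (fun y => planeWave σ ρ₁ ρ₂ x y)
      (planeWave σ ρ₁ ρ₂ x t * (I * (1 + σ * ρ₁ * ρ₂) * ((ρ₁ : ℂ) / ρ₂))) t := by
  refine HasDerivAt.cexp ?_
  refine (hasDerivAt_linear (I * (1 + σ * ρ₁ * ρ₂) * ((ρ₁ : ℂ) / ρ₂))
    (I * (1 + σ * ρ₁ * ρ₂) * ((ρ₂ : ℂ) / ρ₁ * x)) t).congr_of_eventuallyEq
    (Filter.Eventually.of_forall fun y => ?_)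
  simp only
  ring

theorem contDiff_planeWave : ContDiff ℝ 1 fun p : ℝ × ℝ => planeWave σ ρ₁ ρ₂ p.1 p.2 := by
  refine ContDiff.cexp (contDiff_const.mul ?_)
  exact (contDiff_const.mul (ofRealCLM.contDiff.comp contDiff_fst)).add
    (contDiff_const.mul (ofRealCLM.contDiff.comp contDiff_snd))

theorem IsPolynomialFun.contDiff_quotient {F G : ℝ → ℝ → ℂ} (hF : IsPolynomialFun F)
    (hG : IsPolynomialFun G) (h0 : ∀ x t, G x t ≠ 0) (c : ℂ) :
    ContDiff ℝ 1 fun p : ℝ × ℝ => c * (F p.1 p.2 / G p.1 p.2) * planeWave σ ρ₁ ρ₂ p.1 p.2 := by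
  simp only [div_eq_mul_inv]
  exact (contDiff_const.mul (hF.contDiff.mul (hG.contDiff.inv fun p => h0 p.1 p.2))).mul
    contDiff_planeWave

/-- The bilinear identities supply derivatives of `g/f` and `f/f'`, not of `g/f'`; this is the
product rule for `(g/f)(f/f')`. -/
theorem hasDerivAt_quotient_chain {g f f' e : ℝ → ℂ} {A B E c : ℂ} {s : ℝ} (hf : ∀ y, f y ≠ 0)
    (h1 : HasDerivAt (fun y => g y / f y) A s) (h2 : HasDerivAt (fun y => f y / f' y) B s)
    (h3 : HasDerivAt e E s) :
    HasDerivAt (fun y => c * (g y / f' y) * e y)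
      (c * (A * (f s / f' s) + g s / f s * B) * e s + c * (g s / f' s) * E) s := by
  have key := ((h1.mul h2).const_mul c).mul h3
  refine (key.congr_of_eventuallyEq (Filter.Eventually.of_forall fun y => ?_)).congr_deriv ?_
  · simp only [Pi.mul_apply]
    rw [div_mul_div_cancel₀ (hf y)]
  · simp only [Pi.mul_apply]
    rw [div_mul_div_cancel₀ (hf s)]

/-- The derivative of `g/f` accounts for the linear term, that of `f/f^*` for the cubic one; the
multiples of `g/f^*` left over cancel against the phase derivative. -/
theorem thirring_algebra_x {s r₁ r₂ g f f' q q' e : ℂ} (h1 : r₁ ≠ 0) (hf : f ≠ 0)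
    (hf' : f' ≠ 0) :
    I * (r₁ * (r₂ / r₁ * I * (q * f' / f ^ 2 - g / f) * (f / f') +
        g / f * (r₂ / r₁ * (I * s * r₁ * r₂) * (q * q' / f' ^ 2 - f / f'))) * e +
      r₁ * (g / f') * (e * (I * (1 + s * r₁ * r₂) * (r₂ / r₁)))) +
      r₂ * (q / f) * e + s * (r₁ * (g / f') * e) * (r₂ ^ 2 * (q / f * (q' / f'))) = 0 := by
  field_simp
  ring_nf
  simp only [I_sq]
  ring

theorem thirring_algebra_t {s r r₁ r₂ g f f' q g' e : ℂ} (h2 : r₂ ≠ 0)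
    (hf : f ≠ 0) (hf' : f' ≠ 0) (hr : r = 1 + s * r₁ * r₂) (hr0 : r ≠ 0) :
    I * (r₂ * (r₁ * r / r₂ * (0 - 1 / (I * r - 0)) * (g * f / f' ^ 2 - q / f') * (f' / f) +
        q / f' * (r₁ * r / r₂ * (1 / (I * r - 0) - 1 / I) * (g * g' / f ^ 2 - f' / f))) * e +
      r₂ * (q / f) * (e * (I * (1 + s * r₁ * r₂) * (r₁ / r₂)))) +
      r₁ * (g / f') * e + s * (r₂ * (q / f) * e) * (r₁ ^ 2 * (g / f' * (g' / f))) = 0 := by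
  have h3 : (1 : ℂ) / (I * r - 0) = -I / r := by
    rw [sub_zero, div_eq_div_iff (mul_ne_zero I_ne_zero hr0) hr0]
    linear_combination r * I_sq
  have h4 : (1 : ℂ) / I = -I := by
    rw [one_div, inv_I]
  have h5 : s * r₁ * r₂ = r - 1 := by rw [hr]; ring
  rw [h3, h4, ← hr]
  field_simp
  linear_combination r₁ * e * ((r - 1) * g * q * g' + f ^ 2 * g) * I_sq +
    r₁ * e * g * q * g' * h5

theorem isSolution_of_ne_zero (h : Background σ ρ₁ ρ₂) (a : ℕ → ℂ) (N : ℕ)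
    (hf : ∀ x t, tauF σ ρ₁ ρ₂ a N x t ≠ 0) :
    IsSolution σ (rogueU σ ρ₁ ρ₂ a N) (rogueV σ ρ₁ ρ₂ a N) := by
  have hf' : ∀ x t, tau σ ρ₁ ρ₂ a N (-1) 0 0 x t ≠ 0 := by
    intro x t
    rw [← conj_tauF]
    exact (map_ne_zero _).mpr (hf x t)
  have hρ₁ : (ρ₁ : ℂ) ≠ 0 := ofReal_ne_zero.mpr h.ne₁
  have hρ₂ : (ρ₂ : ℂ) ≠ 0 := ofReal_ne_zero.mpr h.ne₂
  have hrho : (rho σ ρ₁ ρ₂ : ℂ) = 1 + σ * ρ₁ * ρ₂ := by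
    rw [rho]
    push_cast
    ring
  have hrho0 : (rho σ ρ₁ ρ₂ : ℂ) ≠ 0 := ofReal_ne_zero.mpr h.rho_pos.ne'
  have hU : rogueU σ ρ₁ ρ₂ a N = fun x t => ρ₁ * (tauG σ ρ₁ ρ₂ a N x t /
      tau σ ρ₁ ρ₂ a N (-1) 0 0 x t) * planeWave σ ρ₁ ρ₂ x t := by
    funext x t
    rw [rogueU, conj_tauF]
  have hV : rogueV σ ρ₁ ρ₂ a N = fun x t => ρ₂ * (tauH σ ρ₁ ρ₂ a N x t /
      tauF σ ρ₁ ρ₂ a N x t) * planeWave σ ρ₁ ρ₂ x t := rfl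
  refine ⟨?_, ?_, fun x t => ⟨?_, ?_⟩⟩
  · rw [hU]
    exact IsPolynomialFun.contDiff_quotient (F := tauG σ ρ₁ ρ₂ a N)
      (isPolynomialFun_tau a N (-1) 1 0) (isPolynomialFun_tau a N (-1) 0 0) hf' _
  · rw [hV]
    exact IsPolynomialFun.contDiff_quotient (F := tauH σ ρ₁ ρ₂ a N) (G := tauF σ ρ₁ ρ₂ a N)
      (isPolynomialFun_tau a N (-1) 0 1) (isPolynomialFun_tau a N 0 0 0) hf _
  · have hd := hasDerivAt_quotient_chain (g := fun y => tauG σ ρ₁ ρ₂ a N y t)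
      (f := fun y => tauF σ ρ₁ ρ₂ a N y t) (f' := fun y => tau σ ρ₁ ρ₂ a N (-1) 0 0 y t)
      (c := ρ₁) (fun y => hf y t) (hasDerivAt_g_div_f a N h (hf x t))
      (hasDerivAt_f_div_conj a N h (hf' x t))
      (hasDerivAt_planeWave_x (σ := σ) (ρ₁ := ρ₁) (ρ₂ := ρ₂) x t)
    have hn : ((‖rogueV σ ρ₁ ρ₂ a N x t‖ : ℝ) : ℂ) ^ 2 = (ρ₂ : ℂ) ^ 2 *
        (tauH σ ρ₁ ρ₂ a N x t / tauF σ ρ₁ ρ₂ a N x t *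
          (tau σ ρ₁ ρ₂ a N 0 0 (-1) x t / tau σ ρ₁ ρ₂ a N (-1) 0 0 x t)) := by
      rw [rogueV, norm_sq_mul_planeWave, map_div₀, conj_tauH, conj_tauF]
    rw [hn, hU, hV, hd.deriv]
    exact thirring_algebra_x hρ₁ (hf x t) (hf' x t)
  · have hd := hasDerivAt_quotient_chain (g := fun y => tauH σ ρ₁ ρ₂ a N x y)
      (f := fun y => tau σ ρ₁ ρ₂ a N (-1) 0 0 x y) (f' := fun y => tauF σ ρ₁ ρ₂ a N x y)
      (c := ρ₂) (fun y => hf' x y) (hasDerivAt_h_div_conj a N h (hf' x t))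
      (hasDerivAt_conj_div_f a N h (hf x t))
      (hasDerivAt_planeWave_t (σ := σ) (ρ₁ := ρ₁) (ρ₂ := ρ₂) x t)
    have hn : ((‖rogueU σ ρ₁ ρ₂ a N x t‖ : ℝ) : ℂ) ^ 2 = (ρ₁ : ℂ) ^ 2 *
        (tauG σ ρ₁ ρ₂ a N x t / tau σ ρ₁ ρ₂ a N (-1) 0 0 x t *
          (tau σ ρ₁ ρ₂ a N 0 (-1) 0 x t / tauF σ ρ₁ ρ₂ a N x t)) := by
      rw [rogueU, norm_sq_mul_planeWave, map_div₀, conj_tauG, conj_conj, conj_tauF]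
    rw [hn, hU, hV, hd.deriv]
    exact thirring_algebra_t hρ₂ (hf x t) (hf' x t) hrho hrho0

/-! ### Absence of zeros -/

section Moments

variable {K : ℤ → ℤ → ℂ} {φ : ℤ → ℂ}

/-- While `φ_b = 0`, a unit moves from one index to the other at the cost of a sign. This carries
`K(2n,0)` to a diagonal entry and `K(2n+1,0)` to a neighbouring one. -/
theorem moment_shift_up (h1 : ∀ a b, K (a + 1) b + K a (b + 1) = starRingEnd ℂ (φ a) * φ b)
    (n : ℕ) (hn : ∀ i : ℕ, i < n → φ i = 0) (a : ℤ) :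
    K (a + n) 0 = (-1) ^ n * K a n := by
  induction n generalizing a with
  | zero => simp
  | succ n ih =>
    have h2 := ih (fun i hi => hn i (by omega)) (a + 1)
    have h3 := h1 a n
    rw [hn n (Nat.lt_succ_self n), mul_zero] at h3
    have h4 : a + ((n + 1 : ℕ) : ℤ) = a + 1 + n := by push_cast; ring
    have h5 : ((n + 1 : ℕ) : ℤ) = (n : ℤ) + 1 := by push_cast; ring
    rw [h4, h2, h5]
    linear_combination (-1) ^ n * h3

theorem moment_shift_down (h1 : ∀ a b, K (a + 1) b + K a (b + 1) = starRingEnd ℂ (φ a) * φ b)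
    (n : ℕ) (hn : ∀ i : ℕ, i < n → φ (-(i + 1)) = 0) (a : ℤ) :
    K (a - n) 0 = (-1) ^ n * K a (-n) := by
  induction n generalizing a with
  | zero => simp
  | succ n ih =>
    have h2 := ih (fun i hi => hn i (by omega)) (a - 1)
    have h3 := h1 (a - 1) (-((n : ℤ) + 1))
    rw [hn n (Nat.lt_succ_self n), mul_zero, sub_add_cancel,
      show -((n : ℤ) + 1) + 1 = -n by ring] at h3
    have h4 : a - ((n + 1 : ℕ) : ℤ) = a - 1 - n := by push_cast; ring
    have h5 : -((n + 1 : ℕ) : ℤ) = -((n : ℤ) + 1) := by push_cast; ring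
    rw [h4, h2, h5]
    linear_combination (-1) ^ n * h3

theorem neg_one_pow_mul_im (n : ℕ) (z : ℂ) (hz : z.im = 0) : ((-1) ^ n * z).im = 0 := by
  rcases neg_one_pow_eq_or ℂ n with h | h <;> simp [h, hz]

theorem neg_one_pow_mul_re (n : ℕ) (z : ℂ) : ((-1) ^ n * z).re = (-1) ^ n * z.re := by
  rcases Nat.even_or_odd n with h | h <;> simp [h.neg_one_pow]

/-- A Hermitian moment problem on which the even combinations vanish has only the trivial
solution. -/
theorem moments_eq_zero {μ : ℝ} (hμ : μ ≠ 0)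
    (h1 : ∀ a b, K (a + 1) b + K a (b + 1) = starRingEnd ℂ (φ a) * φ b)
    (h2 : ∀ a b, starRingEnd ℂ (K a b) = K b a)
    (h3 : ∀ k : ℕ, K (k + 1) 0 + K (1 - k) 0 + I * μ * (K k 0 + K (-k) 0) = 0) (j : ℤ) :
    φ j = 0 := by
  have hdiag : ∀ a, (K a a).im = 0 := fun a => conj_eq_iff_im.mp (h2 a a)
  -- Hermitian symmetry makes the two terms of `h1 a a` conjugate to each other.
  have hre : ∀ a, (K (a + 1) a).re = normSq (φ a) / 2 := by
    intro a
    have h4 := congrArg Complex.re (h1 a a)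
    rw [← h2 (a + 1) a, add_re, conj_re, mul_comm, mul_conj, ofReal_re] at h4
    linarith
  have hre' : ∀ a, (K a (a + 1)).re = normSq (φ a) / 2 := by
    intro a
    rw [← h2 (a + 1) a, conj_re, hre]
  have evenUp : ∀ n : ℕ, (∀ i : ℕ, i < n → φ i = 0) → (K (2 * n) 0).im = 0 := by
    intro n hn
    rw [two_mul, moment_shift_up h1 n hn]
    exact neg_one_pow_mul_im n _ (hdiag n)
  have oddUp : ∀ n : ℕ, (∀ i : ℕ, i < n → φ i = 0) →
      (K (2 * n + 1) 0).re = (-1) ^ n * (normSq (φ n) / 2) := by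
    intro n hn
    rw [show (2 * n + 1 : ℤ) = n + 1 + n by ring, moment_shift_up h1 n hn, neg_one_pow_mul_re, hre]
  have evenDown : ∀ n : ℕ, (∀ i : ℕ, i < n → φ (-(i + 1)) = 0) → (K (-(2 * n)) 0).im = 0 := by
    intro n hn
    rw [show (-(2 * n) : ℤ) = -n - n by ring, moment_shift_down h1 n hn]
    exact neg_one_pow_mul_im n _ (hdiag _)
  have oddDown : ∀ n : ℕ, (∀ i : ℕ, i < n → φ (-(i + 1)) = 0) →
      (K (-(2 * n + 1)) 0).re = (-1) ^ n * (normSq (φ (-(n + 1))) / 2) := by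
    intro n hn
    rw [show (-(2 * n + 1) : ℤ) = -(n + 1) - n by ring, moment_shift_down h1 n hn,
      neg_one_pow_mul_re]
    congr 1
    have := hre' (-(n + 1))
    rwa [show (-((n : ℤ) + 1) + 1) = -n by ring] at this
  have hparts : ∀ k : ℕ, (K (k + 1) 0).re + (K (1 - k) 0).re -
      μ * ((K k 0).im + (K (-k) 0).im) = 0 ∧ (K (k + 1) 0).im + (K (1 - k) 0).im +
      μ * ((K k 0).re + (K (-k) 0).re) = 0 := by
    intro k
    have h4 := congrArg Complex.re (h3 k)
    have h5 := congrArg Complex.im (h3 k)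
    simp at h4 h5
    constructor <;> linarith
  have hsq : ∀ (n : ℕ) (z : ℂ), (-1 : ℝ) ^ n * (normSq z / 2) = 0 → z = 0 := by
    intro n z hz
    rcases mul_eq_zero.mp hz with h | h
    · exact absurd h (pow_ne_zero _ (by norm_num))
    · exact normSq_eq_zero.mp (by linarith)
  -- The order of elimination is `φ_0, φ_{-1}, φ_1, φ_{-2}, …`. Nonnegative indices use the real
  -- part of `h3` at even `k`; negative ones use the imaginary part at odd `k`, where `μ ≠ 0` is
  -- needed. In each case only one squared modulus survives.
  have main : ∀ n : ℕ, (∀ i : ℕ, i < n + 1 → φ i = 0) ∧ (∀ i : ℕ, i < n → φ (-(i + 1)) = 0) := by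
    intro n
    induction n with
    | zero =>
      refine ⟨fun i hi => ?_, fun i hi => absurd hi (Nat.not_lt_zero i)⟩
      obtain rfl : i = 0 := by omega
      have h4 := (hparts 0).1
      have h5 := oddUp 0 (fun i hi => absurd hi (Nat.not_lt_zero i))
      have h6 := hdiag 0
      simp only [Nat.cast_zero, zero_add, mul_zero, sub_zero, neg_zero] at h4 h5
      refine hsq 0 _ ?_
      rw [Nat.cast_zero, ← h5]
      rw [h6] at h4
      linarith
    | succ n ih =>
      obtain ⟨up, down⟩ := ih
      have hneg : φ (-(n + 1)) = 0 := by
        have h4 := (hparts (2 * n + 1)).2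
        have h5 := evenUp (n + 1) up
        have h6 := evenDown n down
        have h7 := oddUp n (fun i hi => up i (by omega))
        have h8 := oddDown n down
        rw [up n (Nat.lt_succ_self n), map_zero, zero_div, mul_zero] at h7
        push_cast at h4 h5
        rw [show (2 * (n : ℤ) + 1 + 1) = 2 * (n + 1) by ring,
          show (1 - (2 * (n : ℤ) + 1)) = -(2 * n) by ring, h5, h6, h7, h8, zero_add, zero_add,
          zero_add] at h4
        exact hsq n _ ((mul_eq_zero.mp h4).resolve_left hμ)
      have down' : ∀ i : ℕ, i < n + 1 → φ (-(i + 1)) = 0 := by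
        intro i hi
        rcases Nat.lt_succ_iff_lt_or_eq.mp hi with h | rfl
        · exact down i h
        · exact hneg
      refine ⟨fun i hi => ?_, down'⟩
      rcases Nat.lt_succ_iff_lt_or_eq.mp hi with h | rfl
      · exact up i h
      have h4 := (hparts (2 * n + 2)).1
      have h5 := evenUp (n + 1) up
      have h6 := evenDown (n + 1) down'
      have h7 := oddUp (n + 1) up
      have h8 := oddDown n down
      rw [hneg, map_zero, zero_div, mul_zero] at h8
      push_cast at h4 h5 h6 h7
      rw [show (2 * (n : ℤ) + 2 + 1) = 2 * (n + 1) + 1 by ring,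
        show (1 - (2 * (n : ℤ) + 2)) = -(2 * n + 1) by ring,
        show (2 * (n : ℤ) + 2) = 2 * (n + 1) by ring, h5, h6, h7, h8] at h4
      refine hsq (n + 1) _ ?_
      push_cast
      linarith
  rcases le_or_gt 0 j with hj | hj
  · lift j to ℕ using hj
    exact (main j).1 j (Nat.lt_succ_self j)
  · have := (main j.natAbs).2 (j.natAbs - 1) (by omega)
    rwa [show (-(((j.natAbs - 1 : ℕ) : ℤ) + 1)) = j by omega] at this

end Moments

/-! ### From a null vector to the moment problem -/

/-- The exponential series as a unit. -/
def expUnit : (PowerSeries ℂ)ˣ where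
  val := PowerSeries.exp ℂ
  inv := expNeg
  val_inv := exp_mul_expNeg
  inv_val := by rw [mul_comm, exp_mul_expNeg]

/-- The series of `e^{aκ}`. -/
def expPow (a : ℤ) : PowerSeries ℂ := (expUnit ^ a : (PowerSeries ℂ)ˣ)

theorem expPow_succ (a : ℤ) : expPow (a + 1) = expPow a * PowerSeries.exp ℂ := by
  rw [expPow, zpow_add_one, Units.val_mul]
  rfl

theorem expPow_natCast (k : ℕ) : expPow k = PowerSeries.exp ℂ ^ k := by
  rw [expPow, zpow_natCast, Units.val_pow_eq_pow_val]
  rfl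

theorem expPow_neg_natCast (k : ℕ) : expPow (-k) = expNeg ^ k := by
  rw [expPow, zpow_neg, zpow_natCast, ← inv_pow, Units.val_pow_eq_pow_val]
  rfl

theorem conjSeries_expPow (a : ℤ) : conjSeries (expPow a) = expPow a := by
  rcases Int.eq_nat_or_neg a with ⟨k, rfl | rfl⟩
  · rw [expPow_natCast, map_pow, conjSeries_exp]
  · rw [expPow_neg_natCast, map_pow, conjSeries_expNeg]

theorem conjSeries_gauge_inv : conjSeries gauge⁻¹ = gauge⁻¹ := by
  have h1 : conjSeries gauge = gauge := by
    rw [gauge, map_mul, map_add, map_one, conjSeries_exp, conjSeries_C, conj_ofReal]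
  have h2 := congrArg conjSeries gauge_mul_inv
  rw [map_mul, h1, map_one] at h2
  linear_combination gauge⁻¹ * h2 - conjSeries gauge⁻¹ * gauge_mul_inv

theorem conjSeries_tanhSeries : conjSeries tanhSeries = tanhSeries := by
  have h : conjSeries PowerSeries.X = PowerSeries.X := PowerSeries.map_X _
  rw [tanhSeries, map_mul, h, ← schurSeries_conj]
  congr 2
  ext r
  exact conj_sCoeff r

theorem conj_coeff₂_cauchyKernel (A B : PowerSeries ℂ) (i j : ℕ) :
    starRingEnd ℂ (coeff₂ i j (inl A * inr (conjSeries B) * cauchyKernel)) =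
      coeff₂ j i (inl B * inr (conjSeries A) * cauchyKernel) := by
  rw [coeff₂_cauchyKernel _ _ i j (i + j + 1) (by omega),
    coeff₂_cauchyKernel _ _ j i (i + j + 1) (by omega), map_sum]
  refine Finset.sum_congr rfl fun γ _ => ?_
  have h : ∀ F m, starRingEnd ℂ (coeff m (F * gauge⁻¹ * tanhSeries ^ γ)) =
      coeff m (conjSeries F * gauge⁻¹ * tanhSeries ^ γ) := by
    intro F m
    rw [← coeff_conjSeries, map_mul conjSeries, map_mul conjSeries, map_pow, conjSeries_gauge_inv,
      conjSeries_tanhSeries]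
  have h' : conjSeries (conjSeries B) = B := by
    ext n
    rw [coeff_conjSeries, coeff_conjSeries, conj_conj]
  rw [map_mul, map_mul, h, h, h', map_div₀, map_pow, map_one, map_ofNat]
  ring

theorem star_dotProduct_vecMulVec_mulVec {N : ℕ} (v p q : Fin N → ℂ) :
    star v ⬝ᵥ (Matrix.vecMulVec p q).mulVec v = (star v ⬝ᵥ p) * (q ⬝ᵥ v) := by
  rw [Matrix.vecMulVec_mulVec]
  simp [dotProduct, Finset.sum_mul, mul_assoc]

/-- A functional of odd coefficients that annihilates all `B(κ) e^{bκ}` is zero. -/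
theorem eq_zero_of_forall_expPow {N : ℕ} {B : PowerSeries ℂ} (hB : constantCoeff B ≠ 0)
    {v : Fin N → ℂ} (h : ∀ b : ℤ, oddVector N (B * expPow b) ⬝ᵥ v = 0) : v = 0 := by
  -- Finite differences in `b` replace `e^{bκ}` by multiples of `(e^κ-1)^m`, which has order exactly
  -- `m` in `κ`.
  have h1 : ∀ m b : ℕ,
      oddVector N (B * PowerSeries.exp ℂ ^ b * (PowerSeries.exp ℂ - 1) ^ m) ⬝ᵥ v = 0 := by
    intro m
    induction m with
    | zero =>
      intro b
      rw [pow_zero, mul_one, ← expPow_natCast]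
      exact h b
    | succ m ih =>
      intro b
      have h2 : oddVector N (B * PowerSeries.exp ℂ ^ b * (PowerSeries.exp ℂ - 1) ^ (m + 1)) =
          oddVector N (B * PowerSeries.exp ℂ ^ (b + 1) * (PowerSeries.exp ℂ - 1) ^ m) -
          oddVector N (B * PowerSeries.exp ℂ ^ b * (PowerSeries.exp ℂ - 1) ^ m) := by
        ext i
        simp only [oddVector, Pi.sub_apply, ← map_sub]
        congr 1
        ring
      rw [h2, sub_dotProduct, ih, ih, sub_zero]
  by_contra hv
  obtain ⟨i, hi⟩ := Function.ne_iff.mp hv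
  -- With `j` the last index in the support of `v` and order `m = 2j+1`, the pairing reduces to its
  -- `j`-th term: earlier coefficients vanish by order, later entries of `v` by the choice of `j`.
  obtain ⟨j, hj, hmax⟩ := Finset.exists_max_image (Finset.univ.filter fun j => v j ≠ 0) id
    ⟨i, Finset.mem_filter.mpr ⟨Finset.mem_univ i, hi⟩⟩
  have hj' := (Finset.mem_filter.mp hj).2
  have h2 := h1 (2 * (j : ℕ) + 1) 0
  rw [pow_zero, mul_one, ← X_mul_expSubOneDiv, mul_pow, dotProduct, Finset.sum_eq_single j] at h2
  · rw [oddVector, mul_left_comm, PowerSeries.coeff_X_pow_mul', if_pos le_rfl, Nat.sub_self,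
      PowerSeries.coeff_zero_eq_constantCoeff_apply, map_mul, map_pow] at h2
    have h3 : constantCoeff expSubOneDiv = 1 := by
      rw [← PowerSeries.coeff_zero_eq_constantCoeff_apply, expSubOneDiv, PowerSeries.coeff_mk]
      simp [PowerSeries.coeff_exp, PowerSeries.coeff_one]
    rw [h3, one_pow, mul_one] at h2
    exact (mul_ne_zero hB hj') h2
  · intro k _ hk
    by_cases hvk : v k = 0
    · rw [hvk, mul_zero]
    · have hle : k ≤ j := hmax k (Finset.mem_filter.mpr ⟨Finset.mem_univ k, hvk⟩)
      have hlt : (k : ℕ) < j := lt_of_le_of_ne hle fun h => hk (Fin.ext h)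
      rw [oddVector, mul_left_comm, PowerSeries.coeff_X_pow_mul', if_neg (by omega), zero_mul]
  · intro h
    exact absurd (Finset.mem_univ j) h

/-- With `plusSeries_eq_mul`, the kernel of `f` is that of a Hermitian matrix, `D(κ)
conj(D)(λ)/(e^κ+e^λ)`, times a single `n`-shift factor in `κ`. -/
theorem minusSeries_eq_conj (a : ℕ → ℂ) (x t : ℝ) :
    minusSeries σ ρ₁ ρ₂ a 0 0 0 x t = conjSeries (plusSeries σ ρ₁ ρ₂ a (-1) 0 0 x t) := by
  have h1 : conjSeries gauge = gauge := by
    rw [gauge, map_mul, map_add, map_one, conjSeries_exp, conjSeries_C, conj_ofReal]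
  rw [minusSeries, plusSeries, map_mul, ← schurSeries_conj, h1]
  congr 2
  ext r
  simp only [xPlus, xMinus, map_add, map_mul, conj_alpha, conj_ofReal,
    conj_zetaCoeff, map_intCast, map_div₀, map_one, map_ofNat]
  push_cast
  ring

theorem plusSeries_eq_mul (h : Background σ ρ₁ ρ₂) (a : ℕ → ℂ) (x t : ℝ) :
    plusSeries σ ρ₁ ρ₂ a 0 0 0 x t =
      plusSeries σ ρ₁ ρ₂ a (-1) 0 0 x t * shiftFactor σ ρ₁ ρ₂ (I * rho σ ρ₁ ρ₂) := by
  rw [plusSeries, plusSeries, mul_right_comm, ← schurSeries_theta h, ← schurSeries_add]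
  congr 2
  ext r
  simp only [xPlus]
  push_cast
  ring

/-- A null vector `v` gives moments `K(a,b) = v^* M_{a,b} v` as in `moments_eq_zero`, with `μ =
ρ/ρ̂`. Their vanishing makes `v` annihilate the odd coefficients of all `conj(D) e^{bκ}`. -/
theorem det_ne_zero_of_factor (h : Background σ ρ₁ ρ₂) (N : ℕ) {D : PowerSeries ℂ}
    (hD : constantCoeff D ≠ 0) :
    (oddMatrix N (inl (D * shiftFactor σ ρ₁ ρ₂ (I * rho σ ρ₁ ρ₂)) * inr (conjSeries D) *
      cauchyKernel)).det ≠ 0 := by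
  intro hdet
  obtain ⟨v, hv, hmv⟩ := Matrix.exists_mulVec_eq_zero_iff.mpr hdet
  refine hv ?_
  have hD' : constantCoeff (conjSeries D) ≠ 0 := by
    rw [constantCoeff_conjSeries]
    exact (map_ne_zero _).mpr hD
  refine eq_zero_of_forall_expPow hD' fun b => ?_
  have hr := h.rhoHat_pos
  have hμ : rho σ ρ₁ ρ₂ / rhoHat σ ρ₁ ρ₂ ≠ 0 := (div_pos h.rho_pos hr).ne'
  refine moments_eq_zero (K := fun a b => star v ⬝ᵥ (oddMatrix N (inl (D * expPow a) *
    inr (conjSeries (D * expPow b)) * cauchyKernel)).mulVec v)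
    (φ := fun b => oddVector N (conjSeries D * expPow b) ⬝ᵥ v) hμ ?_ ?_ ?_ b
  · intro a b
    have h1 : inl (D * expPow (a + 1)) * inr (conjSeries (D * expPow b)) * cauchyKernel +
        inl (D * expPow a) * inr (conjSeries (D * expPow (b + 1))) * cauchyKernel =
        inl (D * expPow a) * inr (conjSeries D * expPow b) := by
      simp only [expPow_succ, map_mul, conjSeries_exp, conjSeries_expPow]
      linear_combination inl D * inl (expPow a) * inr (conjSeries D) * inr (expPow b) *
        cauchyKernel_spec
    have h2 : star v ⬝ᵥ oddVector N (D * expPow a) =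
        starRingEnd ℂ (oddVector N (conjSeries D * expPow a) ⬝ᵥ v) := by
      have h3 : ∀ i, oddVector N (D * expPow a) i =
          starRingEnd ℂ (oddVector N (conjSeries D * expPow a) i) := by
        intro i
        have h4 : conjSeries (conjSeries D) = D := by
          ext n
          rw [coeff_conjSeries, coeff_conjSeries, conj_conj]
        rw [oddVector, oddVector, ← coeff_conjSeries, map_mul conjSeries, h4, conjSeries_expPow]
      rw [dotProduct, dotProduct, map_sum]
      refine Finset.sum_congr rfl fun i _ => ?_
      rw [h3, map_mul, mul_comm]
      rfl
    rw [← dotProduct_add, ← Matrix.add_mulVec, ← oddMatrix_add, h1, oddMatrix_inl_mul_inr,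
      star_dotProduct_vecMulVec_mulVec, h2]
  · intro a b
    simp only [dotProduct, Matrix.mulVec, map_sum, Finset.mul_sum]
    rw [Finset.sum_comm]
    refine Finset.sum_congr rfl fun i _ => Finset.sum_congr rfl fun j _ => ?_
    simp only [oddMatrix, Matrix.of_apply, map_mul (starRingEnd ℂ), conj_coeff₂_cauchyKernel, Pi.star_apply]
    rw [starRingEnd_apply, star_star, ← starRingEnd_apply]
    ring
  · intro k
    -- The constant `c` removes the normalization: `c` times the shift factor is `e^κ + iμ`.
    set c : ℂ := ((rhoHat σ ρ₁ ρ₂ : ℂ) + I * rho σ ρ₁ ρ₂) / rhoHat σ ρ₁ ρ₂ with hc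
    set F := inl (D * shiftFactor σ ρ₁ ρ₂ (I * rho σ ρ₁ ρ₂)) * inr (conjSeries D) *
      cauchyKernel with hF
    have h1 : PowerSeries.C c * shiftFactor σ ρ₁ ρ₂ (I * rho σ ρ₁ ρ₂) =
        PowerSeries.exp ℂ + PowerSeries.C (I * (rho σ ρ₁ ρ₂ / rhoHat σ ρ₁ ρ₂ : ℝ)) := by
      have e1 := h.add_I_mul_ne (rho σ ρ₁ ρ₂)
      have e2 := h.rhoHat_ne
      have e3 : c * (1 / ((rhoHat σ ρ₁ ρ₂ : ℂ) + I * rho σ ρ₁ ρ₂)) = 1 / rhoHat σ ρ₁ ρ₂ := by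
        rw [hc]
        field_simp
      have e4 : PowerSeries.C c * PowerSeries.C (1 / ((rhoHat σ ρ₁ ρ₂ : ℂ) + I * rho σ ρ₁ ρ₂)) =
          PowerSeries.C (1 / (rhoHat σ ρ₁ ρ₂ : ℂ)) := by
        rw [← map_mul, e3]
      have e5 : PowerSeries.C (1 / (rhoHat σ ρ₁ ρ₂ : ℂ)) * PowerSeries.C (rhoHat σ ρ₁ ρ₂ : ℂ) =
          1 := by
        rw [← map_mul, one_div_mul_cancel e2, map_one]
      have e6 : PowerSeries.C (1 / (rhoHat σ ρ₁ ρ₂ : ℂ)) * PowerSeries.C (I * rho σ ρ₁ ρ₂) =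
          PowerSeries.C (I * ((rho σ ρ₁ ρ₂ / rhoHat σ ρ₁ ρ₂ : ℝ) : ℂ)) := by
        rw [← map_mul]
        congr 1
        push_cast
        ring
      rw [shiftFactor, shiftedExp_eq, scaledExp]
      linear_combination (PowerSeries.exp ℂ * PowerSeries.C (rhoHat σ ρ₁ ρ₂ : ℂ) +
        PowerSeries.C (I * rho σ ρ₁ ρ₂)) * e4 + PowerSeries.exp ℂ * e5 + e6
    -- The series `e^{kκ} + e^{-kκ}` is even, so inserting it multiplies the matrix on the left by a
    -- Toeplitz matrix and `v` remains a null vector.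
    have h2 : star v ⬝ᵥ (oddMatrix N (inl (PowerSeries.exp ℂ ^ k + expNeg ^ k) *
        (inl (PowerSeries.C c) * F))).mulVec v = 0 := by
      rw [oddMatrix_inl_mul (isEvenSeries_cosh k), oddMatrix_C_mul, ← Matrix.mulVec_mulVec,
        Matrix.smul_mulVec, hmv, smul_zero, Matrix.mulVec_zero, dotProduct_zero]
    have h3 : inl (PowerSeries.exp ℂ ^ k + expNeg ^ k) * (inl (PowerSeries.C c) * F) =
        inl (D * expPow (k + 1)) * inr (conjSeries (D * expPow 0)) * cauchyKernel +
        inl (D * expPow (1 - k)) * inr (conjSeries (D * expPow 0)) * cauchyKernel +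
        inl (PowerSeries.C (I * (rho σ ρ₁ ρ₂ / rhoHat σ ρ₁ ρ₂ : ℝ))) *
          (inl (D * expPow k) * inr (conjSeries (D * expPow 0)) * cauchyKernel +
          inl (D * expPow (-k)) * inr (conjSeries (D * expPow 0)) * cauchyKernel) := by
      have e0 : expPow 0 = 1 := by simpa using expPow_natCast 0
      have e1 := congrArg inl h1
      rw [map_mul, map_add] at e1
      rw [hF, sub_eq_neg_add, expPow_succ, expPow_succ, expPow_natCast, expPow_neg_natCast, e0,
        mul_one]
      simp only [map_mul inl D, map_mul inl (_ ^ _), map_add inl (_ ^ _)]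
      linear_combination (inl (PowerSeries.exp ℂ ^ k) + inl (expNeg ^ k)) * inl D *
        inr (conjSeries D) * cauchyKernel * e1
    rw [h3, oddMatrix_add, oddMatrix_add, oddMatrix_C_mul, oddMatrix_add, Matrix.add_mulVec,
      Matrix.add_mulVec, Matrix.smul_mulVec, Matrix.add_mulVec, dotProduct_add, dotProduct_add,
      dotProduct_smul, dotProduct_add, smul_eq_mul] at h2
    exact h2

theorem tauF_ne_zero (h : Background σ ρ₁ ρ₂) (a : ℕ → ℂ) (N : ℕ) (x t : ℝ) :
    tauF σ ρ₁ ρ₂ a N x t ≠ 0 := by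
  rw [tauF, tau_eq, tauKernel, plusSeries_eq_mul h, minusSeries_eq_conj]
  refine det_ne_zero_of_factor h N ?_
  rw [plusSeries, map_mul, constantCoeff_schurSeries, one_mul]
  exact constantCoeff_gauge_ne_zero

/-! ### Asymptotics of the determinants -/

theorem tendsto_det {ι : Type*} {l : Filter ι} {N : ℕ} {M : ι → Matrix (Fin N) (Fin N) ℂ}
    {P : Matrix (Fin N) (Fin N) ℂ}
    (h : ∀ i j, Filter.Tendsto (fun p => M p i j) l (nhds (P i j))) :
    Filter.Tendsto (fun p => (M p).det) l (nhds P.det) := by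
  have hM : Filter.Tendsto M l (nhds P) :=
    tendsto_pi_nhds.mpr fun i => tendsto_pi_nhds.mpr fun j => h i j
  exact ((Continuous.matrix_det continuous_id).tendsto P).comp hM

theorem tendsto_adjugate {ι : Type*} {l : Filter ι} {N : ℕ} {M : ι → Matrix (Fin N) (Fin N) ℂ}
    {P : Matrix (Fin N) (Fin N) ℂ}
    (h : ∀ i j, Filter.Tendsto (fun p => M p i j) l (nhds (P i j))) (i j : Fin N) :
    Filter.Tendsto (fun p => (M p).adjugate i j) l (nhds (P.adjugate i j)) := by
  have hM : Filter.Tendsto M l (nhds P) :=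
    tendsto_pi_nhds.mpr fun i => tendsto_pi_nhds.mpr fun j => h i j
  have h1 : Filter.Tendsto (fun p => (M p).adjugate) l (nhds P.adjugate) :=
    ((Continuous.matrix_adjugate continuous_id).tendsto P).comp hM
  exact tendsto_pi_nhds.mp (tendsto_pi_nhds.mp h1 i) j

/-- The determinant of a product of rectangular matrices with geometric weights is dominated by
the leading minors. -/
theorem tendsto_det_geometric {ι : Type*} {l : Filter ι} {N : ℕ} {ε : ι → ℂ}
    (hε : Filter.Tendsto ε l (nhds 0)) (hε0 : ∀ᶠ p in l, ε p ≠ 0)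
    {Φ Ψ : ι → Fin N → ℕ → ℂ} {P : Fin N → ℕ → ℂ}
    (hΦ : ∀ i γ, Filter.Tendsto (fun p => Φ p i γ) l (nhds (P i γ)))
    (hΨ : ∀ i γ, Filter.Tendsto (fun p => Ψ p i γ) l (nhds (P i γ)))
    (hP : (Matrix.of fun i γ : Fin N => P i γ).det ≠ 0) :
    Filter.Tendsto (fun p => (Matrix.of fun i j : Fin N =>
        ∑ γ ∈ Finset.range (N + N), ε p ^ γ * (Φ p i γ * Ψ p j γ)).det / ∏ γ : Fin N, ε p ^ (γ : ℕ))
      l (nhds ((Matrix.of fun i γ : Fin N => P i γ).det ^ 2)) := by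
  set Φ₁ : ι → Matrix (Fin N) (Fin N) ℂ := fun p => Matrix.of fun i γ => Φ p i γ with hΦ₁
  set Ψ₁ : ι → Matrix (Fin N) (Fin N) ℂ := fun p => Matrix.of fun i γ => Ψ p i γ with hΨ₁
  set W : ι → Matrix (Fin N) (Fin N) ℂ := fun p => Matrix.of fun i j =>
    ∑ γ ∈ Finset.range N, ε p ^ γ * (Φ p i (N + γ) * Ψ p j (N + γ)) with hW
  -- `X` is the matrix for which the whole sum equals `Φ₁ diag(ε^γ) X`. Pulling the tail `γ ≥ N`
  -- through both factors leaves weights `ε^{N-γ}` with `γ < N`, which tend to `0`.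
  set X : ι → Matrix (Fin N) (Fin N) ℂ := fun p => (Ψ₁ p).transpose +
    Matrix.diagonal (fun γ : Fin N => ε p ^ (N - (γ : ℕ))) * ((Φ₁ p)⁻¹ * W p) with hX
  have hdet : Filter.Tendsto (fun p => (Φ₁ p).det) l
      (nhds (Matrix.of fun i γ : Fin N => P i γ).det) := tendsto_det fun i γ => hΦ i γ
  have hWlim : ∀ i j, ∃ c, Filter.Tendsto (fun p => W p i j) l (nhds c) := by
    intro i j
    exact ⟨∑ γ ∈ Finset.range N, 0 ^ γ * (P i (N + γ) * P j (N + γ)),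
      tendsto_finsetSum _ fun γ _ => (hε.pow γ).mul ((hΦ i (N + γ)).mul (hΨ j (N + γ)))⟩
  have hinv : ∀ i j, ∃ c, Filter.Tendsto (fun p => (Φ₁ p)⁻¹ i j) l (nhds c) := by
    intro i j
    refine ⟨_, Filter.Tendsto.congr (fun p => ?_)
      ((hdet.inv₀ hP).mul (tendsto_adjugate (fun i γ => hΦ i γ) i j))⟩
    rw [Matrix.inv_def, Ring.inverse_eq_inv', Matrix.smul_apply, smul_eq_mul]
    rfl
  have hXlim : ∀ i j, Filter.Tendsto (fun p => X p i j) l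
      (nhds ((Matrix.of fun i γ : Fin N => P i γ).transpose i j)) := by
    intro i j
    choose cW hcW using hWlim
    choose cI hcI using hinv
    have h1 : Filter.Tendsto (fun p => ∑ k, (Φ₁ p)⁻¹ i k * W p k j) l
        (nhds (∑ k, cI i k * cW k j)) :=
      tendsto_finsetSum _ fun k _ => (hcI i k).mul (hcW k j)
    have h2 : Filter.Tendsto (fun p => ε p ^ (N - (i : ℕ))) l (nhds 0) := by
      have := hε.pow (N - (i : ℕ))
      rwa [zero_pow (by have := i.isLt; omega)] at this
    have h3 := (hΨ j i).add (h2.mul h1)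
    rw [zero_mul, add_zero] at h3
    refine h3.congr fun p => ?_
    simp only [hX, Matrix.add_apply, Matrix.diagonal_mul, Matrix.transpose_apply]
    rw [Matrix.mul_apply]
    rfl
  have hprod := hdet.mul (tendsto_det hXlim)
  rw [Matrix.det_transpose, ← sq] at hprod
  refine hprod.congr' ?_
  filter_upwards [hε0, hdet.eventually_ne hP] with p hp hd
  have hfac : (Matrix.of fun i j : Fin N =>
      ∑ γ ∈ Finset.range (N + N), ε p ^ γ * (Φ p i γ * Ψ p j γ)) =
      Φ₁ p * (Matrix.diagonal (fun γ : Fin N => ε p ^ (γ : ℕ)) * X p) := by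
    have h1 : Matrix.diagonal (fun γ : Fin N => ε p ^ (γ : ℕ)) *
        Matrix.diagonal (fun γ : Fin N => ε p ^ (N - (γ : ℕ))) =
        (ε p ^ N) • (1 : Matrix (Fin N) (Fin N) ℂ) := by
      rw [Matrix.diagonal_mul_diagonal, Matrix.smul_one_eq_diagonal]
      congr 1
      ext γ
      rw [← pow_add, Nat.add_sub_cancel' γ.isLt.le]
    rw [hX, Matrix.mul_add, ← Matrix.mul_assoc (Matrix.diagonal _) (Matrix.diagonal _), h1,
      Matrix.smul_mul, Matrix.one_mul, Matrix.mul_add, Matrix.mul_smul, ← Matrix.mul_assoc (Φ₁ p)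
      (Φ₁ p)⁻¹, Matrix.mul_nonsing_inv _ (isUnit_iff_ne_zero.mpr hd), Matrix.one_mul]
    ext i j
    rw [Matrix.of_apply, Finset.sum_range_add]
    rw [Matrix.add_apply, Matrix.mul_apply]
    simp only [Matrix.diagonal_mul, Matrix.smul_apply, Matrix.transpose_apply, hW, hΦ₁, hΨ₁,
      Matrix.of_apply, smul_eq_mul, Finset.mul_sum]
    rw [Finset.sum_range]
    congr 1
    · exact Finset.sum_congr rfl fun γ _ => by ring
    · exact Finset.sum_congr rfl fun γ _ => by rw [pow_add]; ring
  have hε' : ∏ γ : Fin N, ε p ^ (γ : ℕ) ≠ 0 := Finset.prod_ne_zero_iff.mpr fun γ _ => pow_ne_zero _ hp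
  rw [hfac, Matrix.det_mul, Matrix.det_mul, Matrix.det_diagonal]
  field_simp

/-- The matrix `1 / (2 i + 1 - γ)!` is nonsingular. -/
theorem det_inv_factorial_ne_zero (N : ℕ) :
    (Matrix.of fun i γ : Fin N => if (γ : ℕ) ≤ 2 * (i : ℕ) + 1 then
      (1 : ℂ) / ((2 * (i : ℕ) + 1 - (γ : ℕ)).factorial : ℂ) else 0).det ≠ 0 := by
  -- Up to the row factor `1/(2i+1)!`, the entry is the falling factorial of degree `γ` at `2i+1`,
  -- which also vanishes in the default case `γ > 2i+1`. As these polynomials are monic, the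
  -- determinant is a Vandermonde one at distinct nodes.
  have h1 : (Matrix.of fun i γ : Fin N => if (γ : ℕ) ≤ 2 * (i : ℕ) + 1 then
      (1 : ℂ) / ((2 * (i : ℕ) + 1 - (γ : ℕ)).factorial : ℂ) else 0) =
      Matrix.of fun i γ : Fin N => (1 / ((2 * (i : ℕ) + 1).factorial : ℂ)) *
        (Matrix.of fun i γ : Fin N => (descPochhammer ℂ (γ : ℕ)).eval
          (((2 * (i : ℕ) + 1 : ℕ) : ℂ))) i γ := by
    ext i γ
    simp only [Matrix.of_apply, descPochhammer_eval_eq_descFactorial]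
    split_ifs with h
    · have h2 := Nat.factorial_mul_descFactorial h
      have h3 : ((2 * (i : ℕ) + 1 - (γ : ℕ)).factorial : ℂ) ≠ 0 :=
        Nat.cast_ne_zero.mpr (Nat.factorial_ne_zero _)
      have h4 : ((2 * (i : ℕ) + 1).factorial : ℂ) ≠ 0 :=
        Nat.cast_ne_zero.mpr (Nat.factorial_ne_zero _)
      rw [one_div_mul_eq_div, div_eq_div_iff h3 h4, one_mul, ← h2]
      push_cast
      ring
    · rw [Nat.descFactorial_eq_zero_iff_lt.mpr (by omega), Nat.cast_zero, mul_zero]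
  rw [h1, Matrix.det_mul_column, ← Matrix.det_eval_matrixOfPolynomials_eq_det_vandermonde
    (fun i : Fin N => (((2 * (i : ℕ) + 1 : ℕ) : ℂ))) (fun γ : Fin N => descPochhammer ℂ (γ : ℕ))
    (fun γ => descPochhammer_natDegree ℂ _) (fun γ => monic_descPochhammer ℂ _)]
  refine mul_ne_zero (Finset.prod_ne_zero_iff.mpr fun i _ => one_div_ne_zero
    (Nat.cast_ne_zero.mpr (Nat.factorial_ne_zero _))) (Matrix.det_vandermonde_ne_zero_iff.mpr ?_)
  intro i j hij
  have : 2 * (i : ℕ) + 1 = 2 * (j : ℕ) + 1 := Nat.cast_injective (R := ℂ) hij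
  exact Fin.ext (by omega)

/-! ### Asymptotics of the Schur polynomials -/

theorem schur_single (n : ℕ) : schur (fun r => if r = 1 then 1 else 0) n = 1 / (n.factorial : ℂ) := by
  have h : exponent (fun r => if r = 1 then 1 else 0) = PowerSeries.X := by
    ext r
    rw [exponent, PowerSeries.coeff_mk, PowerSeries.coeff_X]
    split_ifs with h1 h2 h2
    · omega
    · rfl
    · rfl
    · rfl
  rw [← coeff_schurSeries, schurSeries, h, PowerSeries.X_subst, PowerSeries.coeff_exp]
  simp

/-- By weighted homogeneity, division by `z^n` rescales `y_r` to `z^{-r} y_r`. Every `y_r` is at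
most of order `z`, so the rescaled variables tend to `(1, 0, 0, …)`, where `S_n = 1/n!`. -/
theorem tendsto_schur_div_pow {ι : Type*} {l : Filter ι} {z X T : ι → ℂ}
    (hz : Filter.Tendsto (fun p => ‖z p‖) l Filter.atTop) {C : ℝ}
    (hX : ∀ p, ‖X p‖ ≤ C * ‖z p‖) (hT : ∀ p, ‖T p‖ ≤ C * ‖z p‖) {y : ι → ℕ → ℂ} {a b c : ℕ → ℂ}
    (hy : ∀ p r, y p r = a r * X p + b r * T p + c r) (hz1 : ∀ p, z p = a 1 * X p + b 1 * T p)
    (n : ℕ) :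
    Filter.Tendsto (fun p => schur (y p) n / z p ^ n) l (nhds (1 / (n.factorial : ℂ))) := by
  have hne : ∀ᶠ p in l, z p ≠ 0 := by
    filter_upwards [hz.eventually_gt_atTop 0] with p hp using norm_pos_iff.mp hp
  have hinv : Filter.Tendsto (fun p => (z p)⁻¹) l (nhds 0) :=
    tendsto_zero_iff_norm_tendsto_zero.mpr (by
      simp only [norm_inv]
      exact hz.inv_tendsto_atTop)
  have hbd : ∀ Y : ι → ℂ, (∀ p, ‖Y p‖ ≤ C * ‖z p‖) → ∀ m : ℕ,
      Filter.Tendsto (fun p => (z p)⁻¹ ^ (m + 2) * Y p) l (nhds 0) := by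
    intro Y hY m
    have h1 : Filter.Tendsto (fun p => (z p)⁻¹ ^ (m + 1) * ((z p)⁻¹ * Y p)) l (nhds 0) := by
      have h2 := hinv.pow (m + 1)
      rw [zero_pow (Nat.succ_ne_zero m)] at h2
      refine h2.zero_mul_isBoundedUnder_le ⟨|C|, Filter.eventually_map.mpr ?_⟩
      filter_upwards [hne] with p hp
      have hp' : 0 < ‖z p‖ := norm_pos_iff.mpr hp
      simp only [Function.comp, norm_mul, norm_inv]
      rw [inv_mul_le_iff₀ hp', mul_comm]
      exact (hY p).trans (mul_le_mul_of_nonneg_right (le_abs_self C) hp'.le)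
    refine h1.congr fun p => ?_
    ring
  have key : ∀ r, Filter.Tendsto (fun p => (z p)⁻¹ ^ (r + 1) * y p (r + 1)) l
      (nhds (if r + 1 = 1 then 1 else 0)) := by
    intro r
    rcases r with _ | r
    · rw [zero_add, if_pos rfl]
      have h1 : Filter.Tendsto (fun p => 1 + (z p)⁻¹ * c 1) l (nhds (1 + 0 * c 1)) :=
        tendsto_const_nhds.add (hinv.mul_const _)
      rw [zero_mul, add_zero] at h1
      refine h1.congr' ?_
      filter_upwards [hne] with p hp
      rw [hy, ← hz1, pow_one, mul_add, inv_mul_cancel₀ hp]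
    · rw [if_neg (by omega)]
      have h2 := hinv.pow (r + 2)
      rw [zero_pow (Nat.succ_ne_zero _)] at h2
      have h3 := ((((hbd X hX r).const_mul (a (r + 2))).add
        ((hbd T hT r).const_mul (b (r + 2)))).add (h2.mul_const (c (r + 2))))
      rw [mul_zero, mul_zero, zero_mul, add_zero, add_zero] at h3
      refine h3.congr fun p => ?_
      rw [hy]
      ring
  have h4 := tendsto_schur (x := fun p r => (z p)⁻¹ ^ r * y p r)
    (y := fun r => if r = 1 then 1 else 0) key n
  rw [schur_single] at h4
  refine h4.congr fun p => ?_
  rw [schur_scale, inv_pow, div_eq_inv_mul]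

/-! ### Localization -/

theorem alpha_one : alpha σ ρ₁ ρ₂ 1 = ((ρ₂ / ρ₁ * rhoHat σ ρ₁ ρ₂ : ℝ) : ℂ) := by
  rw [alpha, PowerSeries.coeff_C_mul, map_sub, PowerSeries.coeff_exp, PowerSeries.coeff_one]
  simp

theorem beta_one (hs : (rhoHat σ ρ₁ ρ₂ : ℂ) + I * rho σ ρ₁ ρ₂ ≠ 0) :
    beta σ ρ₁ ρ₂ 1 = (ρ₁ : ℂ) * rho σ ρ₁ ρ₂ / ρ₂ *
      (rhoHat σ ρ₁ ρ₂ / ((rhoHat σ ρ₁ ρ₂ : ℂ) + I * rho σ ρ₁ ρ₂) ^ 2) := by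
  set s := (rhoHat σ ρ₁ ρ₂ : ℂ) + I * rho σ ρ₁ ρ₂ with hs_def
  have h0 : constantCoeff (shiftedExp σ ρ₁ ρ₂ (I * rho σ ρ₁ ρ₂)) = s := by
    simp [shiftedExp, hs_def]
  have h1 : coeff 1 (shiftedExp σ ρ₁ ρ₂ (I * rho σ ρ₁ ρ₂)) = rhoHat σ ρ₁ ρ₂ := by
    rw [shiftedExp, map_add, PowerSeries.coeff_mul_C, PowerSeries.coeff_exp, PowerSeries.coeff_C]
    simp
  have h2 := congrArg (coeff 1)
    (PowerSeries.mul_inv_cancel (shiftedExp σ ρ₁ ρ₂ (I * rho σ ρ₁ ρ₂)) (by rwa [h0]))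
  rw [PowerSeries.coeff_mul, Finset.Nat.sum_antidiagonal_eq_sum_range_succ_mk,
    Finset.sum_range_succ, Finset.sum_range_one, Nat.sub_zero, Nat.sub_self, h1,
    PowerSeries.coeff_zero_eq_constantCoeff_apply, PowerSeries.coeff_zero_eq_constantCoeff_apply,
    PowerSeries.constantCoeff_inv, h0, PowerSeries.coeff_one, if_neg one_ne_zero] at h2
  rw [beta, PowerSeries.coeff_C_mul, map_sub, PowerSeries.coeff_C, if_neg one_ne_zero, zero_sub]
  congr 1
  field_simp at h2 ⊢
  linear_combination -h2

theorem Background.alpha_one_ne_zero (h : Background σ ρ₁ ρ₂) :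
    ρ₂ / ρ₁ * rhoHat σ ρ₁ ρ₂ ≠ 0 :=
  mul_ne_zero (div_ne_zero h.ne₂ h.ne₁) (Real.sqrt_pos.mpr h.rhoHat_arg).ne'

/-- The imaginary part of `(ρ̂+iρ)²` is `2ρ̂ρ > 0`. As `α₁` is real and nonzero, `α₁x + β₁t` is then
a real-linear isomorphism of the plane onto `ℂ`, so its modulus grows in every direction. -/
theorem Background.im_beta_one_ne_zero (h : Background σ ρ₁ ρ₂) : (beta σ ρ₁ ρ₂ 1).im ≠ 0 := by
  have hr : 0 < rhoHat σ ρ₁ ρ₂ := Real.sqrt_pos.mpr h.rhoHat_arg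
  have hs : (rhoHat σ ρ₁ ρ₂ : ℂ) + I * rho σ ρ₁ ρ₂ ≠ 0 := h.add_I_mul_ne _
  have hd : (ρ₁ : ℂ) * rho σ ρ₁ ρ₂ / ρ₂ = ((ρ₁ * rho σ ρ₁ ρ₂ / ρ₂ : ℝ) : ℂ) := by push_cast; rfl
  rw [beta_one hs, hd, im_ofReal_mul, div_eq_mul_inv (rhoHat σ ρ₁ ρ₂ : ℂ), im_ofReal_mul, inv_im]
  have him : (((rhoHat σ ρ₁ ρ₂ : ℂ) + I * rho σ ρ₁ ρ₂) ^ 2).im =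
      2 * (rhoHat σ ρ₁ ρ₂ * rho σ ρ₁ ρ₂) := by
    simp [sq]
    ring
  rw [him]
  refine mul_ne_zero (div_ne_zero (mul_ne_zero h.ne₁ h.rho_pos.ne') h.ne₂)
    (mul_ne_zero hr.ne' (div_ne_zero (neg_ne_zero.mpr ?_) (normSq_pos.mpr (pow_ne_zero 2 hs)).ne'))
  exact (mul_pos two_pos (mul_pos hr h.rho_pos)).ne'

/-- A nondegenerate linear phase controls both coordinates. -/
theorem exists_norm_le_linear {A : ℝ} {B : ℂ} (hA : A ≠ 0) (hB : B.im ≠ 0) :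
    ∃ C : ℝ, ∀ x t : ℝ, ‖(x : ℂ)‖ ≤ C * ‖(A : ℂ) * x + B * t‖ ∧
      ‖(t : ℂ)‖ ≤ C * ‖(A : ℂ) * x + B * t‖ := by
  have hA' : 0 < |A| := abs_pos.mpr hA
  have hB' : 0 < |B.im| := abs_pos.mpr hB
  have ht : ∀ x t : ℝ, ‖(t : ℂ)‖ ≤ |B.im|⁻¹ * ‖(A : ℂ) * x + B * t‖ := by
    intro x t
    rw [le_inv_mul_iff₀ hB', norm_real, Real.norm_eq_abs, ← abs_mul]
    have : B.im * t = ((A : ℂ) * x + B * t).im := by simp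
    rw [this]
    exact abs_im_le_norm _
  have hx : ∀ x t : ℝ, ‖(x : ℂ)‖ ≤ |A|⁻¹ * (1 + ‖B‖ * |B.im|⁻¹) * ‖(A : ℂ) * x + B * t‖ := by
    intro x t
    rw [mul_assoc, le_inv_mul_iff₀ hA', norm_real, Real.norm_eq_abs, ← abs_mul,
      ← Real.norm_eq_abs, ← norm_real, ofReal_mul]
    calc ‖(A : ℂ) * x‖ = ‖((A : ℂ) * x + B * t) - B * t‖ := by rw [add_sub_cancel_right]
      _ ≤ ‖(A : ℂ) * x + B * t‖ + ‖B * t‖ := norm_sub_le _ _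
      _ ≤ ‖(A : ℂ) * x + B * t‖ + ‖B‖ * (|B.im|⁻¹ * ‖(A : ℂ) * x + B * t‖) := by
        rw [norm_mul]
        gcongr
        exact ht x t
      _ = _ := by ring
  refine ⟨max (|A|⁻¹ * (1 + ‖B‖ * |B.im|⁻¹)) |B.im|⁻¹, fun x t => ⟨(hx x t).trans ?_,
    (ht x t).trans ?_⟩⟩
  · exact mul_le_mul_of_nonneg_right (le_max_left _ _) (norm_nonneg _)
  · exact mul_le_mul_of_nonneg_right (le_max_right _ _) (norm_nonneg _)

theorem tendsto_norm_linear {A : ℝ} {B : ℂ} (hA : A ≠ 0) (hB : B.im ≠ 0) :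
    Filter.Tendsto (fun p : ℝ × ℝ => ‖(A : ℂ) * p.1 + B * p.2‖) (Filter.cocompact (ℝ × ℝ))
      Filter.atTop := by
  obtain ⟨C, hC⟩ := exists_norm_le_linear hA hB
  have hC' : 0 < |C| + 1 := by positivity
  refine Filter.tendsto_atTop_mono (fun p => ?_)
    ((tendsto_norm_cocompact_atTop (E := ℝ × ℝ)).const_mul_atTop (inv_pos.mpr hC'))
  rw [inv_mul_le_iff₀ hC', Prod.norm_def]
  have hle : C * ‖(A : ℂ) * p.1 + B * p.2‖ ≤ (|C| + 1) * ‖(A : ℂ) * p.1 + B * p.2‖ :=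
    mul_le_mul_of_nonneg_right ((le_abs_self C).trans (lt_add_one _).le) (norm_nonneg _)
  have h1 := (hC p.1 p.2).1.trans hle
  have h2 := (hC p.1 p.2).2.trans hle
  rw [norm_real] at h1 h2
  exact max_le h1 h2

/-- Extracting the growth `z^i w^j` leaves geometric weights in `ε = 1/(4zw)`. The zero defaults let
all entries share one range of `γ`, as `tendsto_det_geometric` needs. -/
theorem sum_range_min_eq {z w : ℂ} (hz : z ≠ 0) (hw : w ≠ 0) {K i j : ℕ} (hi : i < K)
    (F G : ℕ → ℕ → ℂ) :
    ∑ γ ∈ Finset.range (min i j + 1), 1 / 4 ^ γ * F γ (i - γ) * G γ (j - γ) =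
      z ^ i * (w ^ j * ∑ γ ∈ Finset.range K, (1 / (4 * (z * w))) ^ γ *
        ((if γ ≤ i then F γ (i - γ) / z ^ (i - γ) else 0) *
          (if γ ≤ j then G γ (j - γ) / w ^ (j - γ) else 0))) := by
  have hsub : Finset.range (min i j + 1) ⊆ Finset.range K :=
    Finset.range_subset_range.mpr ((Nat.succ_le_succ (min_le_left i j)).trans hi)
  rw [← Finset.sum_subset hsub, Finset.mul_sum, Finset.mul_sum]
  · refine Finset.sum_congr rfl fun γ hγ => ?_
    have hγ' := Finset.mem_range.mp hγ
    have hγi : γ ≤ i := by omega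
    have hγj : γ ≤ j := by omega
    rw [if_pos hγi, if_pos hγj]
    obtain ⟨b, rfl⟩ := Nat.exists_eq_add_of_le hγi
    obtain ⟨c, rfl⟩ := Nat.exists_eq_add_of_le hγj
    rw [Nat.add_sub_cancel_left, Nat.add_sub_cancel_left, pow_add, pow_add]
    simp only [div_pow, mul_pow, one_pow]
    field_simp
  · intro γ _ hγ
    rw [Finset.mem_range, not_lt] at hγ
    by_cases hγi : γ ≤ i
    · rw [if_neg (show ¬γ ≤ j by omega), mul_zero, mul_zero]
    · rw [if_neg hγi, zero_mul, mul_zero]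

/-- Determinants of Gram type `∑ 4^{-γ} S_{i-γ} S_{j-γ}` whose factors grow like powers of `z` and
`w` have a nonzero leading coefficient. -/
theorem tendsto_det_div {ι : Type*} {l : Filter ι} (N : ℕ) {z w : ι → ℂ}
    (hz : Filter.Tendsto (fun p => ‖z p‖) l Filter.atTop)
    (hw : Filter.Tendsto (fun p => ‖w p‖) l Filter.atTop) {F G : ι → ℕ → ℕ → ℂ}
    (hF : ∀ γ n, Filter.Tendsto (fun p => F p γ n / z p ^ n) l (nhds (1 / (n.factorial : ℂ))))
    (hG : ∀ γ n, Filter.Tendsto (fun p => G p γ n / w p ^ n) l (nhds (1 / (n.factorial : ℂ)))) :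
    Filter.Tendsto (fun p => (Matrix.of fun i j : Fin N =>
        ∑ γ ∈ Finset.range (min (2 * (i : ℕ) + 1) (2 * (j : ℕ) + 1) + 1),
          1 / 4 ^ γ * F p γ (2 * (i : ℕ) + 1 - γ) * G p γ (2 * (j : ℕ) + 1 - γ)).det /
        ((∏ i : Fin N, z p ^ (2 * (i : ℕ) + 1)) * ((∏ j : Fin N, w p ^ (2 * (j : ℕ) + 1)) *
          ∏ γ : Fin N, (1 / (4 * (z p * w p))) ^ (γ : ℕ)))) l
      (nhds ((Matrix.of fun i γ : Fin N => if (γ : ℕ) ≤ 2 * (i : ℕ) + 1 then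
        (1 : ℂ) / ((2 * (i : ℕ) + 1 - (γ : ℕ)).factorial : ℂ) else 0).det ^ 2)) := by
  have hz0 : ∀ᶠ p in l, z p ≠ 0 := by
    filter_upwards [hz.eventually_gt_atTop 0] with p hp using norm_pos_iff.mp hp
  have hw0 : ∀ᶠ p in l, w p ≠ 0 := by
    filter_upwards [hw.eventually_gt_atTop 0] with p hp using norm_pos_iff.mp hp
  have hε : Filter.Tendsto (fun p => 1 / (4 * (z p * w p))) l (nhds 0) := by
    refine tendsto_zero_iff_norm_tendsto_zero.mpr ?_
    simp only [one_div, norm_inv, norm_mul]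
    exact ((hz.atTop_mul_atTop₀ hw).const_mul_atTop
      (norm_pos_iff.mpr (by norm_num : (4 : ℂ) ≠ 0))).inv_tendsto_atTop
  have hε0 : ∀ᶠ p in l, 1 / (4 * (z p * w p)) ≠ 0 := by
    filter_upwards [hz0, hw0] with p h1 h2
    exact one_div_ne_zero (mul_ne_zero (by norm_num : (4 : ℂ) ≠ 0) (mul_ne_zero h1 h2))
  have key : ∀ (H : ι → ℕ → ℕ → ℂ) (v : ι → ℂ),
      (∀ γ n, Filter.Tendsto (fun p => H p γ n / v p ^ n) l (nhds (1 / (n.factorial : ℂ)))) →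
      ∀ (i : Fin N) (γ : ℕ), Filter.Tendsto (fun p => if γ ≤ 2 * (i : ℕ) + 1 then
        H p γ (2 * (i : ℕ) + 1 - γ) / v p ^ (2 * (i : ℕ) + 1 - γ) else 0) l
        (nhds (if γ ≤ 2 * (i : ℕ) + 1 then
          (1 : ℂ) / ((2 * (i : ℕ) + 1 - γ).factorial : ℂ) else 0)) := by
    intro H v hH i γ
    split_ifs with hγ
    · exact hH γ _
    · exact tendsto_const_nhds
  refine (tendsto_det_geometric hε hε0 (key F z hF) (key G w hG)
    (det_inv_factorial_ne_zero N)).congr' ?_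
  filter_upwards [hz0, hw0] with p h1 h2
  -- The common range `N + N` suffices because `2i+1 ≤ 2N-1`.
  have hM : (Matrix.of fun i j : Fin N =>
      ∑ γ ∈ Finset.range (min (2 * (i : ℕ) + 1) (2 * (j : ℕ) + 1) + 1),
        1 / 4 ^ γ * F p γ (2 * (i : ℕ) + 1 - γ) * G p γ (2 * (j : ℕ) + 1 - γ)) =
      Matrix.of fun i j : Fin N => z p ^ (2 * (i : ℕ) + 1) *
        (Matrix.of fun i j : Fin N => w p ^ (2 * (j : ℕ) + 1) *
          (Matrix.of fun i j : Fin N => ∑ γ ∈ Finset.range (N + N), (1 / (4 * (z p * w p))) ^ γ *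
            ((if γ ≤ 2 * (i : ℕ) + 1 then
              F p γ (2 * (i : ℕ) + 1 - γ) / z p ^ (2 * (i : ℕ) + 1 - γ) else 0) *
            (if γ ≤ 2 * (j : ℕ) + 1 then
              G p γ (2 * (j : ℕ) + 1 - γ) / w p ^ (2 * (j : ℕ) + 1 - γ) else 0))) i j) i j :=
    Matrix.ext fun i j => sum_range_min_eq h1 h2 (by have := i.isLt; omega) (F p) (G p)
  rw [hM, Matrix.det_mul_column, Matrix.det_mul_row,
    mul_div_mul_left _ _ (Finset.prod_ne_zero_iff.mpr fun i _ => pow_ne_zero _ h1),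
    mul_div_mul_left _ _ (Finset.prod_ne_zero_iff.mpr fun i _ => pow_ne_zero _ h2)]

theorem tendsto_ratio {ι : Type*} {l : Filter ι} {F G T : ι → ℂ} {c : ℂ} (hc : c ≠ 0)
    (hF : Filter.Tendsto (fun p => F p / T p) l (nhds c))
    (hG : Filter.Tendsto (fun p => G p / T p) l (nhds c)) :
    Filter.Tendsto (fun p => F p / G p) l (nhds 1) := by
  have h := hF.div hG hc
  rw [div_self hc] at h
  refine h.congr' ?_
  filter_upwards [hG.eventually_ne hc] with p hp
  exact div_div_div_cancel_right₀ (fun h0 => hp (by rw [h0, div_zero])) _ _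

/-- All the determinants have the same asymptotics. -/
theorem tendsto_tau_div_tau (h : Background σ ρ₁ ρ₂) (a : ℕ → ℂ) (N : ℕ) (n k l n' k' l' : ℤ) :
    Filter.Tendsto (fun p : ℝ × ℝ => tau σ ρ₁ ρ₂ a N n k l p.1 p.2 /
      tau σ ρ₁ ρ₂ a N n' k' l' p.1 p.2) (Filter.cocompact (ℝ × ℝ)) (nhds 1) := by
  have hB := h.im_beta_one_ne_zero
  have hB' : (starRingEnd ℂ (beta σ ρ₁ ρ₂ 1)).im ≠ 0 := by
    rw [conj_im]
    exact neg_ne_zero.mpr hB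
  have hz := tendsto_norm_linear h.alpha_one_ne_zero hB
  have hw := tendsto_norm_linear h.alpha_one_ne_zero hB'
  obtain ⟨C, hC⟩ := exists_norm_le_linear h.alpha_one_ne_zero hB
  obtain ⟨C', hC'⟩ := exists_norm_le_linear h.alpha_one_ne_zero hB'
  have key := fun n k l : ℤ => tendsto_det_div N hz hw
    (F := fun p γ => schur fun r => xPlus σ ρ₁ ρ₂ a n k l p.1 p.2 r + γ * sCoeff r)
    (G := fun p γ => schur fun r => xMinus σ ρ₁ ρ₂ a n k l p.1 p.2 r + γ * sCoeff r)
    (fun γ m => tendsto_schur_div_pow hz (fun p => (hC p.1 p.2).1) (fun p => (hC p.1 p.2).2)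
      (a := alpha σ ρ₁ ρ₂) (b := beta σ ρ₁ ρ₂)
      (c := fun r => ((n : ℂ) + 1 / 2) * theta σ ρ₁ ρ₂ r + k * vartheta σ ρ₁ ρ₂ r +
        l * zetaCoeff r + a r + γ * sCoeff r)
      (fun p r => by rw [xPlus]; ring) (fun p => by rw [alpha_one]) m)
    (fun γ m => tendsto_schur_div_pow hw (fun p => (hC' p.1 p.2).1) (fun p => (hC' p.1 p.2).2)
      (a := alpha σ ρ₁ ρ₂) (b := fun r => starRingEnd ℂ (beta σ ρ₁ ρ₂ r))
      (c := fun r => -((n : ℂ) + 1 / 2) * starRingEnd ℂ (theta σ ρ₁ ρ₂ r) -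
        k * starRingEnd ℂ (vartheta σ ρ₁ ρ₂ r) - l * zetaCoeff r + starRingEnd ℂ (a r) +
        γ * sCoeff r)
      (fun p r => by rw [xMinus]; ring) (fun p => by rw [alpha_one]) m)
  -- The integers `n`, `k`, `l` enter only the constant parts of `x_r^±`, so neither the
  -- normalization nor the limit depends on them.
  exact tendsto_ratio (pow_ne_zero 2 (det_inv_factorial_ne_zero N)) (key n k l) (key n' k' l')

theorem tendsto_sub_planeWave {q : ℝ × ℝ → ℂ} (c : ℂ)
    (hq : Filter.Tendsto q (Filter.cocompact (ℝ × ℝ)) (nhds 1)) :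
    Filter.Tendsto (fun p : ℝ × ℝ => c * q p * planeWave σ ρ₁ ρ₂ p.1 p.2 -
      c * planeWave σ ρ₁ ρ₂ p.1 p.2) (Filter.cocompact (ℝ × ℝ)) (nhds 0) := by
  refine tendsto_zero_iff_norm_tendsto_zero.mpr ?_
  have h := ((hq.sub_const 1).norm.const_mul ‖c‖)
  rw [sub_self, norm_zero, mul_zero] at h
  refine h.congr fun p => ?_
  rw [show c * q p * planeWave σ ρ₁ ρ₂ p.1 p.2 - c * planeWave σ ρ₁ ρ₂ p.1 p.2 =
    c * (q p - 1) * planeWave σ ρ₁ ρ₂ p.1 p.2 by ring, norm_mul, norm_mul, norm_planeWave, mul_one]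

theorem tendsto_rogueU_sub (h : Background σ ρ₁ ρ₂) (a : ℕ → ℂ) (N : ℕ) :
    Filter.Tendsto (fun p : ℝ × ℝ => rogueU σ ρ₁ ρ₂ a N p.1 p.2 - ρ₁ * planeWave σ ρ₁ ρ₂ p.1 p.2)
      (Filter.cocompact (ℝ × ℝ)) (nhds 0) := by
  refine tendsto_sub_planeWave (ρ₁ : ℂ) ?_
  simp only [conj_tauF]
  exact tendsto_tau_div_tau h a N (-1) 1 0 (-1) 0 0

theorem tendsto_rogueV_sub (h : Background σ ρ₁ ρ₂) (a : ℕ → ℂ) (N : ℕ) :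
    Filter.Tendsto (fun p : ℝ × ℝ => rogueV σ ρ₁ ρ₂ a N p.1 p.2 - ρ₂ * planeWave σ ρ₁ ρ₂ p.1 p.2)
      (Filter.cocompact (ℝ × ℝ)) (nhds 0) :=
  tendsto_sub_planeWave (ρ₂ : ℂ) (tendsto_tau_div_tau h a N (-1) 0 1 0 0 0)

end

end MassiveThirring

theorem theorem1 (σ ρ₁ ρ₂ : ℝ)
    (hσ : (σ = 1 ∧ -1 < ρ₁ * ρ₂ ∧ ρ₁ * ρ₂ < 0) ∨ (σ = -1 ∧ 0 < ρ₁ * ρ₂ ∧ ρ₁ * ρ₂ < 1))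
    (a : ℕ → ℂ) (N : ℕ) :
    -- `f^* = σ_{-1,0,0}`, and `f` has no zeros
    (∀ x t : ℝ, starRingEnd ℂ (MassiveThirring.tauF σ ρ₁ ρ₂ a N x t) =
      MassiveThirring.tau σ ρ₁ ρ₂ a N (-1) 0 0 x t) ∧
    (∀ x t : ℝ, MassiveThirring.tauF σ ρ₁ ρ₂ a N x t ≠ 0) ∧
    -- rationality: all the determinants are polynomials in `x` and `t`
    (∀ n k l : ℤ, MassiveThirring.IsPolynomialFun (MassiveThirring.tau σ ρ₁ ρ₂ a N n k l)) ∧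
    -- `(u, v)` solves the massive Thirring model on the whole plane
    MassiveThirring.IsSolution σ
      (MassiveThirring.rogueU σ ρ₁ ρ₂ a N) (MassiveThirring.rogueV σ ρ₁ ρ₂ a N) ∧
    -- localization in space and time on the plane-wave background
    Filter.Tendsto
      (fun p : ℝ × ℝ => MassiveThirring.rogueU σ ρ₁ ρ₂ a N p.1 p.2 -
        ρ₁ * MassiveThirring.planeWave σ ρ₁ ρ₂ p.1 p.2)
      (Filter.cocompact (ℝ × ℝ)) (nhds 0) ∧
    Filter.Tendsto
      (fun p : ℝ × ℝ => MassiveThirring.rogueV σ ρ₁ ρ₂ a N p.1 p.2 -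
        ρ₂ * MassiveThirring.planeWave σ ρ₁ ρ₂ p.1 p.2)
      (Filter.cocompact (ℝ × ℝ)) (nhds 0) := by
  have h := MassiveThirring.background_of_sign hσ
  exact ⟨MassiveThirring.conj_tauF a N, MassiveThirring.tauF_ne_zero h a N,
    MassiveThirring.isPolynomialFun_tau a N,
    MassiveThirring.isSolution_of_ne_zero h a N (MassiveThirring.tauF_ne_zero h a N),
    MassiveThirring.tendsto_rogueU_sub h a N, MassiveThirring.tendsto_rogueV_sub h a N⟩
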